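/- Let $p$ be a prime and $n\geqslant 1$. Let $\mathcal I$ be a nonzero proper ideal of $\mathbb Z_p[x_1,\dots,x_n]$ generated by monic monomials, and let $g=\sum_\omega a_\omega x^\omega\in\mathbb Z_p[x_1,\dots,x_n]$ be nonzero with $g(0)=0$. Let $\Gamma_g$ be the convex hull of $\bigcup_{a_\omega\neq0}(\omega+\mathbb R_{\geqslant0}^n)$ and $\Gamma_{\mathcal I}$ the convex hull of $\{\omega\in\mathbb N^n\mid x^\omega\in\mathcal I\}$. For $\Gamma\in\{\Gamma_{\mathcal I},\Gamma_g\}$ and $k\in\mathbb R_{\geqslant0}^n$ put $m_\Gamma(k)=\inf_{x\in\Gamma}k\cdot x$, $F_\Gamma(k)=\{x\in\Gamma\mid k\cdot x=m_\Gamma(k)\}$, and write $m_{\mathcal I}=m_{\Gamma_{\mathcal I}}$, $m_g=m_{\Gamma_g}$, $\sigma(k)=k_1+\dots+k_n$. A face of $\Gamma$ is $\Gamma$ itself or a nonempty intersection of $\Gamma$ with a supporting hyperplane; for a face $\tau$ of $\Gamma$ put $\Delta_\Gamma(\tau)=\{k\in\mathbb R_{\geqslant0}^n\mid F_\Gamma(k)=\tau\}$.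 For a face $\tau$ of $\Gamma_g$ put $g_\tau=\sum_{\omega\in\tau}a_\omega x^\omega$, and let $\bar g_\tau$ be its reduction modulo $p$. Assume that $g$ is non-degenerated over $\mathbb F_p$: for every face $\tau$ of $\Gamma_g$ (including $\Gamma_g$), $\bar g_\tau$ and all its partial derivatives have no common zero in $(\mathbb F_p^\times)^n$. Let $\Delta_{\mathcal I,g}$ be the set of all nonempty intersections $\delta=\Delta_{\Gamma_{\mathcal I}}(\tau)\cap\Delta_{\Gamma_g}(\tau')$ with $\tau$ a face of $\Gamma_{\mathcal I}$ and $\tau'$ a face of $\Gamma_g$; for such $\delta$ put $g_\delta=g_{\tau'}$ and $N_\delta=\#\{a\in(\mathbb F_p^\times)^n\mid\bar g_\delta(a)=0\}$. For $\operatorname{Re}(s)>0$ let $$Z_{\mathcal I,g}(s)=\int_{\mathbb Z_p^n}|\mathcal I(x)|^s\,|g(x)|\,|dx|,\qquad|\mathcal I(x)|=\max_{f\in\mathcal I}|f(x)|,$$ where $|dx|$ is the Haar measure with total mass one. Then: 1. $\Delta_{\mathcal I,g}$ is finite and, for $\operatorname{Re}(s)>0$, the integrand is integrable, the series $S_\delta$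 below converge absolutely, and $Z_{\mathcal I,g}(s)=\sum_{\delta\in\Delta_{\mathcal I,g}}L_\delta S_\delta(s)$ with $$L_\delta=p^{-n}\Bigl((p-1)^n-N_\delta\frac p{p+1}\Bigr),\qquad S_\delta(s)=\sum_{k\in\mathbb N^n\cap\delta}p^{-m_{\mathcal I}(k)s-m_g(k)-\sigma(k)}.$$ 2. For $\delta\in\Delta_{\mathcal I,g}$ there is a finite partition of $\delta$ into cones $\delta_i$, $i\in I$, where $\delta_i=\{\sum_j\lambda_jk_{i,j}\mid\lambda_j>0\}$ for linearly independent primitive vectors $k_{i,1},\dots,k_{i,r_i}\in\mathbb N^n$ (with $r_i=0$ giving $\{0\}$), in which every $k_{i,j}$ is the primitive generator of a ray (one-dimensional cone) in $\Delta_{\mathcal I,g}$, i.e. no new rays are introduced. For every finite partition of $\delta$ into cones strictly positively spanned by linearly independent primitive vectors of $\mathbb N^n$, whether or not it introduces new rays, and for $\operatorname{Re}(s)>0$, the denominators below are nonzero and $$S_\delta(s)=\sum_{i\in I}\frac{\sum_hp^{m_{\mathcal I}(h)s+m_g(h)+\sigma(h)}}{\prod_{j=1}^{r_i}\bigl(p^{m_{\mathcal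 I}(k_{i,j})s+m_g(k_{i,j})+\sigma(k_{i,j})}-1\bigr)},$$ where $h$ runs through $\mathbb Z^n\cap\{\sum_{j}\lambda_jk_{i,j}\mid0\leqslant\lambda_j<1\}$. In particular $S_\delta(s)$ is, for $\operatorname{Re}(s)>0$, a rational function of $p^{-s}$ with rational coefficients. 3. $Z_{\mathcal I,g}$ has a meromorphic continuation to $\mathbb C$, and each of its poles is a candidate pole, that is, a zero of $p^{m_{\mathcal I}(k)s+m_g(k)+\sigma(k)}-1$ for some primitive generator $k$ of a ray in $\Delta_{\mathcal I,g}$. The set of real parts of the candidate poles is exactly the set of the numbers $$-\frac{m_g(k)+\sigma(k)}{m_{\mathcal I}(k)}$$ with $k$ a primitive generator of a ray in $\Delta_{\mathcal I,g}$ and $m_{\mathcal I}(k)\neq0$, and these numbers are rational. -/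

import Mathlib

noncomputable section

namespace MonomialZeta

open MeasureTheory MvPolynomial

section Convex

variable {n : ℕ}

/-- The point of `ℝⁿ` given by an exponent `ω ∈ ℕⁿ`. -/
def expPt (ω : Fin n →₀ ℕ) : Fin n → ℝ := fun i => (ω i : ℝ)

/-- The point of `ℝⁿ` given by a vector of natural numbers. -/
def natPt (k : Fin n → ℕ) : Fin n → ℝ := fun i => (k i : ℝ)

/-- The point of `ℝⁿ` given by a vector of integers. -/
def intPt (k : Fin n → ℤ) : Fin n → ℝ := fun i => (k i : ℝ)

/-- `m_Γ(k) = inf_{x ∈ Γ} k·x`. -/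
def mVal (Γ : Set (Fin n → ℝ)) (k : Fin n → ℝ) : ℝ := sInf ((fun x => k ⬝ᵥ x) '' Γ)

/-- The first meet locus `F_Γ(k) = {x ∈ Γ | k·x = m_Γ(k)}`. -/
def firstMeetLocus (Γ : Set (Fin n → ℝ)) (k : Fin n → ℝ) : Set (Fin n → ℝ) :=
  {x ∈ Γ | k ⬝ᵥ x = mVal Γ k}

/-- A face of `Γ`: either `Γ` itself or the (nonempty) intersection of `Γ` with a supporting
hyperplane. (Taking the zero functional in `IsExposed` gives `Γ` itself.) -/
def IsFace (Γ τ : Set (Fin n → ℝ)) : Prop := τ.Nonempty ∧ IsExposed ℝ Γ τ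

/-- The cone associated to `τ`: all `k ∈ ℝ₊ⁿ` with first meet locus `τ`. -/
def dualCone (Γ τ : Set (Fin n → ℝ)) : Set (Fin n → ℝ) :=
  {k | (∀ i, 0 ≤ k i) ∧ firstMeetLocus Γ k = τ}

/-- The partition of `ℝ₊ⁿ` associated to two polyhedra: all nonempty intersections of a cone
associated to a face of `Γ` with a cone associated to a face of `Γ'`. -/
def conePartition (Γ Γ' : Set (Fin n → ℝ)) : Set (Set (Fin n → ℝ)) :=
  {δ | δ.Nonempty ∧ ∃ τ τ', IsFace Γ τ ∧ IsFace Γ' τ' ∧ δ = dualCone Γ τ ∩ dualCone Γ' τ'}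

/-- The face of `Γ` associated to `δ`: the common first meet locus of the elements of `δ`
(see `assocFace_eq`). -/
def assocFace (Γ δ : Set (Fin n → ℝ)) : Set (Fin n → ℝ) := ⋃ k ∈ δ, firstMeetLocus Γ k

/-- If `δ` is a nonempty intersection of the cones associated to `τ` and `τ'`,
then `τ'` is the associated face. -/
theorem assocFace_eq {Γ Γ' τ τ' δ : Set (Fin n → ℝ)} (hδ : δ.Nonempty)
    (h : δ = dualCone Γ τ ∩ dualCone Γ' τ') : assocFace Γ' δ = τ' := by
  obtain ⟨k, hk⟩ := hδ
  ext x
  simp only [assocFace, Set.mem_iUnion]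
  constructor
  · rintro ⟨l, hl, hx⟩
    rw [h] at hl
    rw [← hl.2.2]
    exact hx
  · intro hx
    refine ⟨k, hk, ?_⟩
    rw [h] at hk
    rw [hk.2.2]
    exact hx

/-- `σ(k)`, the sum of the coordinates of `k`. -/
def sigma (k : Fin n → ℝ) : ℝ := ∑ i, k i

/-- A primitive vector of `ℕⁿ`: the greatest common divisor of its components is one. -/
def IsPrimitive (k : Fin n → ℕ) : Prop := Finset.univ.gcd k = 1

/-- The cone strictly positively spanned by a finite set of vectors of `ℕⁿ`. -/
def openCone (B : Finset (Fin n → ℕ)) : Set (Fin n → ℝ) :=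
  {x | ∃ l : (Fin n → ℕ) → ℝ, (∀ k ∈ B, 0 < l k) ∧ x = ∑ k ∈ B, l k • natPt k}

/-- The integral points `∑ λ_k k` with `0 ≤ λ_k < 1`. -/
def boxPoints (B : Finset (Fin n → ℕ)) : Set (Fin n → ℤ) :=
  {h | ∃ l : (Fin n → ℕ) → ℝ, (∀ k ∈ B, 0 ≤ l k ∧ l k < 1) ∧ intPt h = ∑ k ∈ B, l k • natPt k}

theorem boxPoints_finite (B : Finset (Fin n → ℕ)) : (boxPoints B).Finite := by
  refine (Set.finite_Icc (0 : Fin n → ℤ) (fun i => ∑ k ∈ B, (k i : ℤ))).subset ?_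
  rintro h ⟨l, hl, hh⟩
  have key : ∀ i, (h i : ℝ) = ∑ k ∈ B, l k * (k i : ℝ) := by
    intro i
    have := congrFun hh i
    simpa [intPt, natPt, Finset.sum_apply] using this
  refine ⟨fun i => ?_, fun i => ?_⟩
  · have : (0 : ℝ) ≤ (h i : ℝ) := by
      rw [key i]
      exact Finset.sum_nonneg fun k hk => mul_nonneg (hl k hk).1 (Nat.cast_nonneg _)
    exact_mod_cast this
  · have : (h i : ℝ) ≤ ((∑ k ∈ B, (k i : ℤ) : ℤ) : ℝ) := by
      rw [key i]
      push_cast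
      exact Finset.sum_le_sum fun k hk =>
        mul_le_of_le_one_left (Nat.cast_nonneg _) (hl k hk).2.le
    exact_mod_cast this

/-- A finite partition of `δ` into rational simplicial cones. Each member `B` of `T` is the set of
primitive, linearly independent generators of one of the cones. -/
structure IsSimplicialPartition (δ : Set (Fin n → ℝ)) (T : Finset (Finset (Fin n → ℕ))) :
    Prop where
  primitive : ∀ B ∈ T, ∀ k ∈ B, IsPrimitive k
  linearIndependent : ∀ B ∈ T, LinearIndependent ℝ (fun k : B => natPt (k : Fin n → ℕ))
  pairwiseDisjoint : (T : Set (Finset (Fin n → ℕ))).PairwiseDisjoint openCone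
  iUnion_eq : ⋃ B ∈ T, openCone B = δ

/-- `k` is the primitive generator of a ray (a one-dimensional cone) of the family `D`. -/
def IsRayGenerator (D : Set (Set (Fin n → ℝ))) (k : Fin n → ℕ) : Prop :=
  IsPrimitive k ∧ openCone {k} ∈ D

end Convex

section Arithmetic

variable {p : ℕ} [Fact p.Prime] {n : ℕ}

instance : MeasurableSpace ℤ_[p] := borel _

instance : BorelSpace ℤ_[p] := ⟨rfl⟩

variable (p n) in
/-- The Haar measure on `ℤ_pⁿ` of total mass one. -/
def haar : Measure (Fin n → ℤ_[p]) := Measure.addHaarMeasure ⊤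

/-- A monomial ideal: an ideal that can be generated by monic monomials. -/
def IsMonomialIdeal (I : Ideal (MvPolynomial (Fin n) ℤ_[p])) : Prop :=
  ∃ S : Set (Fin n →₀ ℕ), I = Ideal.span ((fun ω => monomial ω (1 : ℤ_[p])) '' S)

/-- The Newton polyhedron of a polynomial: the convex hull of `⋃_{ω ∈ supp g} (ω + ℝ₊ⁿ)`. -/
def newton (g : MvPolynomial (Fin n) ℤ_[p]) : Set (Fin n → ℝ) :=
  convexHull ℝ (⋃ ω ∈ g.support, {x | ∀ i, expPt ω i ≤ x i})

/-- The Newton polyhedron of a monomial ideal: the convex hull of the exponents of the monomials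
that it contains. -/
def newtonIdeal (I : Ideal (MvPolynomial (Fin n) ℤ_[p])) : Set (Fin n → ℝ) :=
  convexHull ℝ (expPt '' {ω | monomial ω (1 : ℤ_[p]) ∈ I})

open Classical in
/-- `g_τ`, the sum of the terms of `g` whose exponents lie in `τ`. -/
def facePoly (g : MvPolynomial (Fin n) ℤ_[p]) (τ : Set (Fin n → ℝ)) :
    MvPolynomial (Fin n) ℤ_[p] :=
  ∑ ω ∈ g.support with expPt ω ∈ τ, monomial ω (g.coeff ω)

/-- Reduction of the coefficients modulo `p`. -/
def red (g : MvPolynomial (Fin n) ℤ_[p]) : MvPolynomial (Fin n) (ZMod p) :=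
  MvPolynomial.map PadicInt.toZMod g

/-- The value at a point of the torus `(𝔽_p^×)ⁿ`. -/
def torusEval (a : Fin n → (ZMod p)ˣ) (f : MvPolynomial (Fin n) (ZMod p)) : ZMod p :=
  MvPolynomial.eval (fun i => (a i : ZMod p)) f

/-- `g` is non-degenerated over `𝔽_p` with respect to all the faces of its Newton polyhedron. -/
def NonDegenerated (g : MvPolynomial (Fin n) ℤ_[p]) : Prop :=
  ∀ τ, IsFace (newton g) τ → ∀ a : Fin n → (ZMod p)ˣ,
    ¬ (torusEval a (red (facePoly g τ)) = 0 ∧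
      ∀ i, torusEval a (pderiv i (red (facePoly g τ))) = 0)

/-- `|I(x)| = max {|f(x)| : f ∈ I}` (a maximum by `isGreatest_idealNorm`). -/
def idealNorm (I : Ideal (MvPolynomial (Fin n) ℤ_[p])) (x : Fin n → ℤ_[p]) : ℝ :=
  sSup ((fun f => ‖eval x f‖) '' (I : Set (MvPolynomial (Fin n) ℤ_[p])))

theorem isGreatest_idealNorm (I : Ideal (MvPolynomial (Fin n) ℤ_[p])) (x : Fin n → ℤ_[p]) :
    IsGreatest ((fun f => ‖eval x f‖) '' (I : Set (MvPolynomial (Fin n) ℤ_[p])))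
      (idealNorm I x) := by
  suffices h : ∃ f ∈ I, ∀ f' ∈ I, ‖eval x f'‖ ≤ ‖eval x f‖ by
    obtain ⟨f, hf, hmax⟩ := h
    have hg : IsGreatest ((fun f => ‖eval x f‖) '' (I : Set (MvPolynomial (Fin n) ℤ_[p])))
        ‖eval x f‖ := by
      refine ⟨⟨f, hf, rfl⟩, ?_⟩
      rintro _ ⟨f', hf', rfl⟩
      exact hmax f' hf'
    rw [idealNorm, hg.csSup_eq]
    exact hg
  obtain ⟨c, hc⟩ := (IsPrincipalIdealRing.principal (Ideal.map (eval x) I)).principal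
  have hcm : c ∈ Ideal.map (eval x) I := by
    rw [hc]
    exact Submodule.mem_span_singleton_self c
  rw [Ideal.mem_map_iff_of_surjective (eval x) (fun a => ⟨C a, eval_C a⟩)] at hcm
  obtain ⟨f, hf, hfc⟩ := hcm
  refine ⟨f, hf, fun f' hf' => ?_⟩
  have hm : eval x f' ∈ Ideal.map (eval x) I := Ideal.mem_map_of_mem _ hf'
  rw [hc] at hm
  obtain ⟨d, hd⟩ := Submodule.mem_span_singleton.mp hm
  rw [← hd, hfc, smul_eq_mul, norm_mul]
  exact mul_le_of_le_one_left (norm_nonneg _) (PadicInt.norm_le_one d)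

/-- The integrand `|I(x)|^s |g(x)|`. -/
def zetaIntegrand (I : Ideal (MvPolynomial (Fin n) ℤ_[p])) (g : MvPolynomial (Fin n) ℤ_[p])
    (s : ℂ) (x : Fin n → ℤ_[p]) : ℂ :=
  (idealNorm I x : ℂ) ^ s * (‖eval x g‖ : ℂ)

/-- Igusa's local zeta function of `I` with measure `|g(x)||dx|`, used for `Re s > 0`. -/
def zeta (I : Ideal (MvPolynomial (Fin n) ℤ_[p])) (g : MvPolynomial (Fin n) ℤ_[p]) (s : ℂ) : ℂ :=
  ∫ x, zetaIntegrand I g s x ∂(haar p n)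

/-- The partition of `ℝ₊ⁿ` associated to `I` and `g`. -/
def cones (I : Ideal (MvPolynomial (Fin n) ℤ_[p])) (g : MvPolynomial (Fin n) ℤ_[p]) :
    Set (Set (Fin n → ℝ)) :=
  conePartition (newtonIdeal I) (newton g)

/-- `g_δ`. -/
def conePoly (g : MvPolynomial (Fin n) ℤ_[p]) (δ : Set (Fin n → ℝ)) :
    MvPolynomial (Fin n) ℤ_[p] :=
  facePoly g (assocFace (newton g) δ)

/-- `N_δ`, the number of zeros on the torus `(𝔽_p^×)ⁿ` of the reduction of `g_δ`. -/
def torusZeros (g : MvPolynomial (Fin n) ℤ_[p]) (δ : Set (Fin n → ℝ)) : ℕ :=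
  Nat.card {a : Fin n → (ZMod p)ˣ // torusEval a (red (conePoly g δ)) = 0}

/-- `L_δ = p^{-n} ((p-1)^n - N_δ p/(p+1))`. -/
def L (g : MvPolynomial (Fin n) ℤ_[p]) (δ : Set (Fin n → ℝ)) : ℂ :=
  ((p : ℂ) ^ n)⁻¹ * (((p : ℂ) - 1) ^ n - (torusZeros g δ : ℂ) * ((p : ℂ) / ((p : ℂ) + 1)))

/-- The exponent `m_I(k) s + m_g(k) + σ(k)`. -/
def expo (I : Ideal (MvPolynomial (Fin n) ℤ_[p])) (g : MvPolynomial (Fin n) ℤ_[p]) (s : ℂ)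
    (k : Fin n → ℝ) : ℂ :=
  (mVal (newtonIdeal I) k : ℂ) * s + (mVal (newton g) k : ℂ) + (sigma k : ℂ)

/-- The term `p^{-m_I(k) s - m_g(k) - σ(k)}` of `S_δ`, for `k ∈ ℕⁿ ∩ δ`. -/
def STerm (I : Ideal (MvPolynomial (Fin n) ℤ_[p])) (g : MvPolynomial (Fin n) ℤ_[p])
    (δ : Set (Fin n → ℝ)) (s : ℂ) (k : {k : Fin n → ℕ // natPt k ∈ δ}) : ℂ :=
  (p : ℂ) ^ (-expo I g s (natPt k.1))

/-- `S_δ`, as a series. -/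
def S (I : Ideal (MvPolynomial (Fin n) ℤ_[p])) (g : MvPolynomial (Fin n) ℤ_[p])
    (δ : Set (Fin n → ℝ)) (s : ℂ) : ℂ :=
  ∑' k, STerm I g δ s k

/-- The closed expression attached to a simplicial partition `T`. -/
def SClosed (I : Ideal (MvPolynomial (Fin n) ℤ_[p])) (g : MvPolynomial (Fin n) ℤ_[p])
    (T : Finset (Finset (Fin n → ℕ))) (s : ℂ) : ℂ :=
  ∑ B ∈ T, (∑ h ∈ (boxPoints_finite B).toFinset, (p : ℂ) ^ expo I g s (intPt h)) /
    ∏ k ∈ B, ((p : ℂ) ^ expo I g s (natPt k) - 1)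

/-- The candidate poles: the zeros of the factors `p^{m_I(k) s + m_g(k) + σ(k)} - 1`, with `k` a
primitive generator of a ray of the partition associated to `I` and `g`. -/
def candidatePoles (I : Ideal (MvPolynomial (Fin n) ℤ_[p])) (g : MvPolynomial (Fin n) ℤ_[p]) :
    Set ℂ :=
  {s | ∃ k : Fin n → ℕ, IsRayGenerator (cones I g) k ∧ (p : ℂ) ^ expo I g s (natPt k) - 1 = 0}

end Arithmetic

end MonomialZeta

end

/-! Up to a null set the coordinates of `x` are nonzero, and such `x` fall into shells indexed by `k
= ord x ∈ ℕⁿ`. Write `x_i = p^{k_i} u_i` with units `u_i`. A monomial has constant absolute value on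
a shell, so `|I(x)| = p^{-m_I(k)}`. Moreover `g(x) = p^{m_g(k)} g̃(u)`, where `g̃` is congruent
modulo `p` to `g_τ` with `τ` the first meet locus of `k`. Fix the residue `a` of `u`. If `ḡ_τ(a) ≠
0`, then `|g| = p^{-m_g(k)}`. Otherwise non-degeneracy supplies a nonvanishing partial derivative,
and by Hensel `g` behaves like `t - α` in that direction, which gives `|g|` the mean value
`p^{-m_g(k)}/(p+1)`. Summing over `a` yields `L_δ`, and grouping the shells by the cone `δ`
containing `k` yields the formula (`integral_torusClass_of_eq_zero`, `integral_shell`,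
`hasSum_zeta`, `zeta_eq_finsum`).

The closure of `δ` is a rational polyhedral cone in the orthant, spanned by its rays
(`mem_span_rays`). Among the nonnegative representations of a point over these rays take the
lexicographically smallest. Its support is linearly independent, and minimality depends on the
support alone, so the open cones on the minimal supports are disjoint and cover everything. Those
meeting `δ` partition it without new rays (`IsLexMin.linearIndependent`, `IsLexMin.of_support_eq`,
`exists_isSimplicialPartition`).

On a simplicial cone inside `δ` both functions `m` are linear (`exists_mVal_linear`), and its
lattice points are uniquely `∑ (m_b + 1) b - h` with `h` in the box (`bijective_openCone`). The
series thus becomes a finite sum times a product of geometric series (`hasSum_openCone`).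

The resulting expression is meromorphic on `ℂ` and analytic where no denominator vanishes. The
identity theorem carries this to every continuation (`eventuallyEq_of_eqOn_re_pos`), and `p^z = 1`
forces `Re z = 0`, which gives the real parts. -/

noncomputable section

namespace MonomialZeta

open MeasureTheory MvPolynomial

/-! ### First meet loci of Newton polyhedra and the finite partition of the orthant. -/

section Polyhedra

variable {n : ℕ}

/-- `Γ` is the polyhedron `conv(A) + ℝ₊ⁿ`, given by the properties of it that are needed. -/
structure IsNewton (Γ : Set (Fin n → ℝ)) (A : Finset (Fin n → ℕ)) : Prop where
  nonempty : A.Nonempty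
  mem : ∀ a ∈ A, natPt a ∈ Γ
  add_single_mem : ∀ a ∈ A, ∀ i, natPt a + Pi.single i 1 ∈ Γ
  exists_le : ∀ x ∈ Γ, ∃ w : (Fin n → ℕ) → ℝ, (∀ a ∈ A, 0 ≤ w a) ∧ ∑ a ∈ A, w a = 1 ∧
    ∑ a ∈ A, w a • natPt a ≤ x

theorem dotProduct_natPt (k a : Fin n → ℕ) :
    natPt k ⬝ᵥ natPt a = ((∑ i, k i * a i : ℕ) : ℝ) := by
  simp [dotProduct, natPt]

theorem natPt_nonneg (k : Fin n → ℕ) (i : Fin n) : 0 ≤ natPt k i := Nat.cast_nonneg _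

theorem natPt_injective : Function.Injective (natPt : (Fin n → ℕ) → Fin n → ℝ) := by
  intro a b h
  ext i
  have := congrFun h i
  simpa [natPt] using this

theorem mVal_eq_of_forall_le {Γ : Set (Fin n → ℝ)} {k x : Fin n → ℝ} (hx : x ∈ Γ)
    (h : ∀ y ∈ Γ, k ⬝ᵥ x ≤ k ⬝ᵥ y) : mVal Γ k = k ⬝ᵥ x := by
  have : IsLeast ((fun x => k ⬝ᵥ x) '' Γ) (k ⬝ᵥ x) := by
    refine ⟨⟨x, hx, rfl⟩, ?_⟩
    rintro _ ⟨y, hy, rfl⟩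
    exact h y hy
  exact this.csInf_eq

namespace IsNewton

variable {Γ : Set (Fin n → ℝ)} {A : Finset (Fin n → ℕ)} (hΓ : IsNewton Γ A)
include hΓ

theorem exists_mVal_eq {k : Fin n → ℝ} (hk : ∀ i, 0 ≤ k i) :
    ∃ a ∈ A, mVal Γ k = k ⬝ᵥ natPt a ∧ ∀ y ∈ Γ, mVal Γ k ≤ k ⬝ᵥ y := by
  obtain ⟨a, ha, hmin⟩ := A.exists_min_image (fun a => k ⬝ᵥ natPt a) hΓ.nonempty
  have key : ∀ y ∈ Γ, k ⬝ᵥ natPt a ≤ k ⬝ᵥ y := by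
    intro y hy
    obtain ⟨w, hw, hw1, hle⟩ := hΓ.exists_le y hy
    calc k ⬝ᵥ natPt a = ∑ b ∈ A, w b * (k ⬝ᵥ natPt a) := by rw [← Finset.sum_mul, hw1, one_mul]
      _ ≤ ∑ b ∈ A, w b * (k ⬝ᵥ natPt b) :=
          Finset.sum_le_sum fun b hb => mul_le_mul_of_nonneg_left (hmin b hb) (hw b hb)
      _ = k ⬝ᵥ ∑ b ∈ A, w b • natPt b := by simp [dotProduct_sum, dotProduct_smul]
      _ ≤ k ⬝ᵥ y := dotProduct_le_dotProduct_of_nonneg_left hle hk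
  have := mVal_eq_of_forall_le (hΓ.mem a ha) key
  exact ⟨a, ha, this, fun y hy => this ▸ key y hy⟩

theorem mVal_le {k : Fin n → ℝ} (hk : ∀ i, 0 ≤ k i) {y : Fin n → ℝ} (hy : y ∈ Γ) :
    mVal Γ k ≤ k ⬝ᵥ y := by
  obtain ⟨a, -, -, h⟩ := hΓ.exists_mVal_eq hk
  exact h y hy

theorem exists_mem_locus {k : Fin n → ℝ} (hk : ∀ i, 0 ≤ k i) :
    ∃ a ∈ A, natPt a ∈ firstMeetLocus Γ k := by
  obtain ⟨a, ha, h, -⟩ := hΓ.exists_mVal_eq hk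
  exact ⟨a, ha, hΓ.mem a ha, h.symm⟩

theorem isFace_firstMeetLocus {k : Fin n → ℝ} (hk : ∀ i, 0 ≤ k i) :
    IsFace Γ (firstMeetLocus Γ k) := by
  obtain ⟨a, ha, h⟩ := hΓ.exists_mem_locus hk
  -- `IsExposed` maximises a functional, hence the sign: `-k` exposes the locus where `k` is
  -- minimal.
  refine ⟨⟨_, h⟩, fun _ => ⟨LinearMap.toContinuousLinearMap
    (-(dotProductBilin ℝ ℝ k) : (Fin n → ℝ) →ₗ[ℝ] ℝ), ?_⟩⟩
  ext x
  constructor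
  · rintro ⟨hx, hxk⟩
    refine ⟨hx, fun y hy => ?_⟩
    have := hΓ.mVal_le hk hy
    simpa [hxk] using this
  · rintro ⟨hx, hxk⟩
    refine ⟨hx, le_antisymm ?_ (hΓ.mVal_le hk hx)⟩
    have := hxk _ h.1
    rw [← h.2]
    simpa using this

theorem add_single_mem_locus {k : Fin n → ℝ} {i : Fin n} (hi : k i = 0) {a : Fin n → ℕ}
    (ha : a ∈ A) (h : natPt a ∈ firstMeetLocus Γ k) :
    natPt a + Pi.single i 1 ∈ firstMeetLocus Γ k := by
  refine ⟨hΓ.add_single_mem a ha i, ?_⟩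
  rw [dotProduct_add, h.2]
  simp [hi]

/-- A point `x` of `Γ` dominates a convex combination `y` of `A`. If `x` minimises `k`, then all
weight of `y` sits on minimisers in `A`, and `x` exceeds `y` only in directions with `k i = 0`.
Conversely, the points `a + e_i` let the locus detect where `k` vanishes. A locus is thus encoded by
finite data. -/
theorem locus_subset_iff {k l : Fin n → ℝ} (hk : ∀ i, 0 ≤ k i) :
    firstMeetLocus Γ k ⊆ firstMeetLocus Γ l ↔
      (∀ a ∈ A, natPt a ∈ firstMeetLocus Γ k → natPt a ∈ firstMeetLocus Γ l) ∧
      ∀ i, k i = 0 → l i = 0 := by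
  constructor
  · intro h
    refine ⟨fun a _ hak => h hak, fun i hi => ?_⟩
    obtain ⟨a, ha, hak⟩ := hΓ.exists_mem_locus hk
    have h1 := (h hak).2
    have h2 := (h (hΓ.add_single_mem_locus hi ha hak)).2
    rw [dotProduct_add, h1] at h2
    simpa using h2
  · rintro ⟨hA, h0⟩ x ⟨hx, hxk⟩
    refine ⟨hx, ?_⟩
    obtain ⟨w, hw, hw1, hle⟩ := hΓ.exists_le x hx
    set y := ∑ a ∈ A, w a • natPt a with hy
    have hdot : ∀ v : Fin n → ℝ, v ⬝ᵥ y = ∑ a ∈ A, w a * (v ⬝ᵥ natPt a) := by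
      intro v
      simp [hy, dotProduct_sum, dotProduct_smul]
    have hsplit : ∀ v : Fin n → ℝ, v ⬝ᵥ x = v ⬝ᵥ y + ∑ i, v i * (x i - y i) := by
      intro v
      simp only [dotProduct, ← Finset.sum_add_distrib]
      exact Finset.sum_congr rfl fun i _ => by ring
    have hterm : ∀ i ∈ Finset.univ, 0 ≤ k i * (x i - y i) := fun i _ =>
      mul_nonneg (hk i) (sub_nonneg.2 (hle i))
    have hsum_nonneg := Finset.sum_nonneg hterm
    have hterm2 : ∀ a ∈ A, 0 ≤ w a * (k ⬝ᵥ natPt a - mVal Γ k) := fun a ha =>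
      mul_nonneg (hw a ha) (sub_nonneg.2 (hΓ.mVal_le hk (hΓ.mem a ha)))
    have hsum2_nonneg := Finset.sum_nonneg hterm2
    have heq : ∑ a ∈ A, w a * (k ⬝ᵥ natPt a - mVal Γ k) = k ⬝ᵥ y - mVal Γ k := by
      simp only [mul_sub, Finset.sum_sub_distrib, ← Finset.sum_mul, hw1, hdot, one_mul]
    have hsp := hsplit k
    have hz1 : ∑ i, k i * (x i - y i) = 0 := by linarith
    have hz2 : ∑ a ∈ A, w a * (k ⬝ᵥ natPt a - mVal Γ k) = 0 := by linarith
    rw [Finset.sum_eq_zero_iff_of_nonneg hterm] at hz1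
    rw [Finset.sum_eq_zero_iff_of_nonneg hterm2] at hz2
    rw [hsplit l, hdot]
    have e1 : ∑ i, l i * (x i - y i) = 0 := by
      refine Finset.sum_eq_zero fun i hi => ?_
      rcases mul_eq_zero.1 (hz1 i hi) with h | h
      · simp [h0 i h]
      · simp [h]
    have e2 : ∑ a ∈ A, w a * (l ⬝ᵥ natPt a) = ∑ a ∈ A, w a * mVal Γ l := by
      refine Finset.sum_congr rfl fun a ha => ?_
      rcases mul_eq_zero.1 (hz2 a ha) with h | h
      · simp [h]
      · rw [(hA a ha ⟨hΓ.mem a ha, by linarith⟩).2]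
    rw [e1, e2, ← Finset.sum_mul, hw1]
    ring

theorem locus_eq_iff {k l : Fin n → ℝ} (hk : ∀ i, 0 ≤ k i) (hl : ∀ i, 0 ≤ l i) :
    firstMeetLocus Γ k = firstMeetLocus Γ l ↔
      (∀ a ∈ A, natPt a ∈ firstMeetLocus Γ k ↔ natPt a ∈ firstMeetLocus Γ l) ∧
      ∀ i, k i = 0 ↔ l i = 0 := by
  rw [Set.Subset.antisymm_iff, hΓ.locus_subset_iff hk, hΓ.locus_subset_iff hl]
  constructor
  · rintro ⟨⟨h1, h2⟩, h3, h4⟩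
    exact ⟨fun a ha => ⟨h1 a ha, h3 a ha⟩, fun i => ⟨h2 i, h4 i⟩⟩
  · rintro ⟨h1, h2⟩
    exact ⟨⟨fun a ha => (h1 a ha).1, fun i => (h2 i).1⟩, fun a ha => (h1 a ha).2,
      fun i => (h2 i).2⟩

theorem exists_nat_mVal (k : Fin n → ℕ) : ∃ m : ℕ, mVal Γ (natPt k) = m := by
  obtain ⟨a, -, h, -⟩ := hΓ.exists_mVal_eq (natPt_nonneg k)
  exact ⟨_, h.trans (dotProduct_natPt k a)⟩

theorem mVal_nonneg {k : Fin n → ℝ} (hk : ∀ i, 0 ≤ k i) : 0 ≤ mVal Γ k := by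
  obtain ⟨a, -, h, -⟩ := hΓ.exists_mVal_eq hk
  rw [h]
  exact dotProduct_nonneg_of_nonneg hk (natPt_nonneg a)

end IsNewton

/-- The member of the partition of `ℝ₊ⁿ` that contains `k`. -/
def cell (Γ Γ' : Set (Fin n → ℝ)) (k : Fin n → ℝ) : Set (Fin n → ℝ) :=
  dualCone Γ (firstMeetLocus Γ k) ∩ dualCone Γ' (firstMeetLocus Γ' k)

theorem mem_cell_iff {Γ Γ' : Set (Fin n → ℝ)} {k l : Fin n → ℝ} : l ∈ cell Γ Γ' k ↔
    (∀ i, 0 ≤ l i) ∧ firstMeetLocus Γ l = firstMeetLocus Γ k ∧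
      firstMeetLocus Γ' l = firstMeetLocus Γ' k := by
  constructor
  · rintro ⟨⟨h0, h1⟩, -, h2⟩
    exact ⟨h0, h1, h2⟩
  · rintro ⟨h0, h1, h2⟩
    exact ⟨⟨h0, h1⟩, h0, h2⟩

theorem mem_cell_self {Γ Γ' : Set (Fin n → ℝ)} {k : Fin n → ℝ} (hk : ∀ i, 0 ≤ k i) :
    k ∈ cell Γ Γ' k := mem_cell_iff.2 ⟨hk, rfl, rfl⟩

theorem nonneg_of_mem_conePartition {Γ Γ' δ : Set (Fin n → ℝ)} (hδ : δ ∈ conePartition Γ Γ')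
    {k : Fin n → ℝ} (hk : k ∈ δ) : ∀ i, 0 ≤ k i := by
  obtain ⟨-, τ, τ', -, -, rfl⟩ := hδ
  exact hk.1.1

/-- Any one of its points determines a member of the family, so distinct members are disjoint. -/
theorem eq_cell_of_mem {Γ Γ' δ : Set (Fin n → ℝ)} (hδ : δ ∈ conePartition Γ Γ')
    {k : Fin n → ℝ} (hk : k ∈ δ) : δ = cell Γ Γ' k := by
  obtain ⟨-, τ, τ', -, -, rfl⟩ := hδ
  rw [cell, hk.1.2, hk.2.2]

theorem cell_mem_conePartition {Γ Γ' : Set (Fin n → ℝ)} {A A' : Finset (Fin n → ℕ)}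
    (hΓ : IsNewton Γ A) (hΓ' : IsNewton Γ' A') {k : Fin n → ℝ} (hk : ∀ i, 0 ≤ k i) :
    cell Γ Γ' k ∈ conePartition Γ Γ' :=
  ⟨⟨k, mem_cell_self hk⟩, _, _, hΓ.isFace_firstMeetLocus hk, hΓ'.isFace_firstMeetLocus hk, rfl⟩

theorem assocFace_cell {Γ Γ' : Set (Fin n → ℝ)} {k : Fin n → ℝ} (hk : ∀ i, 0 ≤ k i) :
    assocFace Γ' (cell Γ Γ' k) = firstMeetLocus Γ' k :=
  assocFace_eq ⟨k, mem_cell_self hk⟩ rfl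

/-- By `locus_eq_iff` the cell of `k` depends only on which points of `A` and `A'` are minimal for
`k` and on which coordinates of `k` vanish. -/
theorem conePartition_finite {Γ Γ' : Set (Fin n → ℝ)} {A A' : Finset (Fin n → ℕ)}
    (hΓ : IsNewton Γ A) (hΓ' : IsNewton Γ' A') : (conePartition Γ Γ').Finite := by
  classical
  let f : (Fin n → ℝ) → Finset (Fin n → ℕ) × Finset (Fin n → ℕ) × Finset (Fin n) := fun k =>
    (A.filter fun a => natPt a ∈ firstMeetLocus Γ k,
      A'.filter fun a => natPt a ∈ firstMeetLocus Γ' k, Finset.univ.filter fun i => k i = 0)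
  have key : ∀ k l : Fin n → ℝ, (∀ i, 0 ≤ k i) → (∀ i, 0 ≤ l i) → f k = f l →
      cell Γ Γ' k = cell Γ Γ' l := by
    intro k l hk hl h
    simp only [f, Prod.mk.injEq, Finset.filter_inj', Finset.mem_univ, true_imp_iff] at h
    rw [cell, cell, (hΓ.locus_eq_iff hk hl).2 ⟨fun a ha => h.1 ha, fun i => @h.2.2 i⟩,
      (hΓ'.locus_eq_iff hk hl).2 ⟨fun a ha => h.2.1 ha, fun i => @h.2.2 i⟩]
  have hne : ∀ δ : conePartition Γ Γ', ∃ k, k ∈ δ.1 := fun δ => δ.2.1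
  choose c hc using hne
  have hfin : (Set.range fun δ : conePartition Γ Γ' => f (c δ)).Finite := by
    refine (Set.Finite.prod (A.powerset.finite_toSet)
      (Set.Finite.prod (A'.powerset.finite_toSet) (Set.finite_univ (α := Finset (Fin n))))).subset ?_
    rintro _ ⟨δ, rfl⟩
    simp only [f, Set.mem_prod, Finset.mem_coe, Finset.mem_powerset, Finset.filter_subset,
      Set.mem_univ, and_self]
  have hinj : Function.Injective fun δ : conePartition Γ Γ' => f (c δ) := by
    intro δ ε h
    apply Subtype.ext
    rw [eq_cell_of_mem δ.2 (hc δ), eq_cell_of_mem ε.2 (hc ε)]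
    exact key _ _ (nonneg_of_mem_conePartition δ.2 (hc δ))
      (nonneg_of_mem_conePartition ε.2 (hc ε)) h
  have : Finite (conePartition Γ Γ') := by
    have := hfin.to_subtype
    exact Finite.of_injective (Set.rangeFactorization fun δ : conePartition Γ Γ' => f (c δ))
      (Set.rangeFactorization_injective.2 hinj)
  exact Set.toFinite _

end Polyhedra

/-! ### Rational polyhedral cones in the orthant are spanned by their primitive ray vectors. -/

section Rays

variable {n : ℕ}

theorem exists_pos_of_isPrimitive {v : Fin n → ℕ} (hv : IsPrimitive v) : ∃ i, 0 < v i := by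
  by_contra! h
  have : Finset.univ.gcd v = 0 := Finset.gcd_eq_zero_iff.2 fun i _ => Nat.le_zero.1 (h i)
  rw [IsPrimitive, this] at hv
  exact zero_ne_one hv

/-- Proportionality gives `v i * w j = w i * v j` for all `j`; the gcd over `j` of the two sides is
`v i` and `w i`. -/
theorem eq_of_isPrimitive_of_smul {v w : Fin n → ℕ} (hv : IsPrimitive v) (hw : IsPrimitive w)
    {t : ℝ} (h : natPt w = t • natPt v) : w = v := by
  obtain ⟨i, hi⟩ := exists_pos_of_isPrimitive hv
  have hc : ∀ j, (w j : ℝ) = t * v j := fun j => by simpa [natPt] using congrFun h j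
  have hcross : (fun j => v i * w j) = fun j => w i * v j := by
    ext j
    have : (v i : ℝ) * w j = w i * v j := by rw [hc, hc]; ring
    exact_mod_cast this
  have h1 : Finset.univ.gcd (fun j => v i * w j) = v i := by
    rw [Finset.gcd_mul_left, hw]
    simp
  have h2 : Finset.univ.gcd (fun j => w i * v j) = w i := by
    rw [Finset.gcd_mul_left, hv]
    simp
  have h3 : v i = w i := by rw [← h1, hcross, h2]
  ext j
  have := congrFun hcross j
  simp only [← h3] at this
  exact Nat.eq_of_mul_eq_mul_left hi this

/-- A primitive generator of a ray of the cone `{x | c·x ≥ 0 for c ∈ Φ}`: the constraints that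
are active at `v` determine the line through `v`. -/
structure IsRayVec (Φ : Finset (Fin n → ℤ)) (v : Fin n → ℕ) : Prop where
  primitive : IsPrimitive v
  nonneg : ∀ c ∈ Φ, 0 ≤ intPt c ⬝ᵥ natPt v
  line : ∀ y : Fin n → ℝ, (∀ c ∈ Φ, intPt c ⬝ᵥ natPt v = 0 → intPt c ⬝ᵥ y = 0) →
    ∃ t : ℝ, y = t • natPt v

/-- The set of active constraints determines the line, hence the primitive vector, and `Φ` has
finitely many subsets. -/
theorem finite_isRayVec (Φ : Finset (Fin n → ℤ)) : {v | IsRayVec Φ v}.Finite := by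
  classical
  let f : (Fin n → ℕ) → Finset (Fin n → ℤ) := fun v => Φ.filter fun c => intPt c ⬝ᵥ natPt v = 0
  refine Set.Finite.of_finite_image (f := f) (Φ.powerset.finite_toSet.subset ?_) ?_
  · rintro _ ⟨v, -, rfl⟩
    simp only [f, Finset.mem_coe, Finset.mem_powerset, Finset.filter_subset]
  · intro v hv w hw h
    obtain ⟨t, ht⟩ := hv.line (natPt w) fun c hc h0 => by
      have : c ∈ f w := h ▸ Finset.mem_filter.2 ⟨hc, h0⟩
      exact (Finset.mem_filter.1 this).2
    exact (eq_of_isPrimitive_of_smul hv.primitive hw.primitive ht).symm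

/-- A real line cut out by integral equations has a primitive integral generator. -/
theorem exists_isPrimitive_of_line {Φ : Finset (Fin n → ℤ)} {x : Fin n → ℝ} (hx : ∀ i, 0 ≤ x i)
    (hx0 : x ≠ 0) (hline : ∀ y : Fin n → ℝ,
      (∀ c ∈ Φ, intPt c ⬝ᵥ x = 0 → intPt c ⬝ᵥ y = 0) → ∃ t : ℝ, y = t • x) :
    ∃ v : Fin n → ℕ, IsPrimitive v ∧ ∃ r : ℝ, 0 < r ∧ x = r • natPt v := by
  obtain ⟨i, hi⟩ : ∃ i, x i ≠ 0 := by
    by_contra! h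
    exact hx0 (funext h)
  -- A `ℚ`-linear functional applied coordinatewise preserves integral equations, so it sends `x` to
  -- a rational point of the same line, nonzero because `f (x i) ≠ 0`.
  obtain ⟨f, hf⟩ : ∃ f : Module.Dual ℚ ℝ, f (x i) ≠ 0 := by
    by_contra! h
    exact hi ((Module.forall_dual_apply_eq_zero_iff ℚ (x i)).1 h)
  obtain ⟨t, ht⟩ := hline (fun j => (f (x j) : ℝ)) fun c _ h0 => by
    have h1 : f (∑ j, (c j : ℚ) • x j) = 0 := by
      have : ∑ j, (c j : ℚ) • x j = intPt c ⬝ᵥ x := by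
        simp [dotProduct, intPt, Rat.smul_def]
      rw [this, h0, map_zero]
    simp only [map_sum, map_smul, smul_eq_mul] at h1
    have h2 : ((∑ j, (c j : ℚ) * f (x j) : ℚ) : ℝ) = 0 := by rw [h1]; simp
    simpa [dotProduct, intPt] using h2
  have hc : ∀ j, (f (x j) : ℝ) = t * x j := fun j => by simpa using congrFun ht j
  have ht0 : t ≠ 0 := by
    rintro rfl
    have := hc i
    simp [hf] at this
  set z : Fin n → ℚ := fun j => f (x j) / f (x i) with hz
  have hzx : ∀ j, x j = x i * z j := by
    intro j
    simp only [hz]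
    push_cast
    rw [hc, hc]
    field_simp
  have hz0 : ∀ j, 0 ≤ z j := by
    intro j
    have h1 : (0 : ℝ) ≤ z j := by
      have : (z j : ℝ) = x j / x i := by rw [hzx j]; field_simp
      rw [this]
      exact div_nonneg (hx j) (hx i)
    exact_mod_cast h1
  set N : ℕ := ∏ j, (z j).den with hN
  have hN0 : 0 < N := Finset.prod_pos fun j _ => (z j).den_pos
  have hu : ∀ j, ∃ u : ℕ, (N : ℚ) * z j = u := by
    intro j
    obtain ⟨q, hq⟩ : (z j).den ∣ N := Finset.dvd_prod_of_mem _ (Finset.mem_univ j)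
    refine ⟨(z j).num.toNat * q, ?_⟩
    have h1 : ((z j).num.toNat : ℤ) = (z j).num :=
      Int.toNat_of_nonneg (Rat.num_nonneg.2 (hz0 j))
    have h2 : ((z j).num.toNat : ℚ) = (z j).num := by exact_mod_cast h1
    have h3 : z j * (z j).den = (z j).num := Rat.mul_den_eq_num _
    rw [hq]
    push_cast
    rw [h2, ← h3]
    ring
  choose u hu using hu
  have hxu : ∀ j, x j = x i / N * u j := by
    intro j
    have h1 : (N : ℝ) * z j = u j := by exact_mod_cast congrArg (fun q : ℚ => (q : ℝ)) (hu j)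
    rw [← h1, hzx j]
    field_simp
  have hxi : 0 < x i := lt_of_le_of_ne (hx i) (Ne.symm hi)
  obtain ⟨v, hv, hv1⟩ := Finset.extract_gcd u (s := Finset.univ) ⟨i, Finset.mem_univ i⟩
  refine ⟨v, hv1, x i / N * (Finset.univ.gcd u : ℕ), ?_, ?_⟩
  · have hg : Finset.univ.gcd u ≠ 0 := by
      intro h0
      have h1 := hv i (Finset.mem_univ i)
      rw [h0, zero_mul] at h1
      have h2 := hxu i
      rw [h1] at h2
      simp [hi] at h2
    have : (0 : ℝ) < (Finset.univ.gcd u : ℕ) := by exact_mod_cast Nat.pos_of_ne_zero hg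
    have : (0 : ℝ) < N := by exact_mod_cast hN0
    positivity
  · ext j
    rw [hxu j, hv j (Finset.mem_univ j)]
    simp [natPt]
    ring

/-- Moving inside the minimal face of a pointed cone until a further constraint becomes active. -/
theorem exists_new_active {Φ : Finset (Fin n → ℤ)} {x y : Fin n → ℝ}
    (hx : ∀ c ∈ Φ, 0 ≤ intPt c ⬝ᵥ x)
    (hy : ∀ c ∈ Φ, intPt c ⬝ᵥ x = 0 → intPt c ⬝ᵥ y = 0) (hneg : ∃ c ∈ Φ, intPt c ⬝ᵥ y < 0) :
    ∃ t : ℝ, 0 < t ∧ (∀ c ∈ Φ, 0 ≤ intPt c ⬝ᵥ (x + t • y)) ∧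
      (∀ c ∈ Φ, intPt c ⬝ᵥ x = 0 → intPt c ⬝ᵥ (x + t • y) = 0) ∧
      ∃ c ∈ Φ, intPt c ⬝ᵥ x ≠ 0 ∧ intPt c ⬝ᵥ (x + t • y) = 0 := by
  classical
  obtain ⟨c0, hc0, hc0n⟩ := hneg
  -- Ratio test: the least ratio is the time at which the first of the decreasing constraints
  -- reaches zero.
  obtain ⟨c, hc, hmin⟩ := (Φ.filter fun c => intPt c ⬝ᵥ y < 0).exists_min_image
    (fun c => intPt c ⬝ᵥ x / -(intPt c ⬝ᵥ y)) ⟨c0, Finset.mem_filter.2 ⟨hc0, hc0n⟩⟩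
  obtain ⟨hcΦ, hcn⟩ := Finset.mem_filter.1 hc
  have hcx : intPt c ⬝ᵥ x ≠ 0 := fun h => hcn.ne (hy c hcΦ h)
  have hcx' : 0 < intPt c ⬝ᵥ x := lt_of_le_of_ne (hx c hcΦ) (Ne.symm hcx)
  refine ⟨intPt c ⬝ᵥ x / -(intPt c ⬝ᵥ y), div_pos hcx' (neg_pos.2 hcn), ?_, ?_, c, hcΦ, hcx, ?_⟩
  · intro d hd
    rw [dotProduct_add, dotProduct_smul, smul_eq_mul]
    rcases lt_or_ge (intPt d ⬝ᵥ y) 0 with h | h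
    · have := hmin d (Finset.mem_filter.2 ⟨hd, h⟩)
      rw [le_div_iff₀ (neg_pos.2 h)] at this
      linarith
    · have := mul_nonneg (div_pos hcx' (neg_pos.2 hcn)).le h
      linarith [hx d hd]
  · intro d hd h
    rw [dotProduct_add, dotProduct_smul, h, hy d hd h]
    simp
  · rw [dotProduct_add, dotProduct_smul, smul_eq_mul]
    have := hcn.ne
    field_simp
    ring

/-- Induction on the number of inactive constraints. Either the active ones determine the line
through `x`, and `x` is a multiple of a ray vector, or `x` can be moved both ways along some `y`
until a new constraint becomes active. It is then a convex combination of two points with fewer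
inactive constraints. -/
theorem mem_span_rays {Φ : Finset (Fin n → ℤ)} (hΦ : ∀ i, Pi.single i 1 ∈ Φ) (N : ℕ) :
    ∀ x : Fin n → ℝ, (∀ c ∈ Φ, 0 ≤ intPt c ⬝ᵥ x) →
      (Φ.filter fun c => intPt c ⬝ᵥ x ≠ 0).card ≤ N →
      x ∈ Submodule.span NNReal (natPt '' {v | IsRayVec Φ v}) := by
  classical
  have hsingle : ∀ (i : Fin n) (y : Fin n → ℝ), intPt (Pi.single i 1) ⬝ᵥ y = y i := by
    intro i y
    have : intPt (Pi.single i (1 : ℤ)) = (Pi.single i (1 : ℝ) : Fin n → ℝ) := by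
      ext j
      by_cases h : j = i
      · subst h; simp [intPt]
      · simp [intPt, h]
    rw [this, single_dotProduct, one_mul]
  induction N using Nat.strong_induction_on with
  | _ N ih =>
  intro x hx hN
  by_cases hx0 : x = 0
  · rw [hx0]
    exact Submodule.zero_mem _
  have hxi : ∀ i, 0 ≤ x i := fun i => hsingle i x ▸ hx _ (hΦ i)
  by_cases hline : ∀ y : Fin n → ℝ,
      (∀ c ∈ Φ, intPt c ⬝ᵥ x = 0 → intPt c ⬝ᵥ y = 0) → ∃ t : ℝ, y = t • x
  · obtain ⟨v, hv, r, hr, rfl⟩ := exists_isPrimitive_of_line hxi hx0 hline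
    have hvr : IsRayVec Φ v := by
      refine ⟨hv, fun c hc => ?_, fun y hy => ?_⟩
      · have := hx c hc
        rw [dotProduct_smul, smul_eq_mul] at this
        exact nonneg_of_mul_nonneg_right this hr
      · obtain ⟨t, ht⟩ := hline y fun c hc h => hy c hc (by
          rw [dotProduct_smul, smul_eq_mul] at h
          exact (mul_eq_zero.1 h).resolve_left hr.ne')
        exact ⟨t * r, by rw [ht, smul_smul]⟩
    have : r • natPt v = (⟨r, hr.le⟩ : NNReal) • natPt v := rfl
    rw [this]
    exact Submodule.smul_mem _ _ (Submodule.subset_span ⟨v, hvr, rfl⟩)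
  · push Not at hline
    obtain ⟨y0, hy0, hy0x⟩ := hline
    have hσ : 0 < sigma x := by
      obtain ⟨i, hi⟩ : ∃ i, x i ≠ 0 := by
        by_contra! h
        exact hx0 (funext h)
      exact Finset.sum_pos' (fun i _ => hxi i) ⟨i, Finset.mem_univ i, lt_of_le_of_ne (hxi i) hi.symm⟩
    -- Subtracting a multiple of `x` makes the coordinate sum zero, so `y` has coordinates of both
    -- signs. Hence moving along `y` and along `-y` each decreases some coordinate constraint.
    set y : Fin n → ℝ := y0 - (sigma y0 / sigma x) • x with hy
    have hyσ : ∑ i, y i = 0 := by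
      simp only [hy, Pi.sub_apply, Pi.smul_apply, smul_eq_mul, Finset.sum_sub_distrib,
        ← Finset.mul_sum]
      change sigma y0 - sigma y0 / sigma x * sigma x = 0
      field_simp
      ring
    have hyne : ∃ i ∈ Finset.univ, y i ≠ 0 := by
      by_contra! h
      refine hy0x (sigma y0 / sigma x) ?_
      have : y = 0 := funext fun i => h i (Finset.mem_univ i)
      rwa [hy, sub_eq_zero] at this
    have hyact : ∀ c ∈ Φ, intPt c ⬝ᵥ x = 0 → intPt c ⬝ᵥ y = 0 := by
      intro c hc h
      rw [hy, dotProduct_sub, dotProduct_smul, h, hy0 c hc h]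
      simp
    obtain ⟨i, -, hi⟩ := Finset.exists_pos_of_sum_zero_of_exists_nonzero _ hyσ hyne
    obtain ⟨j, -, hj⟩ := Finset.exists_pos_of_sum_zero_of_exists_nonzero
      (s := Finset.univ) (fun i => -y i) (by simp [hyσ]) (by simpa using hyne)
    have hstep : ∀ z : Fin n → ℝ, (∀ c ∈ Φ, 0 ≤ intPt c ⬝ᵥ z) →
        (∀ c ∈ Φ, intPt c ⬝ᵥ x = 0 → intPt c ⬝ᵥ z = 0) →
        (∃ c ∈ Φ, intPt c ⬝ᵥ x ≠ 0 ∧ intPt c ⬝ᵥ z = 0) →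
        z ∈ Submodule.span NNReal (natPt '' {v | IsRayVec Φ v}) := by
      intro z hz hact ⟨c, hc, hcx, hcz⟩
      refine ih _ (lt_of_lt_of_le (Finset.card_lt_card ?_) hN) z hz le_rfl
      refine Finset.ssubset_iff_of_subset (fun d hd => ?_) |>.2 ⟨c, ?_, ?_⟩
      · rw [Finset.mem_filter] at hd ⊢
        exact ⟨hd.1, fun h => hd.2 (hact d hd.1 h)⟩
      · exact Finset.mem_filter.2 ⟨hc, hcx⟩
      · simp [hcz]
    obtain ⟨t, ht, h1, h2, h3⟩ := exists_new_active hx hyact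
      ⟨_, hΦ j, by rw [hsingle]; linarith⟩
    obtain ⟨t', ht', h1', h2', h3'⟩ := exists_new_active (y := -y) hx
      (fun c hc h => by rw [dotProduct_neg, hyact c hc h, neg_zero])
      ⟨_, hΦ i, by rw [hsingle]; simpa using hi⟩
    have hcomb : x = (⟨t' / (t + t'), by positivity⟩ : NNReal) • (x + t • y) +
        (⟨t / (t + t'), by positivity⟩ : NNReal) • (x + t' • -y) := by
      change x = (t' / (t + t')) • (x + t • y) + (t / (t + t')) • (x + t' • -y)
      ext i
      simp only [Pi.add_apply, Pi.smul_apply, Pi.neg_apply, smul_eq_mul]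
      field_simp
      ring
    rw [hcomb]
    exact Submodule.add_mem _ (Submodule.smul_mem _ _ (hstep _ h1 h2 h3))
      (Submodule.smul_mem _ _ (hstep _ h1' h2' h3'))

end Rays

/-! ### Lexicographic minima of compact sets. -/

section LexMin

variable {ι : Type*} {e : ι → ℕ}

/-- The strict lexicographic order on real functions, where the indices are ordered by `e`. -/
def LexLt (e : ι → ℕ) (a b : ι → ℝ) : Prop := ∃ i, (∀ j, e j < e i → a j = b j) ∧ a i < b i

theorem LexLt.asymm (he : Function.Injective e) {a b : ι → ℝ} (h : LexLt e a b) :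
    ¬ LexLt e b a := by
  rintro ⟨i', h1', h2'⟩
  obtain ⟨i, h1, h2⟩ := h
  rcases lt_trichotomy (e i) (e i') with h | h | h
  · exact h2.ne (h1' i h).symm
  · rw [he h] at h2
    exact lt_asymm h2 h2'
  · exact h2'.ne (h1 i' h).symm

theorem lexLt_or_lexLt {a b : ι → ℝ} (h : a ≠ b) :
    LexLt e a b ∨ LexLt e b a := by
  classical
  have hex : ∃ N, ∃ i, e i = N ∧ a i ≠ b i := by
    by_contra! hcon
    exact h (funext fun i => hcon _ i rfl)
  obtain ⟨i, hi, hne⟩ := Nat.find_spec hex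
  have hmin : ∀ j, e j < e i → a j = b j := by
    intro j hj
    by_contra hcon
    exact Nat.find_min hex (hi ▸ hj) ⟨j, rfl, hcon⟩
  rcases lt_or_gt_of_ne hne with h1 | h1
  · exact Or.inl ⟨i, hmin, h1⟩
  · exact Or.inr ⟨i, fun j hj => (hmin j hj).symm, h1⟩

/-- A nonempty compact set of functions that vanish off a finite set has a lexicographic minimum. -/
theorem exists_lexMin (he : Function.Injective e) (V : Finset ι) {K : Set (ι → ℝ)}
    (hK : IsCompact K) (hne : K.Nonempty) (hV : ∀ a ∈ K, ∀ i, i ∉ V → a i = 0) :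
    ∃ a ∈ K, ∀ b ∈ K, b ≠ a → LexLt e a b := by
  -- `K'` is what remains after minimising the coordinates of rank below `N` one after the other,
  -- each over the compact set left by the previous ones.
  have key : ∀ N : ℕ, ∃ K' ⊆ K, IsCompact K' ∧ K'.Nonempty ∧ ∀ a ∈ K', ∀ b ∈ K,
      LexLt e a b ∨ ((∀ i, e i < N → a i = b i) ∧ b ∈ K') := by
    intro N
    induction N with
    | zero => exact ⟨K, subset_rfl, hK, hne, fun a _ b hb => Or.inr ⟨by simp, hb⟩⟩
    | succ N ih =>
      obtain ⟨K', hsub, hc, hn, h⟩ := ih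
      by_cases hi : ∃ i, e i = N
      · obtain ⟨i, rfl⟩ := hi
        obtain ⟨m, hm, hmin⟩ := hc.exists_isMinOn hn (continuous_apply i).continuousOn
        refine ⟨K' ∩ {a | a i = m i}, Set.inter_subset_left.trans hsub,
          hc.inter_right (isClosed_eq (continuous_apply i) continuous_const), ⟨m, hm, rfl⟩, ?_⟩
        rintro a ⟨ha, hai⟩ b hb
        rcases h a ha b hb with h1 | ⟨h1, h2⟩
        · exact Or.inl h1
        · have hle : m i ≤ b i := hmin h2
          rcases hle.lt_or_eq with h3 | h3
          · exact Or.inl ⟨i, h1, (le_of_eq hai).trans_lt h3⟩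
          · refine Or.inr ⟨fun j hj => ?_, h2, h3.symm⟩
            rcases Nat.lt_succ_iff_lt_or_eq.1 hj with hj | hj
            · exact h1 j hj
            · rw [he hj]
              exact Eq.trans hai h3
      · refine ⟨K', hsub, hc, hn, fun a ha b hb => ?_⟩
        rcases h a ha b hb with h1 | ⟨h1, h2⟩
        · exact Or.inl h1
        · refine Or.inr ⟨fun j hj => ?_, h2⟩
          rcases Nat.lt_succ_iff_lt_or_eq.1 hj with hj | hj
          · exact h1 j hj
          · exact absurd ⟨j, hj⟩ hi
  obtain ⟨K', hsub, -, ⟨a, ha⟩, h⟩ := key (V.sup e + 1)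
  refine ⟨a, hsub ha, fun b hb hba => ?_⟩
  rcases h a ha b hb with h1 | ⟨h1, -⟩
  · exact h1
  · refine absurd (funext fun i => ?_) hba
    by_cases hi : i ∈ V
    · exact (h1 i (Nat.lt_succ_iff.2 (Finset.le_sup hi))).symm
    · rw [hV _ (hsub ha) i hi, hV b hb i hi]

end LexMin

/-! ### Simplicial decomposition by lexicographically minimal representations. -/

section Triangulation

variable {n : ℕ}

/-- The coefficients of the representations of `x` as a nonnegative combination of `V`. -/
def reps (V : Finset (Fin n → ℕ)) (x : Fin n → ℝ) : Set ((Fin n → ℕ) → ℝ) :=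
  {l | (∀ k, 0 ≤ l k) ∧ (∀ k, k ∉ V → l k = 0) ∧ ∑ k ∈ V, l k • natPt k = x}

/-- `l` is the lexicographically smallest among the representations of the same point. -/
def IsLexMin (V : Finset (Fin n → ℕ)) (l : (Fin n → ℕ) → ℝ) : Prop :=
  (∀ k, 0 ≤ l k) ∧ (∀ k, k ∉ V → l k = 0) ∧
    ∀ l' ∈ reps V (∑ k ∈ V, l k • natPt k), l' ≠ l → LexLt Encodable.encode l l'

/-- A primitive vector has a coordinate at least `1`, so its coefficient is bounded by a coordinate
of `x`. -/
theorem isCompact_reps {V : Finset (Fin n → ℕ)} (hV : ∀ v ∈ V, IsPrimitive v) (x : Fin n → ℝ) :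
    IsCompact (reps V x) := by
  classical
  refine IsCompact.of_isClosed_subset (isCompact_univ_pi
    (s := fun k : Fin n → ℕ => Set.Icc (0 : ℝ) (if k ∈ V then ∑ i, |x i| else 0))
    fun _ => isCompact_Icc) ?_ ?_
  · have : reps V x = (⋂ k, {l | 0 ≤ l k}) ∩ ((⋂ k, ⋂ (_ : k ∉ V), {l | l k = 0}) ∩
        {l | ∑ k ∈ V, l k • natPt k = x}) := by
      ext l
      simp [reps]
    rw [this]
    refine (isClosed_iInter fun k => isClosed_le continuous_const (continuous_apply k)).inter
      ((isClosed_iInter fun k => isClosed_iInter fun _ =>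
        isClosed_eq (continuous_apply k) continuous_const).inter (isClosed_eq ?_ continuous_const))
    fun_prop
  · rintro l ⟨h0, h1, h2⟩ k -
    refine ⟨h0 k, ?_⟩
    split_ifs with hk
    · obtain ⟨i, hi⟩ := exists_pos_of_isPrimitive (hV k hk)
      have hi1 : (1 : ℝ) ≤ natPt k i := by
        have : 1 ≤ k i := hi
        simpa [natPt] using this
      have hxi : x i = ∑ k ∈ V, l k * natPt k i := by rw [← h2]; simp
      calc l k ≤ l k * natPt k i := le_mul_of_one_le_right (h0 k) hi1
        _ ≤ ∑ k ∈ V, l k * natPt k i :=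
            Finset.single_le_sum (f := fun k => l k * natPt k i)
              (fun k _ => mul_nonneg (h0 k) (natPt_nonneg k i)) hk
        _ = x i := hxi.symm
        _ ≤ |x i| := le_abs_self _
        _ ≤ ∑ i, |x i| :=
            Finset.single_le_sum (f := fun i => |x i|) (fun i _ => abs_nonneg _) (Finset.mem_univ i)
    · exact (h1 k hk).le

theorem exists_isLexMin {V : Finset (Fin n → ℕ)} (hV : ∀ v ∈ V, IsPrimitive v) {x : Fin n → ℝ}
    (hx : (reps V x).Nonempty) : ∃ l, IsLexMin V l ∧ ∑ k ∈ V, l k • natPt k = x := by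
  obtain ⟨l, hl, hmin⟩ := exists_lexMin (e := (Encodable.encode : (Fin n → ℕ) → ℕ))
    Encodable.encode_injective V (isCompact_reps hV x) hx fun a ha i hi => ha.2.1 i hi
  refine ⟨l, ⟨hl.1, hl.2.1, ?_⟩, hl.2.2⟩
  rw [hl.2.2]
  exact hmin

/-- A small perturbation inside the support stays nonnegative. -/
theorem exists_pos_add_smul_nonneg {V : Finset (Fin n → ℕ)} {l d : (Fin n → ℕ) → ℝ}
    (hl : ∀ k, 0 ≤ l k) (hd : ∀ k, k ∉ V → 0 ≤ d k) (h : ∀ k, l k = 0 → 0 ≤ d k) :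
    ∃ ε : ℝ, 0 < ε ∧ ∀ k, 0 ≤ l k + ε * d k := by
  have h1 : ∀ k ∈ V, ∀ᶠ ε in nhdsWithin (0 : ℝ) (Set.Ioi 0), 0 ≤ l k + ε * d k := by
    intro k _
    rcases (hl k).eq_or_lt with hk | hk
    · filter_upwards [self_mem_nhdsWithin] with ε hε
      rw [← hk, zero_add]
      exact mul_nonneg (le_of_lt hε) (h k hk.symm)
    · have : Filter.Tendsto (fun ε : ℝ => l k + ε * d k) (nhds 0) (nhds (l k + 0 * d k)) :=
        (continuous_const.add (continuous_id.mul continuous_const)).tendsto 0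
      rw [zero_mul, add_zero] at this
      exact nhdsWithin_le_nhds ((this.eventually (lt_mem_nhds hk)).mono fun _ h => h.le)
  obtain ⟨ε, hε, hpos⟩ := (((Finset.eventually_all V).2 h1).and self_mem_nhdsWithin).exists
  refine ⟨ε, hpos, fun k => ?_⟩
  by_cases hk : k ∈ V
  · exact hε k hk
  · exact add_nonneg (hl k) (mul_nonneg (le_of_lt hpos) (hd k hk))

/-- Minimality depends on the support only: if `m'` beat `m`, then `l + ε (m' - m)` would beat `l`,
and for small `ε` it stays nonnegative because `l` is positive wherever `m` is. -/
theorem IsLexMin.of_support_eq {V : Finset (Fin n → ℕ)} {l m : (Fin n → ℕ) → ℝ}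
    (hl : IsLexMin V l) (hm : ∀ k, 0 ≤ m k) (hs : ∀ k, l k = 0 ↔ m k = 0) : IsLexMin V m := by
  refine ⟨hm, fun k hk => (hs k).1 (hl.2.1 k hk), ?_⟩
  rintro m' ⟨h0, h1, h2⟩ hne
  by_contra hcon
  have hlt := (lexLt_or_lexLt (e := Encodable.encode) hne).resolve_right hcon
  obtain ⟨ε, hε, hnn⟩ := exists_pos_add_smul_nonneg (V := V) (d := fun k => m' k - m k) hl.1
    (fun k hk => by rw [h1 k hk, (hs k).1 (hl.2.1 k hk), sub_zero])
    (fun k hk => by rw [(hs k).1 hk, sub_zero]; exact h0 k)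
  obtain ⟨i, hi1, hi2⟩ := hlt
  have hlt2 : LexLt Encodable.encode (fun k => l k + ε * (m' k - m k)) l := by
    refine ⟨i, fun j hj => by simp [hi1 j hj], ?_⟩
    have := mul_neg_of_pos_of_neg hε (sub_neg.2 hi2)
    linarith
  refine LexLt.asymm Encodable.encode_injective hlt2 (hl.2.2 _ ⟨hnn, fun k hk => ?_, ?_⟩ ?_)
  · simp [h1 k hk, (hs k).1 (hl.2.1 k hk), hl.2.1 k hk]
  · simp only [add_smul, Finset.sum_add_distrib, mul_smul, sub_smul, smul_sub,
      Finset.sum_sub_distrib, ← Finset.smul_sum, h2]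
    simp
  · intro h
    have := congrFun h i
    have h3 := mul_neg_of_pos_of_neg hε (sub_neg.2 hi2)
    linarith

/-- A nontrivial relation `d` among the vectors of `B` gives further representations `l + ε d` and
`l - ε d` of the same point. Minimality of `l` would make both `d` and `-d` lexicographically
positive. -/
theorem IsLexMin.linearIndependent {V B : Finset (Fin n → ℕ)} {l : (Fin n → ℕ) → ℝ}
    (hl : IsLexMin V l) (hB : B ⊆ V) (hBl : ∀ k ∈ B, l k ≠ 0) :
    LinearIndependent ℝ (fun k : B => natPt (k : Fin n → ℕ)) := by
  classical
  by_contra hcon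
  obtain ⟨c, hc, ⟨b, hb⟩, hcb⟩ := Fintype.not_linearIndependent_iff.1 hcon
  let d : (Fin n → ℕ) → ℝ := fun k => if h : k ∈ B then c ⟨k, h⟩ else 0
  have hd0 : ∀ k, k ∉ B → d k = 0 := fun k hk => dif_neg hk
  have hdsum : ∑ k ∈ V, d k • natPt k = 0 := by
    rw [← Finset.sum_subset hB fun k _ hk => by rw [hd0 k hk, zero_smul], ← hc,
      ← Finset.sum_coe_sort B]
    exact Finset.sum_congr rfl fun k _ => by simp [d]
  have hdb : d b ≠ 0 := by simpa [d, hb] using hcb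
  have key : ∀ d : (Fin n → ℕ) → ℝ, (∀ k, k ∉ B → d k = 0) → ∑ k ∈ V, d k • natPt k = 0 →
      d b ≠ 0 → LexLt Encodable.encode 0 d := by
    intro d hd0 hdsum hdb
    obtain ⟨ε, hε, hnn⟩ := exists_pos_add_smul_nonneg (V := V) (d := d) hl.1
      (fun k hk => (hd0 k fun h => hk (hB h)).ge)
      (fun k hk => (hd0 k fun h => hBl k h hk).ge)
    obtain ⟨i, h1, h2⟩ := hl.2.2 (fun k => l k + ε * d k) ⟨hnn, fun k hk => by
      simp [hl.2.1 k hk, hd0 k fun h => hk (hB h)], by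
      simp only [add_smul, Finset.sum_add_distrib, mul_smul, ← Finset.smul_sum, hdsum]
      simp⟩ (fun h => by
        have := congrFun h b
        simp [hε.ne', hdb] at this)
    refine ⟨i, fun j hj => ?_, ?_⟩
    · have := h1 j hj
      have h3 : ε * d j = 0 := by linarith
      exact ((mul_eq_zero.1 h3).resolve_left hε.ne').symm
    · have : 0 < ε * d i := by linarith
      exact pos_of_mul_pos_right this hε.le
  obtain ⟨i, h1, h2⟩ := key d hd0 hdsum hdb
  obtain ⟨i', h1', h2'⟩ := key (-d) (fun k hk => by simp [hd0 k hk])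
    (by simp [neg_smul, hdsum]) (by simpa using hdb)
  simp only [Pi.zero_apply, Pi.neg_apply] at h1 h2 h1' h2'
  rcases lt_trichotomy (Encodable.encode i) (Encodable.encode i') with h | h | h
  · have := h1' i h
    linarith
  · rw [Encodable.encode_injective h] at h2
    linarith
  · have := h1 i' h
    linarith

/-- The simplicial cones in which the points with a representation over `V` are partitioned. -/
def IsGoodSupport (V B : Finset (Fin n → ℕ)) : Prop :=
  B ⊆ V ∧ ∃ l, IsLexMin V l ∧ ∀ k, k ∈ B ↔ l k ≠ 0

theorem exists_isLexMin_of_mem_openCone {V B : Finset (Fin n → ℕ)} (hB : IsGoodSupport V B)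
    {x : Fin n → ℝ} (hx : x ∈ openCone B) :
    ∃ m, IsLexMin V m ∧ (∀ k, k ∈ B ↔ m k ≠ 0) ∧ ∑ k ∈ V, m k • natPt k = x := by
  classical
  obtain ⟨hBV, l, hl, hlB⟩ := hB
  obtain ⟨c, hc, rfl⟩ := hx
  let m : (Fin n → ℕ) → ℝ := fun k => if k ∈ B then c k else 0
  have hmB : ∀ k, k ∈ B ↔ m k ≠ 0 := by
    intro k
    by_cases hk : k ∈ B
    · simp [m, hk, (hc k hk).ne']
    · simp [m, hk]
  refine ⟨m, hl.of_support_eq (fun k => ?_) (fun k => ?_), hmB, ?_⟩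
  · by_cases hk : k ∈ B
    · simp [m, hk, (hc k hk).le]
    · simp [m, hk]
  · exact not_iff_not.1 ((hlB k).symm.trans (hmB k))
  · rw [← Finset.sum_subset hBV fun k _ hk => by simp [m, hk]]
    exact Finset.sum_congr rfl fun k hk => by simp [m, hk]

/-- Every point of the open cone on a good support has its minimal representation supported exactly
there, and minimal representations are unique. -/
theorem IsGoodSupport.eq_of_mem {V B B' : Finset (Fin n → ℕ)} (hB : IsGoodSupport V B)
    (hB' : IsGoodSupport V B') {x : Fin n → ℝ} (hx : x ∈ openCone B) (hx' : x ∈ openCone B') :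
    B = B' := by
  obtain ⟨m, hm, hmB, hmx⟩ := exists_isLexMin_of_mem_openCone hB hx
  obtain ⟨m', hm', hmB', hmx'⟩ := exists_isLexMin_of_mem_openCone hB' hx'
  have : m' = m := by
    by_contra hne
    refine LexLt.asymm Encodable.encode_injective
      (hm.2.2 m' ⟨hm'.1, hm'.2.1, hmx'.trans hmx.symm⟩ hne)
      (hm'.2.2 m ⟨hm.1, hm.2.1, hmx.trans hmx'.symm⟩ (Ne.symm hne))
  ext k
  rw [hmB, hmB', this]

theorem exists_isGoodSupport {V : Finset (Fin n → ℕ)} (hV : ∀ v ∈ V, IsPrimitive v)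
    {x : Fin n → ℝ} (hx : (reps V x).Nonempty) : ∃ B, IsGoodSupport V B ∧ x ∈ openCone B := by
  classical
  obtain ⟨l, hl, hlx⟩ := exists_isLexMin hV hx
  refine ⟨V.filter fun k => l k ≠ 0, ⟨Finset.filter_subset _ _, l, hl, fun k => ?_⟩, l, ?_, ?_⟩
  · rw [Finset.mem_filter, and_iff_right_iff_imp]
    intro h
    by_contra hk
    exact h (hl.2.1 k hk)
  · intro k hk
    exact lt_of_le_of_ne (hl.1 k) (Finset.mem_filter.1 hk).2.symm
  · rw [← hlx]
    symm
    refine Finset.sum_subset (Finset.filter_subset _ _) fun k hk hk' => ?_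
    have : l k = 0 := by
      by_contra h
      exact hk' (Finset.mem_filter.2 ⟨hk, h⟩)
    rw [this, zero_smul]

theorem reps_nonempty_of_mem_span {V : Finset (Fin n → ℕ)} {x : Fin n → ℝ}
    (hx : x ∈ Submodule.span NNReal (natPt '' (V : Set (Fin n → ℕ)))) : (reps V x).Nonempty := by
  classical
  induction hx using Submodule.span_induction with
  | mem x hx =>
    obtain ⟨v, hv, rfl⟩ := hx
    have hv' : v ∈ V := hv
    refine ⟨Pi.single v 1, fun k => ?_, fun k hk => ?_, ?_⟩
    · by_cases h : k = v
      · subst h; simp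
      · simp [h]
    · have : k ≠ v := fun h => hk (h ▸ hv')
      simp [this]
    · rw [Finset.sum_eq_single v (fun k _ h => by simp [h]) (fun h => absurd hv' h)]
      simp
  | zero => exact ⟨0, by simp, by simp, by simp⟩
  | add x y _ _ hx hy =>
    obtain ⟨a, a0, a1, a2⟩ := hx
    obtain ⟨b, b0, b1, b2⟩ := hy
    refine ⟨a + b, fun k => add_nonneg (a0 k) (b0 k), fun k hk => by simp [a1 k hk, b1 k hk], ?_⟩
    simp [add_smul, Finset.sum_add_distrib, a2, b2]
  | smul r x _ hx =>
    obtain ⟨a, a0, a1, a2⟩ := hx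
    refine ⟨fun k => r * a k, fun k => mul_nonneg r.2 (a0 k), fun k hk => by simp [a1 k hk], ?_⟩
    simp only [mul_smul, ← Finset.smul_sum, a2]
    rfl

end Triangulation

/-! ### Simplicial partitions of the cones without new rays. -/

section ConeTriangulation

variable {n : ℕ} {Γ Γ' : Set (Fin n → ℝ)} {A A' : Finset (Fin n → ℕ)}

/-- If the loci of all generators contain a common nonempty locus, then the locus is constant on
the open cone that they span. -/
theorem locus_eq_of_mem_openCone (hΓ : IsNewton Γ A) {k : Fin n → ℝ} (hk : ∀ i, 0 ≤ k i)
    {B : Finset (Fin n → ℕ)} (hB : ∀ b ∈ B, firstMeetLocus Γ k ⊆ firstMeetLocus Γ (natPt b))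
    {x : Fin n → ℝ} (hx : x ∈ openCone B) :
    firstMeetLocus Γ x = {y ∈ Γ | ∀ b ∈ B, y ∈ firstMeetLocus Γ (natPt b)} := by
  obtain ⟨c, hc, rfl⟩ := hx
  obtain ⟨a, -, ha⟩ := hΓ.exists_mem_locus hk
  have hdot : ∀ y : Fin n → ℝ, (∑ b ∈ B, c b • natPt b) ⬝ᵥ y = ∑ b ∈ B, c b * (natPt b ⬝ᵥ y) := by
    intro y
    simp [sum_dotProduct, smul_dotProduct]
  have hle : ∀ b ∈ B, ∀ y ∈ Γ, mVal Γ (natPt b) ≤ natPt b ⬝ᵥ y := fun b _ y hy =>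
    hΓ.mVal_le (natPt_nonneg b) hy
  have hm : mVal Γ (∑ b ∈ B, c b • natPt b) = ∑ b ∈ B, c b * mVal Γ (natPt b) := by
    rw [mVal_eq_of_forall_le ha.1 fun y hy => ?_, hdot]
    · exact Finset.sum_congr rfl fun b hb => by rw [(hB b hb ha).2]
    · rw [hdot, hdot]
      refine Finset.sum_le_sum fun b hb => mul_le_mul_of_nonneg_left ?_ (hc b hb).le
      rw [(hB b hb ha).2]
      exact hle b hb y hy
  ext y
  refine and_congr_right fun hy => ?_
  -- Each summand is already bounded below by its minimum, so equality of the sums forces equality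
  -- term by term.
  rw [hm, hdot, eq_comm, Finset.sum_eq_sum_iff_of_le fun b hb =>
    mul_le_mul_of_nonneg_left (hle b hb y hy) (hc b hb).le]
  refine forall₂_congr fun b hb => ?_
  rw [mul_right_inj' (hc b hb).ne', eq_comm]
  exact ⟨fun h => ⟨hy, h⟩, fun h => h.2⟩

open Classical in
/-- The finitely many integral inequalities that cut out the closure of the cone of `k`. -/
def constraints (Γ : Set (Fin n → ℝ)) (A : Finset (Fin n → ℕ)) (k : Fin n → ℝ) :
    Finset (Fin n → ℤ) :=
  (Finset.univ.image fun i => Pi.single i 1) ∪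
    ((Finset.univ.filter fun i => k i = 0).image fun i => -Pi.single i 1) ∪
    (A ×ˢ A.filter fun b => natPt b ∈ firstMeetLocus Γ k).image
      fun q => (fun i => (q.1 i : ℤ) - q.2 i)

theorem mem_constraints {k : Fin n → ℝ} {c : Fin n → ℤ} : c ∈ constraints Γ A k ↔
    (∃ i, c = Pi.single i 1) ∨ (∃ i, k i = 0 ∧ c = -Pi.single i 1) ∨
      ∃ a ∈ A, ∃ b ∈ A, natPt b ∈ firstMeetLocus Γ k ∧ c = fun i => (a i : ℤ) - b i := by
  classical
  simp only [constraints, Finset.mem_union, Finset.mem_image, Finset.mem_univ, true_and,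
    Finset.mem_filter, Finset.mem_product, Prod.exists, or_assoc]
  refine or_congr ?_ (or_congr ?_ ?_)
  · exact exists_congr fun i => eq_comm
  · exact exists_congr fun i => and_congr_right fun _ => eq_comm
  · constructor
    · rintro ⟨a, b, ⟨ha, hb, h⟩, rfl⟩
      exact ⟨a, ha, b, hb, h, rfl⟩
    · rintro ⟨a, ha, b, hb, h, rfl⟩
      exact ⟨a, b, ⟨ha, hb, h⟩, rfl⟩

theorem intPt_single_dotProduct (i : Fin n) (y : Fin n → ℝ) :
    intPt (Pi.single i 1) ⬝ᵥ y = y i := by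
  have : intPt (Pi.single i (1 : ℤ)) = (Pi.single i (1 : ℝ) : Fin n → ℝ) := by
    ext j
    by_cases h : j = i
    · subst h; simp [intPt]
    · simp [intPt, h]
  rw [this, single_dotProduct, one_mul]

theorem intPt_neg_dotProduct (c : Fin n → ℤ) (y : Fin n → ℝ) :
    intPt (-c) ⬝ᵥ y = -(intPt c ⬝ᵥ y) := by
  have : intPt (-c) = -intPt c := by ext; simp [intPt]
  rw [this, neg_dotProduct]

theorem intPt_sub_dotProduct (a b : Fin n → ℕ) (y : Fin n → ℝ) :
    intPt (fun i => (a i : ℤ) - b i) ⬝ᵥ y = y ⬝ᵥ natPt a - y ⬝ᵥ natPt b := by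
  have : intPt (fun i => (a i : ℤ) - b i) = natPt a - natPt b := by ext; simp [intPt, natPt]
  rw [this, sub_dotProduct, dotProduct_comm y, dotProduct_comm y]

theorem constraints_nonneg_iff (hΓ : IsNewton Γ A) {k : Fin n → ℝ} (hk : ∀ i, 0 ≤ k i)
    {l : Fin n → ℝ} : (∀ c ∈ constraints Γ A k, 0 ≤ intPt c ⬝ᵥ l) ↔
      (∀ i, 0 ≤ l i) ∧ firstMeetLocus Γ k ⊆ firstMeetLocus Γ l := by
  rw [hΓ.locus_subset_iff hk]
  constructor
  · intro h
    have h0 : ∀ i, 0 ≤ l i := fun i => by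
      rw [← intPt_single_dotProduct i l]
      exact h _ (mem_constraints.2 (Or.inl ⟨i, rfl⟩))
    refine ⟨h0, fun b hb hbk => ⟨hbk.1, ?_⟩, fun i hi => le_antisymm ?_ (h0 i)⟩
    · obtain ⟨a, ha, hal, -⟩ := hΓ.exists_mVal_eq h0
      refine le_antisymm ?_ (hΓ.mVal_le h0 hbk.1)
      have := h _ (mem_constraints.2 (Or.inr (Or.inr ⟨a, ha, b, hb, hbk, rfl⟩)))
      rw [intPt_sub_dotProduct] at this
      linarith
    · have := h _ (mem_constraints.2 (Or.inr (Or.inl ⟨i, hi, rfl⟩)))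
      rw [intPt_neg_dotProduct, intPt_single_dotProduct] at this
      linarith
  · rintro ⟨h0, h1, h2⟩ c hc
    rcases mem_constraints.1 hc with ⟨i, rfl⟩ | ⟨i, hi, rfl⟩ | ⟨a, ha, b, hb, hbk, rfl⟩
    · rw [intPt_single_dotProduct]
      exact h0 i
    · rw [intPt_neg_dotProduct, intPt_single_dotProduct, h2 i hi, neg_zero]
    · rw [intPt_sub_dotProduct, (h1 b hb hbk).2]
      linarith [hΓ.mVal_le h0 (hΓ.mem a ha)]

/-- This makes `IsRayVec.line` applicable to every point of the cell of a ray vector `v`. -/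
theorem constraints_active (hΓ : IsNewton Γ A) {k v l : Fin n → ℝ} (hv : ∀ i, 0 ≤ v i)
    (hl : ∀ i, 0 ≤ l i) (hkv : firstMeetLocus Γ k ⊆ firstMeetLocus Γ v)
    (hvl : firstMeetLocus Γ l = firstMeetLocus Γ v) {c : Fin n → ℤ}
    (hc : c ∈ constraints Γ A k) (h : intPt c ⬝ᵥ v = 0) : intPt c ⬝ᵥ l = 0 := by
  have h0 := ((hΓ.locus_eq_iff hv hl).1 hvl.symm).2
  rcases mem_constraints.1 hc with ⟨i, rfl⟩ | ⟨i, hi, rfl⟩ | ⟨a, ha, b, hb, hbk, rfl⟩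
  · rw [intPt_single_dotProduct] at h ⊢
    exact (h0 i).1 h
  · rw [intPt_neg_dotProduct, intPt_single_dotProduct, neg_eq_zero] at h ⊢
    exact (h0 i).1 h
  · rw [intPt_sub_dotProduct] at h ⊢
    have hbv := hkv hbk
    have hav : natPt a ∈ firstMeetLocus Γ v := ⟨hΓ.mem a ha, by rw [← hbv.2]; linarith⟩
    rw [← hvl] at hav hbv
    rw [hav.2, hbv.2, sub_self]

theorem nonneg_of_mem_openCone {B : Finset (Fin n → ℕ)} {x : Fin n → ℝ} (hx : x ∈ openCone B)
    (i : Fin n) : 0 ≤ x i := by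
  obtain ⟨c, hc, rfl⟩ := hx
  rw [Finset.sum_apply]
  exact Finset.sum_nonneg fun b hb => mul_nonneg (hc b hb).le (natPt_nonneg b i)

theorem openCone_subset_cell (hΓ : IsNewton Γ A) (hΓ' : IsNewton Γ' A') {k : Fin n → ℝ}
    (hk : ∀ i, 0 ≤ k i) {B : Finset (Fin n → ℕ)}
    (hB : ∀ b ∈ B, firstMeetLocus Γ k ⊆ firstMeetLocus Γ (natPt b))
    (hB' : ∀ b ∈ B, firstMeetLocus Γ' k ⊆ firstMeetLocus Γ' (natPt b)) {x : Fin n → ℝ}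
    (hx : x ∈ openCone B) : openCone B ⊆ cell Γ Γ' x := fun y hy =>
  mem_cell_iff.2 ⟨nonneg_of_mem_openCone hy,
    by rw [locus_eq_of_mem_openCone hΓ hk hB hx, locus_eq_of_mem_openCone hΓ hk hB hy],
    by rw [locus_eq_of_mem_openCone hΓ' hk hB' hx, locus_eq_of_mem_openCone hΓ' hk hB' hy]⟩

theorem natPt_mem_openCone_singleton (v : Fin n → ℕ) : natPt v ∈ openCone {v} :=
  ⟨fun _ => 1, by simp, by simp⟩

/-- All constraints active at `v` are active on the whole cell of `v`, so that cell lies in the line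
through `v` and is the open ray itself. -/
theorem isRayGenerator_of_isRayVec (hΓ : IsNewton Γ A) (hΓ' : IsNewton Γ' A') {k : Fin n → ℝ}
    (hk : ∀ i, 0 ≤ k i) {v : Fin n → ℕ}
    (hv : IsRayVec (constraints Γ A k ∪ constraints Γ' A' k) v) :
    IsRayGenerator (conePartition Γ Γ') v := by
  have hF := ((constraints_nonneg_iff hΓ hk).1 fun c hc =>
    hv.nonneg c (Finset.mem_union_left _ hc)).2
  have hF' := ((constraints_nonneg_iff hΓ' hk).1 fun c hc =>
    hv.nonneg c (Finset.mem_union_right _ hc)).2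
  refine ⟨hv.primitive, ?_⟩
  have : openCone {v} = cell Γ Γ' (natPt v) := by
    refine Set.Subset.antisymm (openCone_subset_cell hΓ hΓ' (natPt_nonneg v) (by simp) (by simp)
      (natPt_mem_openCone_singleton v)) fun l hl => ?_
    obtain ⟨h0, h1, h2⟩ := mem_cell_iff.1 hl
    obtain ⟨t, rfl⟩ := hv.line l fun c hc h => by
      rcases Finset.mem_union.1 hc with hc | hc
      · exact constraints_active hΓ (natPt_nonneg v) h0 hF h1 hc h
      · exact constraints_active hΓ' (natPt_nonneg v) h0 hF' h2 hc h
    obtain ⟨i, hi⟩ := exists_pos_of_isPrimitive hv.primitive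
    have hi' : 0 < natPt v i := by simpa [natPt] using hi
    -- The loci record which coordinates vanish, so the zero vector is not in the cell of `v`.
    have ht : t ≠ 0 := by
      rintro rfl
      exact hi'.ne' ((((hΓ.locus_eq_iff h0 (natPt_nonneg v)).1 h1).2 i).1 (by simp))
    have ht0 : 0 ≤ t := nonneg_of_mul_nonneg_left (h0 i) hi'
    exact ⟨fun _ => t, fun _ _ => lt_of_le_of_ne ht0 ht.symm, by simp⟩
  rw [this]
  exact cell_mem_conePartition hΓ hΓ' (natPt_nonneg v)

/-- The ray vectors of the closure of `δ` span it, and the good supports cut it into disjoint open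
simplicial cones. The loci are constant on each of these, so a cone that meets `δ` is contained in
`δ`. -/
theorem exists_isSimplicialPartition (hΓ : IsNewton Γ A) (hΓ' : IsNewton Γ' A')
    {δ : Set (Fin n → ℝ)} (hδ : δ ∈ conePartition Γ Γ') :
    ∃ T : Finset (Finset (Fin n → ℕ)), IsSimplicialPartition δ T ∧
      ∀ B ∈ T, ∀ k ∈ B, IsRayGenerator (conePartition Γ Γ') k := by
  classical
  obtain ⟨k, hkδ⟩ := hδ.1
  have hk := nonneg_of_mem_conePartition hδ hkδ
  have hδk := eq_cell_of_mem hδ hkδ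
  set Φ := constraints Γ A k ∪ constraints Γ' A' k with hΦ
  set V := (finite_isRayVec Φ).toFinset with hV
  have hVm : ∀ v ∈ V, IsRayVec Φ v := fun v hv => by simpa [hV] using hv
  have hVF : ∀ v ∈ V, firstMeetLocus Γ k ⊆ firstMeetLocus Γ (natPt v) := fun v hv =>
    ((constraints_nonneg_iff hΓ hk).1 fun c hc =>
      (hVm v hv).nonneg c (Finset.mem_union_left _ hc)).2
  have hVF' : ∀ v ∈ V, firstMeetLocus Γ' k ⊆ firstMeetLocus Γ' (natPt v) := fun v hv =>
    ((constraints_nonneg_iff hΓ' hk).1 fun c hc =>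
      (hVm v hv).nonneg c (Finset.mem_union_right _ hc)).2
  set T := V.powerset.filter fun B => IsGoodSupport V B ∧ (openCone B ∩ δ).Nonempty with hT
  have hTm : ∀ B ∈ T, B ⊆ V ∧ IsGoodSupport V B ∧ (openCone B ∩ δ).Nonempty := fun B hB => by
    simpa [hT] using hB
  refine ⟨T, ⟨fun B hB b hb => (hVm b ((hTm B hB).1 hb)).primitive, fun B hB => ?_, ?_, ?_⟩,
    fun B hB b hb => isRayGenerator_of_isRayVec hΓ hΓ' hk (hVm b ((hTm B hB).1 hb))⟩
  · obtain ⟨hBV, ⟨-, l, hl, hlB⟩, -⟩ := hTm B hB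
    exact hl.linearIndependent hBV fun k hk => (hlB k).1 hk
  · intro B hB B' hB' hne
    refine Set.disjoint_left.2 fun x hx hx' => hne ?_
    exact (hTm B hB).2.1.eq_of_mem (hTm B' hB').2.1 hx hx'
  · refine Set.Subset.antisymm (Set.iUnion₂_subset fun B hB => ?_) fun x hx => ?_
    · obtain ⟨hBV, -, x, hxB, hxδ⟩ := hTm B hB
      rw [eq_cell_of_mem hδ hxδ]
      exact openCone_subset_cell hΓ hΓ' hk (fun b hb => hVF b (hBV hb))
        (fun b hb => hVF' b (hBV hb)) hxB
    · have hx0 := nonneg_of_mem_conePartition hδ hx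
      rw [hδk] at hx
      obtain ⟨-, h1, h2⟩ := mem_cell_iff.1 hx
      have hspan : x ∈ Submodule.span NNReal (natPt '' (V : Set (Fin n → ℕ))) := by
        have := mem_span_rays (Φ := Φ)
          (fun i => Finset.mem_union_left _ (mem_constraints.2 (Or.inl ⟨i, rfl⟩))) _ x
          (fun c hc => ?_) le_rfl
        · simpa [hV] using this
        · rcases Finset.mem_union.1 hc with hc | hc
          · exact (constraints_nonneg_iff hΓ hk).2 ⟨hx0, h1.ge⟩ c hc
          · exact (constraints_nonneg_iff hΓ' hk).2 ⟨hx0, h2.ge⟩ c hc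
      obtain ⟨B, hB, hxB⟩ := exists_isGoodSupport (fun v hv => (hVm v hv).primitive)
        (reps_nonempty_of_mem_span hspan)
      rw [← hδk] at hx
      exact Set.mem_iUnion₂.2 ⟨B, by simpa [hT] using ⟨hB.1, hB, x, hxB, hx⟩, hxB⟩

end ConeTriangulation

/-! ### The two given convex hulls are polyhedra of the required kind. -/

section NewtonPolyhedra

variable {n : ℕ}

/-- The points that dominate some convex combination of `A` form a convex set containing `E`. -/
theorem isNewton_convexHull {E : Set (Fin n → ℝ)} {A : Finset (Fin n → ℕ)} (hA : A.Nonempty)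
    (hAE : ∀ a ∈ A, natPt a ∈ E) (hAE' : ∀ a ∈ A, ∀ i, natPt a + Pi.single i 1 ∈ E)
    (hE : ∀ x ∈ E, ∃ a ∈ A, natPt a ≤ x) : IsNewton (convexHull ℝ E) A where
  nonempty := hA
  mem a ha := subset_convexHull ℝ E (hAE a ha)
  add_single_mem a ha i := subset_convexHull ℝ E (hAE' a ha i)
  exists_le := by
    classical
    let D : Set (Fin n → ℝ) := {x | ∃ w : (Fin n → ℕ) → ℝ, (∀ a ∈ A, 0 ≤ w a) ∧
      ∑ a ∈ A, w a = 1 ∧ ∑ a ∈ A, w a • natPt a ≤ x}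
    have hD : Convex ℝ D := by
      rintro x ⟨w, hw, hw1, hwx⟩ y ⟨v, hv, hv1, hvy⟩ a b ha hb hab
      refine ⟨fun k => a * w k + b * v k, fun k hk => ?_, ?_, ?_⟩
      · exact add_nonneg (mul_nonneg ha (hw k hk)) (mul_nonneg hb (hv k hk))
      · rw [Finset.sum_add_distrib, ← Finset.mul_sum, ← Finset.mul_sum, hw1, hv1]
        linarith
      · simp only [add_smul, mul_smul, Finset.sum_add_distrib, ← Finset.smul_sum]
        exact add_le_add (smul_le_smul_of_nonneg_left hwx ha) (smul_le_smul_of_nonneg_left hvy hb)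
    have hED : E ⊆ D := by
      intro x hx
      obtain ⟨a, ha, hax⟩ := hE x hx
      refine ⟨Pi.single a 1, fun k _ => ?_, ?_, ?_⟩
      · by_cases h : k = a
        · subst h; simp
        · simp [h]
      · rw [Finset.sum_pi_single']
        simp [ha]
      · rw [Finset.sum_eq_single a (fun k _ h => by simp [h]) (fun h => absurd ha h)]
        simpa using hax
    exact fun x hx => convexHull_min hED hD hx

variable {p : ℕ} [Fact p.Prime]

theorem isNewton_newton {g : MvPolynomial (Fin n) ℤ_[p]} (hg : g ≠ 0) :
    IsNewton (newton g) (g.support.image fun ω : Fin n →₀ ℕ => (ω : Fin n → ℕ)) := by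
  classical
  refine isNewton_convexHull ?_ ?_ ?_ ?_
  · exact (Finset.nonempty_iff_ne_empty.2 (mt support_eq_empty.1 hg)).image _
  · simp only [Finset.mem_image, forall_exists_index, and_imp]
    rintro _ ω hω rfl
    exact Set.mem_iUnion₂.2 ⟨ω, hω, fun i => le_rfl⟩
  · simp only [Finset.mem_image, forall_exists_index, and_imp]
    rintro _ ω hω rfl i
    refine Set.mem_iUnion₂.2 ⟨ω, hω, fun j => ?_⟩
    have : (0 : ℝ) ≤ (Pi.single i 1 : Fin n → ℝ) j := by
      by_cases h : j = i
      · subst h; simp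
      · simp [h]
    exact le_add_of_nonneg_right this
  · intro x hx
    obtain ⟨ω, hω, h⟩ := Set.mem_iUnion₂.1 hx
    exact ⟨ω, Finset.mem_image_of_mem _ hω, h⟩

/-- The monomial with a given exponent vector. -/
def monom (p : ℕ) [Fact p.Prime] (a : Fin n → ℕ) : MvPolynomial (Fin n) ℤ_[p] :=
  monomial (Finsupp.equivFunOnFinite.symm a) 1

theorem exists_isNewton_newtonIdeal {I : Ideal (MvPolynomial (Fin n) ℤ_[p])}
    (hI : IsMonomialIdeal I) (hI0 : I ≠ ⊥) : ∃ A : Finset (Fin n → ℕ),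
      IsNewton (newtonIdeal I) A ∧ I = Ideal.span (monom p '' (A : Set (Fin n → ℕ))) := by
  classical
  obtain ⟨S, hS⟩ := hI
  -- Noetherianity extracts finitely many generators from the given monomials themselves.
  have hfg : (Submodule.span (MvPolynomial (Fin n) ℤ_[p])
      ((fun ω => monomial ω (1 : ℤ_[p])) '' S)).FG := IsNoetherian.noetherian _
  obtain ⟨S', hS', hspan⟩ := (Submodule.fg_span_iff_fg_span_finset_subset _).1 hfg
  obtain ⟨A', hA', rfl⟩ := Finset.subset_set_image_iff.1 hS'
  set A := A'.image fun ω : Fin n →₀ ℕ => (ω : Fin n → ℕ) with hA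
  have himg : monom p '' (A : Set (Fin n → ℕ)) =
      (fun ω => monomial ω (1 : ℤ_[p])) '' (A' : Set (Fin n →₀ ℕ)) := by
    rw [hA, Finset.coe_image, Set.image_image]
    refine Set.image_congr fun ω _ => ?_
    simp [monom]
  have hIA : I = Ideal.span (monom p '' (A : Set (Fin n → ℕ))) := by
    rw [himg, hS, Ideal.span, hspan, Ideal.span, Finset.coe_image]
  refine ⟨A, ?_, hIA⟩
  have hmem : ∀ ω : Fin n →₀ ℕ, monomial ω (1 : ℤ_[p]) ∈ I ↔ ∃ a ∈ A', a ≤ ω := by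
    intro ω
    rw [hIA, himg, mem_ideal_span_monomial_image]
    simp [support_monomial]
  refine isNewton_convexHull ?_ ?_ ?_ ?_
  · rw [Finset.nonempty_iff_ne_empty]
    intro h
    rw [h] at hIA
    simp at hIA
    exact hI0 hIA
  · simp only [hA, Finset.mem_image, forall_exists_index, and_imp]
    rintro _ ω hω rfl
    exact ⟨ω, (hmem ω).2 ⟨ω, hω, le_rfl⟩, rfl⟩
  · simp only [hA, Finset.mem_image, forall_exists_index, and_imp]
    rintro _ ω hω rfl i
    refine ⟨ω + Finsupp.single i 1, (hmem _).2 ⟨ω, hω, le_self_add⟩, ?_⟩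
    ext j
    by_cases h : j = i
    · subst h; simp [expPt, natPt]
    · simp [expPt, natPt, h]
  · rintro _ ⟨ω, hω, rfl⟩
    obtain ⟨a, ha, h⟩ := (hmem ω).1 hω
    refine ⟨a, Finset.mem_image_of_mem _ ha, fun i => ?_⟩
    have := h i
    simpa [expPt, natPt] using this

end NewtonPolyhedra

/-! ### Summation over the lattice points of a simplicial cone. -/

section Series

/-- Induction on the index type: adjoining one index multiplies two absolutely convergent series. -/
theorem hasSum_pi_prod {ι : Type} [Fintype ι] (f : ι → ℕ → ℂ)
    (hf : ∀ i, Summable fun m => ‖f i m‖) :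
    (Summable fun m : ι → ℕ => ‖∏ i, f i (m i)‖) ∧
      HasSum (fun m : ι → ℕ => ∏ i, f i (m i)) (∏ i, ∑' m, f i m) := by
  let P : ∀ (ι : Type) [Fintype ι], Prop := fun ι _ => ∀ f : ι → ℕ → ℂ,
    (∀ i, Summable fun m => ‖f i m‖) → (Summable fun m : ι → ℕ => ‖∏ i, f i (m i)‖) ∧
      HasSum (fun m : ι → ℕ => ∏ i, f i (m i)) (∏ i, ∑' m, f i m)
  suffices h : P ι from h f hf
  apply Fintype.induction_empty_option (P := P)
  · intro α β _ e ih f hf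
    let _ := Fintype.ofEquiv _ e.symm
    obtain ⟨h1, h2⟩ := ih (fun i => f (e i)) fun i => hf (e i)
    have key : ∀ m : α → ℕ, ∏ i, f (e i) (m i) = ∏ i, f i (m (e.symm i)) := fun m => by
      rw [← e.prod_comp]
      simp
    have key2 := e.prod_comp fun i => ∑' m, f i m
    rw [key2] at h2
    simp only [key] at h1 h2
    refine ⟨?_, ?_⟩
    · rw [← (e.arrowCongr (Equiv.refl ℕ)).summable_iff]
      exact h1
    · rw [← (e.arrowCongr (Equiv.refl ℕ)).hasSum_iff]
      exact h2
  · intro f _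
    simp only [Finset.univ_eq_empty, Finset.prod_empty]
    refine ⟨Summable.of_finite, ?_⟩
    have := hasSum_fintype (fun _ : PEmpty.{1} → ℕ => (1 : ℂ))
    rwa [Fintype.sum_unique] at this
  · intro α _ ih f hf
    obtain ⟨h1, h2⟩ := ih (fun i => f (some i)) fun i => hf (some i)
    have hs := Summable.mul_norm (hf none) h1
    have hs2 := (hf none).of_norm.hasSum.mul h2 (Summable.of_norm hs)
    have key : ∀ q : ℕ × (α → ℕ), ∏ i, f i ((Equiv.piOptionEquivProd
        (β := fun _ : Option α => ℕ)).symm q i) = f none q.1 * ∏ i, f (some i) (q.2 i) := by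
      intro q
      rw [Fintype.prod_option]
      rfl
    constructor
    · rw [← (Equiv.piOptionEquivProd (β := fun _ : Option α => ℕ)).symm.summable_iff]
      exact hs.congr fun q => by simp only [Function.comp, key]
    · rw [← (Equiv.piOptionEquivProd (β := fun _ : Option α => ℕ)).symm.hasSum_iff,
        Fintype.prod_option]
      have e : (fun m : Option α → ℕ => ∏ i, f i (m i)) ∘
          (Equiv.piOptionEquivProd (β := fun _ : Option α => ℕ)).symm =
            fun q => f none q.1 * ∏ i, f (some i) (q.2 i) := funext key
      rw [e]
      exact hs2

variable {n : ℕ}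

theorem coeff_eq_of_linearIndependent {B : Finset (Fin n → ℕ)}
    (hB : LinearIndependent ℝ (fun k : B => natPt (k : Fin n → ℕ))) {c d : (Fin n → ℕ) → ℝ}
    (h : ∑ b ∈ B, c b • natPt b = ∑ b ∈ B, d b • natPt b) : ∀ b ∈ B, c b = d b := by
  have h0 : ∑ b : B, (c b - d b) • natPt (b : Fin n → ℕ) = 0 := by
    rw [Finset.sum_coe_sort B fun b => (c b - d b) • natPt b]
    simp only [sub_smul, Finset.sum_sub_distrib, h, sub_self]
  exact fun b hb => sub_eq_zero.1 (Fintype.linearIndependent_iff.1 hB _ h0 ⟨b, hb⟩)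

/-- Every lattice point of the open cone is uniquely `∑ (m_b + 1) b - h` with `h` in the box. -/
theorem bijective_openCone {B : Finset (Fin n → ℕ)}
    (hB : LinearIndependent ℝ (fun k : B => natPt (k : Fin n → ℕ))) :
    ∃ F : (boxPoints B) × (B → ℕ) → {k : Fin n → ℕ // natPt k ∈ openCone B},
      Function.Bijective F ∧ ∀ q, natPt (F q).1 =
        ∑ b : B, ((q.2 b : ℝ) + 1) • natPt (b : Fin n → ℕ) - intPt q.1.1 := by
  classical
  have hbox : ∀ h : boxPoints B, ∃ l : (Fin n → ℕ) → ℝ, (∀ k ∈ B, 0 ≤ l k ∧ l k < 1) ∧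
    intPt h.1 = ∑ k ∈ B, l k • natPt k := fun h => h.2
  choose l hl hlh using hbox
  let ext : (B → ℕ) → (Fin n → ℕ) → ℝ := fun m b => if h : b ∈ B then (m ⟨b, h⟩ : ℝ) + 1 else 0
  have hext : ∀ m, ∑ b : B, ((m b : ℝ) + 1) • natPt (b : Fin n → ℕ) =
      ∑ b ∈ B, ext m b • natPt b := by
    intro m
    rw [← Finset.sum_coe_sort B fun b => ext m b • natPt b]
    exact Finset.sum_congr rfl fun b _ => by simp [ext]
  have hpt : ∀ q : (boxPoints B) × (B → ℕ),
      ∑ b : B, ((q.2 b : ℝ) + 1) • natPt (b : Fin n → ℕ) - intPt q.1.1 =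
        ∑ b ∈ B, (ext q.2 b - l q.1 b) • natPt b := by
    intro q
    rw [hext, hlh]
    simp only [sub_smul, Finset.sum_sub_distrib]
  have hpos : ∀ q : (boxPoints B) × (B → ℕ), ∀ b ∈ B, 0 < ext q.2 b - l q.1 b := by
    intro q b hb
    have h1 := (hl q.1 b hb).2
    have h2 : (0 : ℝ) ≤ q.2 ⟨b, hb⟩ := Nat.cast_nonneg _
    simp only [ext, hb, dif_pos]
    linarith
  have hnat : ∀ q : (boxPoints B) × (B → ℕ), ∃ k : Fin n → ℕ, natPt k =
      ∑ b : B, ((q.2 b : ℝ) + 1) • natPt (b : Fin n → ℕ) - intPt q.1.1 := by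
    intro q
    set z : Fin n → ℤ := fun i => ∑ b : B, ((q.2 b : ℤ) + 1) * (b : Fin n → ℕ) i - q.1.1 i with hz
    have hzR : ∀ i, (z i : ℝ) =
        (∑ b : B, ((q.2 b : ℝ) + 1) • natPt (b : Fin n → ℕ) - intPt q.1.1) i := by
      intro i
      simp [hz, natPt, intPt]
    refine ⟨fun i => (z i).toNat, ?_⟩
    ext i
    rw [← hzR]
    have : 0 ≤ z i := by
      have : (0 : ℝ) ≤ z i := by
        rw [hzR, hpt, Finset.sum_apply]
        exact Finset.sum_nonneg fun b hb => mul_nonneg (hpos q b hb).le (natPt_nonneg b i)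
      exact_mod_cast this
    have h2 : ((z i).toNat : ℤ) = z i := Int.toNat_of_nonneg this
    simp only [natPt]
    exact_mod_cast h2
  choose F hF using hnat
  refine ⟨fun q => ⟨F q, _, hpos q, (hF q).trans (hpt q)⟩, ⟨?_, ?_⟩, hF⟩
  · rintro q q' h
    have h1 : natPt (F q) = natPt (F q') := by rw [Subtype.mk.inj h]
    rw [hF, hF, hpt, hpt] at h1
    have h2 := coeff_eq_of_linearIndependent hB h1
    -- The coefficients `m + 1 - l` agree and the fractional parts `l` lie in `[0, 1)`, so the
    -- integers `m` differ by less than `1`.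
    have h3 : ∀ b (hb : b ∈ B), q.2 ⟨b, hb⟩ = q'.2 ⟨b, hb⟩ := by
      intro b hb
      have := h2 b hb
      simp only [ext, hb, dif_pos] at this
      obtain ⟨h4, h5⟩ := hl q.1 b hb
      obtain ⟨h4', h5'⟩ := hl q'.1 b hb
      have a1 : (q.2 ⟨b, hb⟩ : ℝ) < q'.2 ⟨b, hb⟩ + 1 := by linarith
      have a2 : (q'.2 ⟨b, hb⟩ : ℝ) < q.2 ⟨b, hb⟩ + 1 := by linarith
      have a1' : q.2 ⟨b, hb⟩ < q'.2 ⟨b, hb⟩ + 1 := by exact_mod_cast a1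
      have a2' : q'.2 ⟨b, hb⟩ < q.2 ⟨b, hb⟩ + 1 := by exact_mod_cast a2
      omega
    have h4 : q.2 = q'.2 := funext fun b => h3 b.1 b.2
    refine Prod.ext (Subtype.ext ?_) h4
    have h5 : intPt q.1.1 = intPt q'.1.1 := by
      rw [hlh, hlh]
      refine Finset.sum_congr rfl fun b hb => ?_
      have := h2 b hb
      rw [h4] at this
      rw [sub_right_inj.1 this]
    ext i
    have := congrFun h5 i
    simpa [intPt] using this
  · rintro ⟨k, c, hc, hk⟩
    -- Rounding up gives `c b = ⌈c b⌉ - (⌈c b⌉ - c b)` with remainder in `[0, 1)`; since `c b > 0`,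
    -- the ceiling is at least `1` and the truncated subtraction is exact.
    have hm : ∀ b : B, ((⌈c b⌉₊ - 1 : ℕ) : ℝ) + 1 = ⌈c b⌉₊ := by
      intro b
      have : 1 ≤ ⌈c b⌉₊ := Nat.one_le_ceil_iff.2 (hc b b.2)
      push_cast [Nat.cast_sub this]
      ring
    let h : Fin n → ℤ := fun i => ∑ b ∈ B, (⌈c b⌉₊ : ℤ) * b i - k i
    have hh : intPt h = ∑ b ∈ B, ((⌈c b⌉₊ : ℝ) - c b) • natPt b := by
      simp only [sub_smul, Finset.sum_sub_distrib, ← hk]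
      ext i
      simp [h, intPt, natPt]
    have hmem : h ∈ boxPoints B := by
      refine ⟨_, fun b hb => ?_, hh⟩
      have h1 := Nat.le_ceil (c b)
      have h2 := Nat.ceil_lt_add_one (hc b hb).le
      exact ⟨by linarith, by linarith⟩
    refine ⟨⟨⟨h, hmem⟩, fun b => ⌈c b⌉₊ - 1⟩, Subtype.ext (natPt_injective ?_)⟩
    rw [hF, hh]
    simp only [hm]
    rw [hk, Finset.sum_coe_sort B fun b => (⌈c b⌉₊ : ℝ) • natPt b, ← Finset.sum_sub_distrib]
    refine Finset.sum_congr rfl fun b _ => ?_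
    rw [← sub_smul, sub_sub_cancel]

/-- Each factor is a geometric series starting at exponent `1`, as the coefficients `m + 1` are
positive; this is why it sums to `1 / (p^z - 1)`. -/
theorem hasSum_prod_geometric {p : ℕ} (hp : 1 < p) {ι : Type} [Fintype ι] (z : ι → ℂ)
    (hz : ∀ i, 0 < (z i).re) :
    (Summable fun m : ι → ℕ => ‖(p : ℂ) ^ (-∑ i, ((m i : ℂ) + 1) * z i)‖) ∧
      HasSum (fun m : ι → ℕ => (p : ℂ) ^ (-∑ i, ((m i : ℂ) + 1) * z i))
        (∏ i, ((p : ℂ) ^ z i - 1)⁻¹) := by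
  have hp0 : (p : ℂ) ≠ 0 := by exact_mod_cast (by omega : p ≠ 0)
  have hnorm : ∀ i, ‖(p : ℂ) ^ (-z i)‖ < 1 := by
    intro i
    rw [Complex.norm_natCast_cpow_of_pos (by omega), Complex.neg_re]
    exact Real.rpow_lt_one_of_one_lt_of_neg (by exact_mod_cast hp) (neg_lt_zero.2 (hz i))
  have hgeom : ∀ i, ∑' m, ((p : ℂ) ^ (-z i)) ^ (m + 1) = ((p : ℂ) ^ z i - 1)⁻¹ := by
    intro i
    have h1 : (p : ℂ) ^ (-z i) ≠ 0 := by simp [hp0]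
    have h2 : (p : ℂ) ^ z i = ((p : ℂ) ^ (-z i))⁻¹ := by rw [Complex.cpow_neg, inv_inv]
    have h3 : 1 - (p : ℂ) ^ (-z i) ≠ 0 := by
      intro h
      have := hnorm i
      rw [← sub_eq_zero.1 h] at this
      simp at this
    simp only [pow_succ']
    rw [tsum_mul_left, tsum_geometric_of_norm_lt_one (hnorm i), h2]
    have h4 : ((p : ℂ) ^ (-z i))⁻¹ - 1 = (1 - (p : ℂ) ^ (-z i)) / (p : ℂ) ^ (-z i) := by field_simp
    rw [h4, inv_div, div_eq_mul_inv]
  have hterm : ∀ m : ι → ℕ, ∏ i, ((p : ℂ) ^ (-z i)) ^ (m i + 1) =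
      (p : ℂ) ^ (-∑ i, ((m i : ℂ) + 1) * z i) := by
    intro m
    rw [Complex.cpow_def_of_ne_zero hp0, ← Finset.sum_neg_distrib, Finset.mul_sum, Complex.exp_sum]
    refine Finset.prod_congr rfl fun i _ => ?_
    rw [← Complex.cpow_nat_mul, Complex.cpow_def_of_ne_zero hp0]
    push_cast
    ring_nf
  have := hasSum_pi_prod (fun i m => ((p : ℂ) ^ (-z i)) ^ (m + 1)) fun i => by
    simp only [norm_pow]
    exact (summable_nat_add_iff 1).2 (summable_geometric_of_lt_one (norm_nonneg _) (hnorm i))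
  simpa only [hterm, hgeom] using this

/-- By linearity of `φ`, the term at `∑ (m_b + 1) b - h` splits into `p^{φ(h)}` and a product of
geometric terms. The box point is subtracted, so it enters with a positive exponent. -/
theorem hasSum_openCone {p : ℕ} (hp : 1 < p) {B : Finset (Fin n → ℕ)}
    (hB : LinearIndependent ℝ (fun k : B => natPt (k : Fin n → ℕ)))
    (φ : (Fin n → ℝ) →ₗ[ℝ] ℂ) (hφ : ∀ b ∈ B, 0 < (φ (natPt b)).re) :
    HasSum (fun k : {k : Fin n → ℕ // natPt k ∈ openCone B} => (p : ℂ) ^ (-φ (natPt k.1)))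
      ((∑ h ∈ (boxPoints_finite B).toFinset, (p : ℂ) ^ φ (intPt h)) /
        ∏ b ∈ B, ((p : ℂ) ^ φ (natPt b) - 1)) := by
  classical
  have hp0 : (p : ℂ) ≠ 0 := by exact_mod_cast (by omega : p ≠ 0)
  obtain ⟨F, hF, hFq⟩ := bijective_openCone hB
  have : Fintype (boxPoints B) := (boxPoints_finite B).fintype
  obtain ⟨hs1, hs2⟩ := hasSum_prod_geometric hp (fun b : B => φ (natPt (b : Fin n → ℕ)))
    fun b => hφ b b.2
  have hfin := hasSum_fintype fun h : boxPoints B => (p : ℂ) ^ φ (intPt h.1)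
  have hn := (hasSum_fintype fun h : boxPoints B => ‖(p : ℂ) ^ φ (intPt h.1)‖).summable
  have hprod := hfin.mul hs2 (hn.mul_norm hs1).of_norm
  have e1 : ∑ h : boxPoints B, (p : ℂ) ^ φ (intPt h.1) =
      ∑ h ∈ (boxPoints_finite B).toFinset, (p : ℂ) ^ φ (intPt h) :=
    (Finset.sum_subtype _ (fun h => (boxPoints_finite B).mem_toFinset)
      fun h => (p : ℂ) ^ φ (intPt h)).symm
  have e2 : ∏ b : B, ((p : ℂ) ^ φ (natPt (b : Fin n → ℕ)) - 1)⁻¹ =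
      (∏ b ∈ B, ((p : ℂ) ^ φ (natPt b) - 1))⁻¹ := by
    rw [Finset.prod_coe_sort B fun b => ((p : ℂ) ^ φ (natPt b) - 1)⁻¹, Finset.prod_inv_distrib]
  rw [e1, e2, ← div_eq_mul_inv] at hprod
  rw [← (Equiv.ofBijective F hF).hasSum_iff]
  have key : ∀ q : boxPoints B × (B → ℕ), (p : ℂ) ^ (-φ (natPt (F q).1)) =
      (p : ℂ) ^ φ (intPt q.1.1) *
        (p : ℂ) ^ (-∑ b : B, ((q.2 b : ℂ) + 1) * φ (natPt (b : Fin n → ℕ))) := by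
    intro q
    rw [hFq, map_sub, map_sum, neg_sub, sub_eq_add_neg, Complex.cpow_add _ _ hp0]
    simp only [map_smul, Complex.real_smul]
    push_cast
    rfl
  have hfun : ((fun k : {k : Fin n → ℕ // natPt k ∈ openCone B} => (p : ℂ) ^ (-φ (natPt k.1))) ∘
      (Equiv.ofBijective F hF)) = fun q : boxPoints B × (B → ℕ) => (p : ℂ) ^ φ (intPt q.1.1) *
        (p : ℂ) ^ (-∑ b : B, ((q.2 b : ℂ) + 1) * φ (natPt (b : Fin n → ℕ))) :=
    funext fun q => key q
  rw [hfun]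
  exact hprod

end Series

/-! ### Linearity of `m_Γ` on cones with constant locus. -/

section ConeLinear

variable {n : ℕ} {Γ Γ' : Set (Fin n → ℝ)} {A A' : Finset (Fin n → ℕ)}

/-- On the closure of an open cone on which the first meet locus is constant, `m_Γ` is linear. -/
theorem exists_mVal_linear (hΓ : IsNewton Γ A) {B : Finset (Fin n → ℕ)}
    (hB : ∀ x ∈ openCone B, ∀ y ∈ openCone B, firstMeetLocus Γ x = firstMeetLocus Γ y) :
    ∃ z : Fin n → ℝ, ∀ l : (Fin n → ℕ) → ℝ, (∀ b ∈ B, 0 ≤ l b) →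
      mVal Γ (∑ b ∈ B, l b • natPt b) = (∑ b ∈ B, l b • natPt b) ⬝ᵥ z := by
  classical
  have h1 : ∑ b ∈ B, natPt b ∈ openCone B := ⟨fun _ => 1, by simp, by simp⟩
  obtain ⟨a, -, ha⟩ := hΓ.exists_mem_locus (nonneg_of_mem_openCone h1)
  refine ⟨natPt a, fun l hl => mVal_eq_of_forall_le ha.1 fun y hy => ?_⟩
  have hb : ∀ b ∈ B, natPt b ⬝ᵥ natPt a ≤ natPt b ⬝ᵥ y := by
    intro b hb
    by_contra! hcon
    set d := natPt b ⬝ᵥ natPt a - natPt b ⬝ᵥ y with hd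
    have hd0 : 0 < d := sub_pos.2 hcon
    set e := (∑ b ∈ B, natPt b) ⬝ᵥ y - (∑ b ∈ B, natPt b) ⬝ᵥ natPt a with he
    -- If `y` beat `a` on the generator `b`, adding a large multiple of `b` to the sum of the
    -- generators would make `y` beat `a` there, although `a` stays in the common locus. This `t`
    -- gives `t * d = |e| + 1 > e`.
    set t : ℝ := (|e| + 1) / d with ht
    have ht0 : 0 < t := by positivity
    have hmem : ∑ b ∈ B, natPt b + t • natPt b ∈ openCone B := by
      refine ⟨fun c => 1 + if c = b then t else 0, fun c _ => ?_, ?_⟩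
      · beta_reduce
        split_ifs <;> linarith
      · simp [add_smul, Finset.sum_add_distrib, ite_smul, hb]
    rw [hB _ h1 _ hmem] at ha
    have h2 := hΓ.mVal_le (nonneg_of_mem_openCone hmem) hy
    rw [← ha.2, add_dotProduct, add_dotProduct, smul_dotProduct, smul_dotProduct, smul_eq_mul,
      smul_eq_mul] at h2
    have h3 : t * d ≤ e := by
      rw [hd, he, mul_sub]
      linarith
    rw [ht, div_mul_cancel₀ _ hd0.ne'] at h3
    linarith [le_abs_self e]
  simp only [sum_dotProduct, smul_dotProduct, smul_eq_mul]
  exact Finset.sum_le_sum fun b hbB => mul_le_mul_of_nonneg_left (hb b hbB) (hl b hbB)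

end ConeLinear

/-! ### The closed expression for the series of a cone. -/

section ClosedForm

variable {p : ℕ} [Fact p.Prime] {n : ℕ} {I : Ideal (MvPolynomial (Fin n) ℤ_[p])}
  {g : MvPolynomial (Fin n) ℤ_[p]} {A A' : Finset (Fin n → ℕ)}

theorem one_le_sigma {v : Fin n → ℕ} (hv : IsPrimitive v) : 1 ≤ sigma (natPt v) := by
  obtain ⟨i, hi⟩ := exists_pos_of_isPrimitive hv
  have h1 : (1 : ℝ) ≤ natPt v i := by
    have : 1 ≤ v i := hi
    simpa [natPt] using this
  exact h1.trans (Finset.single_le_sum (fun j _ => natPt_nonneg v j) (Finset.mem_univ i))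

theorem expo_re (I : Ideal (MvPolynomial (Fin n) ℤ_[p])) (g : MvPolynomial (Fin n) ℤ_[p]) (s : ℂ)
    (k : Fin n → ℝ) : (expo I g s k).re =
      mVal (newtonIdeal I) k * s.re + mVal (newton g) k + sigma k := by
  simp [expo]

/-- The contribution of `σ` is at least `1` and the others are nonnegative. Both convergence and the
nonvanishing of the denominators rest on this. -/
theorem expo_re_pos (hI : IsNewton (newtonIdeal I) A) (hg : IsNewton (newton g) A') {s : ℂ}
    (hs : 0 < s.re) {v : Fin n → ℕ} (hv : IsPrimitive v) : 0 < (expo I g s (natPt v)).re := by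
  rw [expo_re]
  have h1 := mul_nonneg (hI.mVal_nonneg (natPt_nonneg v)) hs.le
  have h2 := hg.mVal_nonneg (natPt_nonneg v)
  have h3 := one_le_sigma hv
  linarith

theorem one_lt_prime : 1 < p := (Fact.out : p.Prime).one_lt

theorem cpow_sub_one_ne_zero {z : ℂ} (hz : 0 < z.re) : (p : ℂ) ^ z - 1 ≠ 0 := by
  intro h
  have h1 : ‖(p : ℂ) ^ z‖ = 1 := by rw [sub_eq_zero.1 h]; simp
  rw [Complex.norm_natCast_cpow_of_pos (by have := one_lt_prime (p := p); omega)] at h1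
  exact (Real.one_lt_rpow (by exact_mod_cast one_lt_prime (p := p)) hz).ne' h1

/-- The agreement extends to the closed cone, since generators and box points lie on its boundary in
general. -/
theorem exists_expo_linear (hI : IsNewton (newtonIdeal I) A) (hg : IsNewton (newton g) A')
    {δ : Set (Fin n → ℝ)} (hδ : δ ∈ cones I g) {B : Finset (Fin n → ℕ)} (hB : openCone B ⊆ δ)
    (s : ℂ) : ∃ φ : (Fin n → ℝ) →ₗ[ℝ] ℂ, ∀ l : (Fin n → ℕ) → ℝ, (∀ b ∈ B, 0 ≤ l b) →
      φ (∑ b ∈ B, l b • natPt b) = expo I g s (∑ b ∈ B, l b • natPt b) := by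
  have hmem : ∀ x ∈ openCone B, ∀ y ∈ openCone B, x ∈ cell (newtonIdeal I) (newton g) y :=
    fun x hx y hy => eq_cell_of_mem hδ (hB hy) ▸ hB hx
  obtain ⟨z, hz⟩ := exists_mVal_linear hI (B := B) fun x hx y hy =>
    (mem_cell_iff.1 (hmem x hx y hy)).2.1
  obtain ⟨w, hw⟩ := exists_mVal_linear hg (B := B) fun x hx y hy =>
    (mem_cell_iff.1 (hmem x hx y hy)).2.2
  refine ⟨Fintype.linearCombination ℝ fun i => (z i : ℂ) * s + w i + 1, fun l hl => ?_⟩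
  rw [expo, hz l hl, hw l hl, Fintype.linearCombination_apply]
  simp only [dotProduct, sigma, Complex.real_smul, mul_add, Finset.sum_add_distrib, mul_one]
  push_cast
  simp only [Finset.sum_mul, mul_assoc]

theorem natPt_eq_sum_single {B : Finset (Fin n → ℕ)} {b : Fin n → ℕ} (hb : b ∈ B) :
    ∃ l : (Fin n → ℕ) → ℝ, (∀ c ∈ B, 0 ≤ l c) ∧ ∑ c ∈ B, l c • natPt c = natPt b := by
  classical
  refine ⟨fun c => if c = b then 1 else 0, fun c _ => ?_, ?_⟩
  · beta_reduce
    split_ifs <;> norm_num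
  · simp [ite_smul, hb]

theorem hasSum_STerm (hI : IsNewton (newtonIdeal I) A) (hg : IsNewton (newton g) A')
    {δ : Set (Fin n → ℝ)} (hδ : δ ∈ cones I g) {T : Finset (Finset (Fin n → ℕ))}
    (hT : IsSimplicialPartition δ T) {s : ℂ} (hs : 0 < s.re) :
    HasSum (STerm I g δ s) (SClosed I g T s) := by
  classical
  have hBδ : ∀ B ∈ T, openCone B ⊆ δ := fun B hB => by
    rw [← hT.iUnion_eq]
    exact Set.subset_biUnion_of_mem (u := openCone) hB
  set f : (Fin n → ℕ) → ℂ := fun k => (p : ℂ) ^ (-expo I g s (natPt k)) with hf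
  have hsum : ∀ B ∈ T, HasSum (Set.indicator {k | natPt k ∈ openCone B} f)
      ((∑ h ∈ (boxPoints_finite B).toFinset, (p : ℂ) ^ expo I g s (intPt h)) /
        ∏ k ∈ B, ((p : ℂ) ^ expo I g s (natPt k) - 1)) := by
    intro B hB
    obtain ⟨φ, hφ⟩ := exists_expo_linear hI hg hδ (hBδ B hB) s
    have hφb : ∀ b ∈ B, φ (natPt b) = expo I g s (natPt b) := fun b hb => by
      obtain ⟨l, hl, hlb⟩ := natPt_eq_sum_single hb
      rw [← hlb]
      exact hφ l hl
    have h1 := hasSum_openCone (one_lt_prime (p := p)) (hT.linearIndependent B hB) φ fun b hb => by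
      rw [hφb b hb]
      exact expo_re_pos hI hg hs (hT.primitive B hB b hb)
    have e1 : ∑ h ∈ (boxPoints_finite B).toFinset, (p : ℂ) ^ φ (intPt h) =
        ∑ h ∈ (boxPoints_finite B).toFinset, (p : ℂ) ^ expo I g s (intPt h) := by
      refine Finset.sum_congr rfl fun h hh => ?_
      obtain ⟨l, hl, hlh⟩ := (boxPoints_finite B).mem_toFinset.1 hh
      rw [hlh, hφ l fun b hb => (hl b hb).1]
    have e2 : ∏ k ∈ B, ((p : ℂ) ^ φ (natPt k) - 1) =
        ∏ k ∈ B, ((p : ℂ) ^ expo I g s (natPt k) - 1) :=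
      Finset.prod_congr rfl fun b hb => by rw [hφb b hb]
    rw [e1, e2] at h1
    rw [← hasSum_subtype_iff_indicator]
    have e3 : (f ∘ Subtype.val : {k | natPt k ∈ openCone B} → ℂ) =
        fun k => (p : ℂ) ^ (-φ (natPt k.1)) := by
      ext ⟨k, l, hl, hk⟩
      simp only [hf, Function.comp]
      rw [hk, hφ l fun b hb => (hl b hb).le]
    rw [e3]
    exact h1
  have htot := hasSum_sum hsum
  have e4 : STerm I g δ s = (f ∘ Subtype.val : {k | natPt k ∈ δ} → ℂ) := rfl
  rw [e4]
  refine hasSum_subtype_iff_indicator.2 ?_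
  -- Each lattice point of `δ` lies in exactly one of the simplicial cones.
  have e5 : Set.indicator {k | natPt k ∈ δ} f =
      fun k => ∑ B ∈ T, Set.indicator {k | natPt k ∈ openCone B} f k := by
    ext k
    by_cases hk : natPt k ∈ δ
    · have hk' := hk
      rw [← hT.iUnion_eq] at hk'
      obtain ⟨B, hB, hkB⟩ := Set.mem_iUnion₂.1 hk'
      rw [Finset.sum_eq_single B]
      · rw [Set.indicator_of_mem (by exact hk), Set.indicator_of_mem (by exact hkB)]
      · intro B' hB' hne
        refine Set.indicator_of_notMem (fun h => ?_) _
        exact Set.disjoint_left.1 (hT.pairwiseDisjoint hB' hB hne) h hkB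
      · exact fun h => absurd hB h
    · rw [Set.indicator_of_notMem (by exact hk), Finset.sum_eq_zero]
      intro B hB
      refine Set.indicator_of_notMem (fun h => ?_) _
      exact hk (hBδ B hB h)
  rw [e5]
  exact htot

end ClosedForm

/-! ### Rationality in `p^{-s}`. -/

section Rational

variable {p : ℕ}

/-- `f` is, for `Re s > 0`, a rational function of `p^{-s}` with rational coefficients. -/
def IsRational (p : ℕ) (f : ℂ → ℂ) : Prop :=
  ∃ P Q : Polynomial ℚ, ∀ s : ℂ, 0 < s.re → Polynomial.aeval ((p : ℂ) ^ (-s)) Q ≠ 0 ∧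
    f s = Polynomial.aeval ((p : ℂ) ^ (-s)) P / Polynomial.aeval ((p : ℂ) ^ (-s)) Q

namespace IsRational

variable {f h : ℂ → ℂ}

theorem const (c : ℚ) : IsRational p fun _ => (c : ℂ) :=
  ⟨Polynomial.C c, 1, fun s _ => by simp⟩

theorem add (hf : IsRational p f) (hh : IsRational p h) : IsRational p fun s => f s + h s := by
  obtain ⟨P, Q, H⟩ := hf
  obtain ⟨P', Q', H'⟩ := hh
  refine ⟨P * Q' + Q * P', Q * Q', fun s hs => ?_⟩
  obtain ⟨h1, h2⟩ := H s hs
  obtain ⟨h1', h2'⟩ := H' s hs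
  refine ⟨by simp [h1, h1'], ?_⟩
  beta_reduce
  rw [h2, h2', div_add_div _ _ h1 h1']
  simp

theorem mul (hf : IsRational p f) (hh : IsRational p h) : IsRational p fun s => f s * h s := by
  obtain ⟨P, Q, H⟩ := hf
  obtain ⟨P', Q', H'⟩ := hh
  refine ⟨P * P', Q * Q', fun s hs => ?_⟩
  obtain ⟨h1, h2⟩ := H s hs
  obtain ⟨h1', h2'⟩ := H' s hs
  refine ⟨by simp [h1, h1'], ?_⟩
  beta_reduce
  rw [h2, h2', div_mul_div_comm]
  simp

theorem inv (hf : IsRational p f) (h0 : ∀ s : ℂ, 0 < s.re → f s ≠ 0) :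
    IsRational p fun s => (f s)⁻¹ := by
  obtain ⟨P, Q, H⟩ := hf
  refine ⟨Q, P, fun s hs => ?_⟩
  obtain ⟨h1, h2⟩ := H s hs
  refine ⟨fun h => h0 s hs (by rw [h2, h, zero_div]), ?_⟩
  beta_reduce
  rw [h2, inv_div]

theorem sum {ι : Type*} (t : Finset ι) {f : ι → ℂ → ℂ} (hf : ∀ i ∈ t, IsRational p (f i)) :
    IsRational p fun s => ∑ i ∈ t, f i s := by
  classical
  induction t using Finset.induction_on with
  | empty => simpa using const (p := p) 0
  | insert a t ha ih =>
    simp only [Finset.sum_insert ha]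
    exact (hf a (Finset.mem_insert_self a t)).add
      (ih fun i hi => hf i (Finset.mem_insert_of_mem hi))

theorem prod {ι : Type*} (t : Finset ι) {f : ι → ℂ → ℂ} (hf : ∀ i ∈ t, IsRational p (f i)) :
    IsRational p fun s => ∏ i ∈ t, f i s := by
  classical
  induction t using Finset.induction_on with
  | empty => simpa using const (p := p) 1
  | insert a t ha ih =>
    simp only [Finset.prod_insert ha]
    exact (hf a (Finset.mem_insert_self a t)).mul
      (ih fun i hi => hf i (Finset.mem_insert_of_mem hi))

theorem natCast_cpow (hp : p ≠ 0) (m c : ℕ) :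
    IsRational p fun s => (p : ℂ) ^ ((m : ℂ) * s + c) := by
  have hp0 : (p : ℂ) ≠ 0 := by exact_mod_cast hp
  -- In the variable `X = p^{-s}` the function `p^{ms+c}` is `p^c / X^m`.
  refine ⟨Polynomial.C ((p : ℚ) ^ c), Polynomial.X ^ m, fun s _ => ⟨by simp [hp0], ?_⟩⟩
  simp only [map_pow, Polynomial.aeval_X]
  rw [Complex.cpow_add _ _ hp0, Complex.cpow_natCast, Complex.cpow_nat_mul, Complex.cpow_neg,
    inv_pow, div_inv_eq_mul, mul_comm]
  simp

end IsRational

variable [Fact p.Prime] {n : ℕ} {I : Ideal (MvPolynomial (Fin n) ℤ_[p])}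
  {g : MvPolynomial (Fin n) ℤ_[p]} {A A' : Finset (Fin n → ℕ)}

theorem exists_nat_expo (hI : IsNewton (newtonIdeal I) A) (hg : IsNewton (newton g) A')
    (k : Fin n → ℕ) : ∃ m c : ℕ, mVal (newtonIdeal I) (natPt k) = m ∧
      mVal (newton g) (natPt k) + sigma (natPt k) = c ∧
      ∀ s, expo I g s (natPt k) = (m : ℂ) * s + c := by
  obtain ⟨m, hm⟩ := hI.exists_nat_mVal k
  obtain ⟨c, hc⟩ := hg.exists_nat_mVal k
  refine ⟨m, c + ∑ i, k i, hm, by rw [hc]; simp [sigma, natPt], fun s => ?_⟩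
  rw [expo, hm, hc]
  simp [sigma, natPt, add_assoc]

theorem exists_natPt_eq_intPt {B : Finset (Fin n → ℕ)} {h : Fin n → ℤ} (hh : h ∈ boxPoints B) :
    ∃ k : Fin n → ℕ, intPt h = natPt k := by
  obtain ⟨l, hl, hlh⟩ := hh
  refine ⟨fun i => (h i).toNat, funext fun i => ?_⟩
  have h0 : (0 : ℝ) ≤ (h i : ℝ) := by
    have := congrFun hlh i
    rw [Finset.sum_apply] at this
    simp only [intPt] at this
    rw [this]
    exact Finset.sum_nonneg fun b hb => mul_nonneg (hl b hb).1 (natPt_nonneg b i)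
  have h1 : ((h i).toNat : ℤ) = h i := Int.toNat_of_nonneg (by exact_mod_cast h0)
  simp only [intPt, natPt]
  exact_mod_cast h1.symm

theorem isRational_SClosed (hI : IsNewton (newtonIdeal I) A) (hg : IsNewton (newton g) A')
    {T : Finset (Finset (Fin n → ℕ))} (hT : ∀ B ∈ T, ∀ b ∈ B, IsPrimitive b) :
    IsRational p (SClosed I g T) := by
  have hp0 : p ≠ 0 := (Fact.out : p.Prime).ne_zero
  have hexp : ∀ k : Fin n → ℕ, IsRational p fun s => (p : ℂ) ^ expo I g s (natPt k) := by
    intro k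
    obtain ⟨m, c, -, -, h⟩ := exists_nat_expo hI hg k
    simp only [h]
    exact IsRational.natCast_cpow hp0 m c
  refine IsRational.sum T fun B hB => ?_
  simp only [div_eq_mul_inv]
  refine (IsRational.sum _ fun h hh => ?_).mul ((IsRational.prod B fun b _ => ?_).inv ?_)
  · obtain ⟨k, hk⟩ := exists_natPt_eq_intPt ((boxPoints_finite B).mem_toFinset.1 hh)
    simp only [hk]
    exact hexp k
  · simpa [sub_eq_add_neg] using (hexp b).add (IsRational.const (-1))
  · exact fun s hs => Finset.prod_ne_zero_iff.2 fun b hb =>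
      cpow_sub_one_ne_zero (expo_re_pos hI hg hs (hT B hB b hb))

end Rational

/-! ### Meromorphic continuation and candidate poles. -/

section Poles

variable {p : ℕ} [Fact p.Prime] {n : ℕ} {I : Ideal (MvPolynomial (Fin n) ℤ_[p])}
  {g : MvPolynomial (Fin n) ℤ_[p]} {A A' : Finset (Fin n → ℕ)}

theorem analyticAt_cpow_expo (k : Fin n → ℝ) (s : ℂ) :
    AnalyticAt ℂ (fun s => (p : ℂ) ^ expo I g s k) s := by
  have hp0 : (p : ℂ) ≠ 0 := by exact_mod_cast (Fact.out : p.Prime).ne_zero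
  have : (fun s => (p : ℂ) ^ expo I g s k) = fun s => Complex.exp (Complex.log p * expo I g s k) :=
    funext fun s => Complex.cpow_def_of_ne_zero hp0 _
  rw [this]
  unfold expo
  fun_prop

theorem meromorphic_SClosed (T : Finset (Finset (Fin n → ℕ))) : Meromorphic (SClosed I g T) := by
  intro s
  unfold SClosed
  refine MeromorphicAt.fun_sum fun B _ => MeromorphicAt.fun_div ?_ ?_
  · exact MeromorphicAt.fun_sum fun h _ => (analyticAt_cpow_expo _ s).meromorphicAt
  · exact MeromorphicAt.fun_prod fun b _ =>
      ((analyticAt_cpow_expo _ s).sub analyticAt_const).meromorphicAt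

theorem analyticAt_SClosed {T : Finset (Finset (Fin n → ℕ))} {s : ℂ}
    (h : ∀ B ∈ T, ∀ b ∈ B, (p : ℂ) ^ expo I g s (natPt b) - 1 ≠ 0) :
    AnalyticAt ℂ (SClosed I g T) s := by
  unfold SClosed
  refine Finset.analyticAt_fun_sum _ fun B hB => AnalyticAt.fun_div ?_ ?_ ?_
  · exact Finset.analyticAt_fun_sum _ fun h _ => analyticAt_cpow_expo _ s
  · exact Finset.analyticAt_fun_prod _ fun b _ => (analyticAt_cpow_expo _ s).sub analyticAt_const
  · exact Finset.prod_ne_zero_iff.2 fun b hb => h B hB b hb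

/-- Identity theorem: the difference has infinite order at `1`, hence at every point of the
connected plane. -/
theorem eventuallyEq_of_eqOn_re_pos {f h : ℂ → ℂ} (hf : Meromorphic f) (hh : Meromorphic h)
    (heq : ∀ s : ℂ, 0 < s.re → f s = h s) (s : ℂ) : f =ᶠ[nhdsWithin s {s}ᶜ] h := by
  have hd : Meromorphic (f - h) := hf.sub hh
  have h1 : meromorphicOrderAt (f - h) 1 = ⊤ := by
    rw [meromorphicOrderAt_eq_top_iff]
    have hopen : IsOpen {z : ℂ | 0 < z.re} := isOpen_lt continuous_const Complex.continuous_re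
    filter_upwards [nhdsWithin_le_nhds (hopen.mem_nhds (by simp : (1 : ℂ) ∈ {z : ℂ | 0 < z.re}))]
      with z hz
    simp [heq z hz]
  have h2 : meromorphicOrderAt (f - h) s = ⊤ := by
    by_contra hne
    exact (meromorphicOn_univ.2 hd).meromorphicOrderAt_ne_top_of_isPreconnected
      isPreconnected_univ (Set.mem_univ s) (Set.mem_univ 1) hne h1
  rw [meromorphicOrderAt_eq_top_iff] at h2
  filter_upwards [h2] with z hz
  exact sub_eq_zero.1 hz

/-- Taking absolute values, `p^z = 1` forces `Re z = 0`. If `m_I(k)` were zero, that real part would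
be `m_g(k) + σ(k) ≥ 1`. -/
theorem re_of_mem_candidatePoles (hg : IsNewton (newton g) A')
    {s : ℂ} {k : Fin n → ℕ} (hk : IsPrimitive k) (h : (p : ℂ) ^ expo I g s (natPt k) - 1 = 0) :
    mVal (newtonIdeal I) (natPt k) ≠ 0 ∧
      s.re = -((mVal (newton g) (natPt k) + sigma (natPt k)) / mVal (newtonIdeal I) (natPt k)) := by
  have h1 : ‖(p : ℂ) ^ expo I g s (natPt k)‖ = 1 := by rw [sub_eq_zero.1 h]; simp
  have hp := one_lt_prime (p := p)
  rw [Complex.norm_natCast_cpow_of_pos (by omega)] at h1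
  have hp1 : (1 : ℝ) < p := by exact_mod_cast hp
  have h2 : (expo I g s (natPt k)).re = 0 := by
    rcases lt_trichotomy (expo I g s (natPt k)).re 0 with h | h | h
    · exact absurd h1 (Real.rpow_lt_one_of_one_lt_of_neg hp1 h).ne
    · exact h
    · exact absurd h1 (Real.one_lt_rpow hp1 h).ne'
  rw [expo_re] at h2
  have h3 := hg.mVal_nonneg (natPt_nonneg k)
  have h4 := one_le_sigma hk
  have h5 : mVal (newtonIdeal I) (natPt k) ≠ 0 := by
    intro h0
    rw [h0] at h2
    linarith
  refine ⟨h5, ?_⟩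
  field_simp
  linarith

theorem mem_candidatePoles_of_eq {k : Fin n → ℕ} (hk : IsRayGenerator (cones I g) k)
    (h0 : mVal (newtonIdeal I) (natPt k) ≠ 0) :
    ((-((mVal (newton g) (natPt k) + sigma (natPt k)) / mVal (newtonIdeal I) (natPt k)) : ℝ) : ℂ) ∈
      candidatePoles I g := by
  refine ⟨k, hk, ?_⟩
  have : expo I g ((-((mVal (newton g) (natPt k) + sigma (natPt k)) /
      mVal (newtonIdeal I) (natPt k)) : ℝ) : ℂ) (natPt k) = 0 := by
    have h0' : (mVal (newtonIdeal I) (natPt k) : ℂ) ≠ 0 := by exact_mod_cast h0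
    rw [expo]
    push_cast
    field_simp
    ring
  rw [this]
  simp

end Poles

/-! ### Haar measure on `ℤ_pⁿ` and averaging along one coordinate. -/

section PadicMeasure

variable {p : ℕ} [Fact p.Prime] {n : ℕ}

variable (p) in
/-- The Haar measure on `ℤ_p` of total mass one. -/
def haarOne : Measure ℤ_[p] := Measure.addHaarMeasure ⊤

instance : (haarOne p).IsAddHaarMeasure := by unfold haarOne; infer_instance

instance : IsProbabilityMeasure (haarOne p) := by
  refine ⟨?_⟩
  have := Measure.addHaarMeasure_self (K₀ := (⊤ : TopologicalSpace.PositiveCompacts ℤ_[p]))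
  simpa [haarOne] using this

instance : (haar p n).IsAddHaarMeasure := by unfold haar; infer_instance

instance : IsProbabilityMeasure (haar p n) := by
  refine ⟨?_⟩
  have := Measure.addHaarMeasure_self
    (K₀ := (⊤ : TopologicalSpace.PositiveCompacts (Fin n → ℤ_[p])))
  simpa [haar] using this

theorem haar_eq_pi : haar p n = Measure.pi fun _ => haarOne p :=
  Measure.isAddHaarMeasure_eq_of_isProbabilityMeasure _ _

theorem prime_pos_real : (0 : ℝ) < p := by exact_mod_cast (Fact.out : p.Prime).pos

theorem norm_le_iff_pow_dvd (x : ℤ_[p]) (j : ℕ) : ‖x‖ ≤ ((p : ℝ) ^ j)⁻¹ ↔ (p : ℤ_[p]) ^ j ∣ x := by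
  rw [← Ideal.mem_span_singleton, ← PadicInt.norm_le_pow_iff_mem_span_pow, zpow_neg, zpow_natCast]

theorem isClosed_pow_dvd_sub (c : ℤ_[p]) (j : ℕ) : IsClosed {t : ℤ_[p] | (p : ℤ_[p]) ^ j ∣ t - c} := by
  simp only [← norm_le_iff_pow_dvd]
  exact isClosed_le (by fun_prop) continuous_const

theorem measurableSet_pow_dvd (j : ℕ) : MeasurableSet {t : ℤ_[p] | (p : ℤ_[p]) ^ j ∣ t} := by
  simpa using (isClosed_pow_dvd_sub (0 : ℤ_[p]) j).measurableSet

theorem haarOne_pow_dvd_sub_eq (c : ℤ_[p]) (j : ℕ) :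
    haarOne p {t | (p : ℤ_[p]) ^ j ∣ t - c} = haarOne p {t | (p : ℤ_[p]) ^ j ∣ t} := by
  have := measure_preimage_add_right (haarOne p) (-c) {t | (p : ℤ_[p]) ^ j ∣ t}
  simpa [sub_eq_add_neg] using this

/-- The `p^j` residue classes are translates of one another and have total mass one. -/
theorem haarOne_pow_dvd_sub (c : ℤ_[p]) (j : ℕ) :
    haarOne p {t | (p : ℤ_[p]) ^ j ∣ t - c} = ((p : ENNReal) ^ j)⁻¹ := by
  have hp := (Fact.out : p.Prime)
  have hfib : ∀ b : ZMod (p ^ j), ∃ c : ℤ_[p],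
      PadicInt.toZModPow j ⁻¹' {b} = {t | (p : ℤ_[p]) ^ j ∣ t - c} := by
    intro b
    obtain ⟨c, rfl⟩ := ZMod.ringHom_surjective (PadicInt.toZModPow j : ℤ_[p] →+* ZMod (p ^ j)) b
    refine ⟨c, ?_⟩
    ext t
    rw [Set.mem_preimage, Set.mem_singleton_iff, Set.mem_ofPred_eq, ← Ideal.mem_span_singleton,
      ← PadicInt.ker_toZModPow, RingHom.mem_ker, map_sub, sub_eq_zero]
  have : NeZero (p ^ j) := ⟨pow_ne_zero _ hp.ne_zero⟩
  have hsum := sum_measure_preimage_singleton (μ := haarOne p) (Finset.univ : Finset (ZMod (p ^ j)))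
    (f := (PadicInt.toZModPow j : ℤ_[p] →+* ZMod (p ^ j))) fun b _ => by
      obtain ⟨c, hc⟩ := hfib b
      rw [hc]
      exact (isClosed_pow_dvd_sub c j).measurableSet
  have hall : ∀ b : ZMod (p ^ j), haarOne p ((PadicInt.toZModPow j : ℤ_[p] →+* ZMod (p ^ j)) ⁻¹' {b}) =
      haarOne p {t | (p : ℤ_[p]) ^ j ∣ t} := by
    intro b
    obtain ⟨c, hc⟩ := hfib b
    rw [hc, haarOne_pow_dvd_sub_eq]
  simp only [hall, Finset.coe_univ, Set.preimage_univ, measure_univ, Finset.sum_const,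
    Finset.card_univ, ZMod.card, nsmul_eq_mul, Nat.cast_pow] at hsum
  rw [haarOne_pow_dvd_sub_eq]
  exact ENNReal.eq_inv_of_mul_eq_one_left (by rw [mul_comm]; exact hsum)

theorem haarOne_real_pow_dvd (j : ℕ) :
    (haarOne p).real {t | (p : ℤ_[p]) ^ j ∣ t} = ((p : ℝ) ^ j)⁻¹ := by
  have := haarOne_pow_dvd_sub (0 : ℤ_[p]) j
  simp only [sub_zero] at this
  rw [measureReal_def, this]
  simp

theorem haar_real_box (c : Fin n → ℤ_[p]) (j : Fin n → ℕ) :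
    (haar p n).real {x | ∀ i, (p : ℤ_[p]) ^ j i ∣ x i - c i} = ((p : ℝ) ^ ∑ i, j i)⁻¹ := by
  have : {x : Fin n → ℤ_[p] | ∀ i, (p : ℤ_[p]) ^ j i ∣ x i - c i} =
      Set.univ.pi fun i => {t | (p : ℤ_[p]) ^ j i ∣ t - c i} := by
    ext x
    simp
  rw [measureReal_def, this, haar_eq_pi, Measure.pi_pi]
  simp only [haarOne_pow_dvd_sub, ENNReal.toReal_prod]
  simp [Finset.prod_pow_eq_pow_sum]

theorem tendsto_inv_pow_prime : Filter.Tendsto (fun j : ℕ => ((p : ℝ) ^ j)⁻¹) Filter.atTop (nhds 0) := by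
  have h1 : (1 : ℝ) < p := by exact_mod_cast one_lt_prime (p := p)
  simpa only [inv_pow] using tendsto_pow_atTop_nhds_zero_of_lt_one (inv_nonneg.2 prime_pos_real.le)
    (inv_lt_one_of_one_lt₀ h1)

theorem ae_ne_zero : ∀ᵐ x ∂(haar p n), ∀ i, x i ≠ 0 := by
  rw [ae_all_iff]
  intro i
  have : NullSingletonClass (haarOne p) := by
    refine ⟨fun c => ?_⟩
    have hle : ∀ j : ℕ, (haarOne p).real {c} ≤ ((p : ℝ) ^ j)⁻¹ := by
      intro j
      rw [← haarOne_real_pow_dvd j, measureReal_def, measureReal_def,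
        ← haarOne_pow_dvd_sub_eq c j]
      refine ENNReal.toReal_mono (measure_ne_top _ _) (measure_mono ?_)
      rintro _ rfl
      simp
    have := ge_of_tendsto' tendsto_inv_pow_prime hle
    rw [measureReal_def] at this
    exact (ENNReal.toReal_eq_zero_iff _).1 (le_antisymm this ENNReal.toReal_nonneg) |>.resolve_right
      (measure_ne_top _ _)
  rw [haar_eq_pi]
  exact Measure.ae_eval_ne _ i 0

theorem norm_of_dvd_of_not_dvd {t : ℤ_[p]} {j : ℕ} (h1 : (p : ℤ_[p]) ^ j ∣ t)
    (h2 : ¬ (p : ℤ_[p]) ^ (j + 1) ∣ t) : ‖t‖ = ((p : ℝ) ^ j)⁻¹ := by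
  obtain ⟨u, rfl⟩ := h1
  have hu : ‖u‖ = 1 := by
    refine le_antisymm (PadicInt.norm_le_one u) (not_lt.1 fun h => h2 ?_)
    rw [pow_succ]
    exact mul_dvd_mul_left _ ((PadicInt.norm_lt_one_iff_dvd u).1 h)
  rw [norm_mul, hu, mul_one, norm_pow, PadicInt.norm_p, inv_pow]

theorem integrable_norm (μ : Measure ℤ_[p]) [IsFiniteMeasure μ] : Integrable (fun t : ℤ_[p] => ‖t‖) μ :=
  Integrable.of_bound continuous_norm.aestronglyMeasurable 1
    (Filter.Eventually.of_forall fun t => by simpa using PadicInt.norm_le_one t)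

/-- The integral of `|t|` over `p^j ℤ_p`. -/
theorem integral_norm_pow_dvd (j : ℕ) : ∫ t in {t : ℤ_[p] | (p : ℤ_[p]) ^ j ∣ t}, ‖t‖ ∂(haarOne p) =
    ((p : ℝ) ^ j)⁻¹ ^ 2 * (p / (p + 1)) := by
  have hp := prime_pos_real (p := p)
  set J : ℕ → ℝ := fun j => ∫ t in {t : ℤ_[p] | (p : ℤ_[p]) ^ j ∣ t}, ‖t‖ ∂(haarOne p) with hJ
  have hsub : ∀ j, {t : ℤ_[p] | (p : ℤ_[p]) ^ (j + 1) ∣ t} ⊆ {t | (p : ℤ_[p]) ^ j ∣ t} :=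
    fun j t ht => (pow_dvd_pow _ (Nat.le_succ j)).trans ht
  have hstep : ∀ j, J j - J (j + 1) = ((p : ℝ) ^ j)⁻¹ * (((p : ℝ) ^ j)⁻¹ - ((p : ℝ) ^ (j + 1))⁻¹) := by
    intro j
    rw [hJ]
    beta_reduce
    rw [← setIntegral_sdiff (measurableSet_pow_dvd (j + 1)) (integrable_norm _).integrableOn (hsub j),
      setIntegral_congr_fun (g := fun _ => ((p : ℝ) ^ j)⁻¹)
        ((measurableSet_pow_dvd j).diff (measurableSet_pow_dvd (j + 1)))
        (fun t ht => norm_of_dvd_of_not_dvd ht.1 ht.2), setIntegral_const,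
      measureReal_sdiff (hsub j) (measurableSet_pow_dvd (j + 1)), haarOne_real_pow_dvd,
      haarOne_real_pow_dvd, smul_eq_mul, mul_comm]
  -- The claimed value satisfies the same recursion as `J`, so the difference does not depend on
  -- `j`; it tends to zero and therefore vanishes.
  have hconst : ∀ j, J j - ((p : ℝ) ^ j)⁻¹ ^ 2 * (p / (p + 1)) = J 0 - p / (p + 1) := by
    intro j
    induction j with
    | zero => simp
    | succ j ih =>
      rw [← ih]
      have h := hstep j
      have h2 : J (j + 1) = J j - ((p : ℝ) ^ j)⁻¹ * (((p : ℝ) ^ j)⁻¹ - ((p : ℝ) ^ (j + 1))⁻¹) := by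
        linarith
      rw [h2, pow_succ]
      have := hp.ne'
      field_simp
      ring
  have hlim : Filter.Tendsto (fun j => J j - ((p : ℝ) ^ j)⁻¹ ^ 2 * (p / (p + 1))) Filter.atTop
      (nhds (0 - 0 ^ 2 * ((p : ℝ) / (p + 1)))) := by
    refine Filter.Tendsto.sub ?_ ((tendsto_inv_pow_prime.pow 2).mul_const _)
    refine squeeze_zero (fun j => integral_nonneg fun t => norm_nonneg t) (fun j => ?_)
      (tendsto_inv_pow_prime (p := p))
    calc J j ≤ ∫ _ in {t : ℤ_[p] | (p : ℤ_[p]) ^ j ∣ t}, (1 : ℝ) ∂(haarOne p) :=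
          setIntegral_mono (integrable_norm _).integrableOn (integrable_const _).integrableOn
            fun t => PadicInt.norm_le_one t
      _ = ((p : ℝ) ^ j)⁻¹ := by
          rw [setIntegral_const, haarOne_real_pow_dvd, smul_eq_mul, mul_one]
  simp only [hconst] at hlim
  have h0 := tendsto_nhds_unique hlim tendsto_const_nhds
  have := hconst j
  linarith

/-- Averaging over translations in one coordinate direction. -/
theorem integral_eq_of_average {C : Set (Fin n → ℤ_[p])} (hC : MeasurableSet C) {i : Fin n} {j : ℕ}
    (hCi : ∀ x, ∀ t : ℤ_[p], (p : ℤ_[p]) ^ j ∣ t → (x + Pi.single i t ∈ C ↔ x ∈ C))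
    {F : (Fin n → ℤ_[p]) → ℝ} (hF : Continuous F) (hF1 : ∀ x, ‖F x‖ ≤ 1) {c : ℝ}
    (hc : ∀ x ∈ C, ∫ t in {t : ℤ_[p] | (p : ℤ_[p]) ^ j ∣ t}, F (x + Pi.single i t) ∂(haarOne p) = c) :
    ((p : ℝ) ^ j)⁻¹ * ∫ x in C, F x ∂(haar p n) = (haar p n).real C * c := by
  set D := {t : ℤ_[p] | (p : ℤ_[p]) ^ j ∣ t} with hD
  have hDm : MeasurableSet D := measurableSet_pow_dvd j
  -- Fubini for `F(x + t e_i)`: integrating over `t` first gives `c`, while integrating over `x`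
  -- first gives, by translation invariance, a value independent of `t`.
  have hint : Integrable (Function.uncurry fun (x : Fin n → ℤ_[p]) (t : ℤ_[p]) => F (x + Pi.single i t))
      (((haar p n).restrict C).prod ((haarOne p).restrict D)) := by
    refine Integrable.of_bound (Continuous.aestronglyMeasurable ?_) 1
      (Filter.Eventually.of_forall fun q => hF1 _)
    exact hF.comp (continuous_fst.add ((continuous_single i).comp continuous_snd))
  have hswap := integral_integral_swap hint
  rw [setIntegral_congr_fun hC hc, setIntegral_const, smul_eq_mul] at hswap
  rw [hswap, ← haarOne_real_pow_dvd j, ← smul_eq_mul, ← setIntegral_const]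
  refine setIntegral_congr_fun hDm fun t ht => ?_
  rw [← integral_indicator hC, ← integral_indicator hC,
    ← integral_add_right_eq_self (C.indicator F) (Pi.single i t)]
  congr 1
  ext x
  by_cases hx : x ∈ C
  · rw [Set.indicator_of_mem hx, Set.indicator_of_mem ((hCi x t ht).2 hx)]
  · rw [Set.indicator_of_notMem hx, Set.indicator_of_notMem (mt (hCi x t ht).1 hx)]

end PadicMeasure

/-! ### The integral of `|g|` over one residue class of the torus. -/

section Local

variable {p : ℕ} [Fact p.Prime] {n : ℕ}

theorem toZMod_eq_zero_iff (x : ℤ_[p]) : PadicInt.toZMod x = 0 ↔ (p : ℤ_[p]) ∣ x := by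
  rw [← RingHom.mem_ker, PadicInt.ker_toZMod, PadicInt.maximalIdeal_eq_span_p,
    Ideal.mem_span_singleton]

theorem norm_eq_one_of_toZMod_ne_zero {x : ℤ_[p]} (h : PadicInt.toZMod x ≠ 0) : ‖x‖ = 1 := by
  refine le_antisymm (PadicInt.norm_le_one x) (not_lt.1 fun hlt => h ?_)
  rw [toZMod_eq_zero_iff, ← PadicInt.norm_lt_one_iff_dvd]
  exact hlt

/-- A polynomial with a simple root modulo `p` at the origin is isometric to `t - α` nearby. -/
theorem exists_norm_eval_eq_norm_sub (f : Polynomial ℤ_[p]) (h0 : (p : ℤ_[p]) ∣ f.eval 0)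
    (h1 : ¬ (p : ℤ_[p]) ∣ f.derivative.eval 0) :
    ∃ α : ℤ_[p], (p : ℤ_[p]) ∣ α ∧ ∀ t, (p : ℤ_[p]) ∣ t → ‖f.eval t‖ = ‖t - α‖ := by
  have hd : ‖f.derivative.eval 0‖ = 1 := norm_eq_one_of_toZMod_ne_zero fun h =>
    h1 ((toZMod_eq_zero_iff _).1 h)
  obtain ⟨α, hα, hα0, hαd, -⟩ := hensels_lemma (F := f) (a := (0 : ℤ_[p])) (by
    simp only [Polynomial.coe_aeval_eq_eval, hd]
    simpa using (PadicInt.norm_lt_one_iff_dvd _).2 h0)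
  simp only [Polynomial.coe_aeval_eq_eval, hd, sub_zero] at hα hα0 hαd
  have hpα : (p : ℤ_[p]) ∣ α := (PadicInt.norm_lt_one_iff_dvd _).1 hα0
  refine ⟨α, hpα, fun t ht => ?_⟩
  -- In `f = (X - α) q` the cofactor satisfies `q(t) ≡ q(α) = f'(α)` modulo `p`, a unit, so only `t
  -- - α` contributes to the norm.
  obtain ⟨q, hq⟩ := Polynomial.dvd_iff_isRoot.2 hα
  have hqα : q.eval α = f.derivative.eval α := by
    rw [hq]
    simp [Polynomial.derivative_mul]
  have hqt : ‖q.eval t‖ = 1 := by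
    apply norm_eq_one_of_toZMod_ne_zero
    intro h
    rw [toZMod_eq_zero_iff] at h
    have h2 : (p : ℤ_[p]) ∣ q.eval α := by
      have h3 : (p : ℤ_[p]) ∣ q.eval t - q.eval α :=
        ((dvd_sub ht hpα).trans (Polynomial.sub_dvd_eval_sub t α q))
      exact (dvd_sub_right h).1 h3
    rw [hqα, ← PadicInt.norm_lt_one_iff_dvd, hαd] at h2
    exact lt_irrefl _ h2
  rw [hq, Polynomial.eval_mul, norm_mul, hqt, mul_one]
  simp

/-- The restriction of a polynomial to a line in a coordinate direction. -/
def lineRestrict (u : Fin n → ℤ_[p]) (i : Fin n) (h : MvPolynomial (Fin n) ℤ_[p]) :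
    Polynomial ℤ_[p] :=
  aeval (fun j => Polynomial.C (u j) + if j = i then Polynomial.X else 0) h

theorem eval_lineRestrict (u : Fin n → ℤ_[p]) (i : Fin n) (h : MvPolynomial (Fin n) ℤ_[p])
    (t : ℤ_[p]) : (lineRestrict u i h).eval t = eval (u + Pi.single i t) h := by
  induction h using MvPolynomial.induction_on with
  | C a => simp [lineRestrict, Polynomial.algebraMap_eq]
  | add f g hf hg =>
    simp only [lineRestrict, map_add, Polynomial.eval_add] at hf hg ⊢
    rw [hf, hg]
  | mul_X f j hf =>
    simp only [lineRestrict, map_mul, Polynomial.eval_mul, aeval_X, eval_X] at hf ⊢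
    rw [hf]
    by_cases hj : j = i
    · subst hj; simp
    · simp [hj]

theorem derivative_lineRestrict (u : Fin n → ℤ_[p]) (i : Fin n)
    (h : MvPolynomial (Fin n) ℤ_[p]) :
    (lineRestrict u i h).derivative = lineRestrict u i (pderiv i h) := by
  induction h using MvPolynomial.induction_on with
  | C a => simp [lineRestrict, Polynomial.algebraMap_eq]
  | add f g hf hg =>
    simp only [lineRestrict, map_add] at hf hg ⊢
    rw [hf, hg]
  | mul_X f j hf =>
    simp only [lineRestrict, map_mul, Polynomial.derivative_mul, aeval_X, Derivation.leibniz,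
      smul_eq_mul, map_add] at hf ⊢
    rw [hf, pderiv_X]
    by_cases hj : j = i
    · subst hj
      simp
      ring
    · simp [hj]
      ring

/-- The pairing of exponents, as a natural number. -/
def natDot (k : Fin n → ℕ) (ω : Fin n →₀ ℕ) : ℕ := ∑ i, k i * ω i

theorem natPt_dotProduct_expPt (k : Fin n → ℕ) (ω : Fin n →₀ ℕ) :
    natPt k ⬝ᵥ expPt ω = natDot k ω := dotProduct_natPt k ω

/-- The polynomial `p^{-m} g(p^{k_1} x_1, …, p^{k_n} x_n)`. -/
def rescale (g : MvPolynomial (Fin n) ℤ_[p]) (k : Fin n → ℕ) (m : ℕ) :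
    MvPolynomial (Fin n) ℤ_[p] :=
  ∑ ω ∈ g.support, monomial ω (g.coeff ω * (p : ℤ_[p]) ^ (natDot k ω - m))

theorem expPt_mem_newton {g : MvPolynomial (Fin n) ℤ_[p]} {ω : Fin n →₀ ℕ} (hω : ω ∈ g.support) :
    expPt ω ∈ newton g :=
  subset_convexHull ℝ _ (Set.mem_iUnion₂.2 ⟨ω, hω, fun _ => le_rfl⟩)

/-- This makes the truncated subtraction in `rescale` exact. -/
theorem le_natDot {g : MvPolynomial (Fin n) ℤ_[p]} {k : Fin n → ℕ} {m : ℕ}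
    (hm : mVal (newton g) (natPt k) = m) {ω : Fin n →₀ ℕ} (hω : ω ∈ g.support) :
    m ≤ natDot k ω := by
  have hg : g ≠ 0 := by rintro rfl; simp at hω
  have := (isNewton_newton hg).mVal_le (natPt_nonneg k) (expPt_mem_newton hω)
  rw [hm, natPt_dotProduct_expPt] at this
  exact_mod_cast this

theorem eval_scaled {g : MvPolynomial (Fin n) ℤ_[p]} {k : Fin n → ℕ} {m : ℕ}
    (hm : mVal (newton g) (natPt k) = m) (u : Fin n → ℤ_[p]) :
    eval (fun i => (p : ℤ_[p]) ^ k i * u i) g = (p : ℤ_[p]) ^ m * eval u (rescale g k m) := by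
  rw [eval_eq', rescale, map_sum, Finset.mul_sum]
  refine Finset.sum_congr rfl fun ω hω => ?_
  rw [eval_monomial, Finsupp.prod_fintype _ _ (by simp)]
  have h1 : ∏ i, ((p : ℤ_[p]) ^ k i * u i) ^ ω i = (p : ℤ_[p]) ^ natDot k ω * ∏ i, u i ^ ω i := by
    simp only [mul_pow, Finset.prod_mul_distrib, ← pow_mul, Finset.prod_pow_eq_pow_sum, natDot]
  have h2 : (p : ℤ_[p]) ^ natDot k ω = (p : ℤ_[p]) ^ m * (p : ℤ_[p]) ^ (natDot k ω - m) := by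
    rw [← pow_add, Nat.add_sub_cancel' (le_natDot hm hω)]
  rw [h1, h2]
  ring

/-- Terms off the face keep a positive power of `p` and disappear modulo `p`. -/
theorem red_rescale {g : MvPolynomial (Fin n) ℤ_[p]} {k : Fin n → ℕ} {m : ℕ}
    (hm : mVal (newton g) (natPt k) = m) :
    red (rescale g k m) = red (facePoly g (firstMeetLocus (newton g) (natPt k))) := by
  classical
  simp only [red, rescale, facePoly, map_sum, map_monomial, Finset.sum_filter]
  refine Finset.sum_congr rfl fun ω hω => ?_
  have hmem : expPt ω ∈ firstMeetLocus (newton g) (natPt k) ↔ natDot k ω = m := by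
    constructor
    · rintro ⟨-, h⟩
      rw [hm, natPt_dotProduct_expPt] at h
      exact_mod_cast h
    · intro h
      refine ⟨expPt_mem_newton hω, ?_⟩
      rw [hm, natPt_dotProduct_expPt, h]
  by_cases h : natDot k ω = m
  · rw [if_pos (hmem.2 h), h]
    simp
  · rw [if_neg (mt hmem.1 h)]
    have h1 : natDot k ω - m ≠ 0 := by
      have := le_natDot hm hω
      omega
    rw [map_mul, map_pow]
    simp [h1]

theorem toZMod_eval (u : Fin n → ℤ_[p]) (a : Fin n → (ZMod p)ˣ)
    (hu : ∀ i, PadicInt.toZMod (u i) = (a i : ZMod p)) (h : MvPolynomial (Fin n) ℤ_[p]) :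
    PadicInt.toZMod (eval u h) = torusEval a (red h) := by
  rw [torusEval, red, map_eval]
  congr 2
  ext i
  exact hu i

theorem red_pderiv (i : Fin n) (h : MvPolynomial (Fin n) ℤ_[p]) :
    red (pderiv i h) = pderiv i (red h) := (pderiv_map).symm

/-- The points `(p^{k_1} u_1, …, p^{k_n} u_n)` with `u` congruent to `a` modulo `p`. -/
def torusClass (k : Fin n → ℕ) (a : Fin n → (ZMod p)ˣ) : Set (Fin n → ℤ_[p]) :=
  {x | ∀ i, (p : ℤ_[p]) ^ (k i + 1) ∣ x i - (p : ℤ_[p]) ^ k i * ((a i : ZMod p).val : ℤ_[p])}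

theorem mem_torusClass_iff {k : Fin n → ℕ} {a : Fin n → (ZMod p)ˣ} {x : Fin n → ℤ_[p]} :
    x ∈ torusClass k a ↔ ∃ u : Fin n → ℤ_[p], (∀ i, PadicInt.toZMod (u i) = (a i : ZMod p)) ∧
      x = fun i => (p : ℤ_[p]) ^ k i * u i := by
  have hval : ∀ i, PadicInt.toZMod (((a i : ZMod p).val : ℤ_[p])) = (a i : ZMod p) := by
    intro i
    rw [map_natCast, ZMod.natCast_zmod_val]
  constructor
  · intro hx
    choose v hv using hx
    refine ⟨fun i => ((a i : ZMod p).val : ℤ_[p]) + p * v i, fun i => ?_, funext fun i => ?_⟩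
    · rw [map_add, hval, map_mul]
      simp
    · have := hv i
      rw [sub_eq_iff_eq_add] at this
      rw [this]
      ring
  · rintro ⟨u, hu, rfl⟩ i
    rw [← mul_sub, pow_succ]
    refine mul_dvd_mul_left _ ?_
    rw [← toZMod_eq_zero_iff, map_sub, hu, hval, sub_self]

theorem measurableSet_torusClass (k : Fin n → ℕ) (a : Fin n → (ZMod p)ˣ) :
    MeasurableSet (torusClass k a) := by
  have : torusClass k a = Set.univ.pi fun i =>
      {t | (p : ℤ_[p]) ^ (k i + 1) ∣ t - (p : ℤ_[p]) ^ k i * ((a i : ZMod p).val : ℤ_[p])} := by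
    ext x
    simp [torusClass]
  rw [this]
  exact MeasurableSet.univ_pi fun i => (isClosed_pow_dvd_sub _ _).measurableSet

theorem haar_torusClass (k : Fin n → ℕ) (a : Fin n → (ZMod p)ˣ) :
    (haar p n).real (torusClass k a) = ((p : ℝ) ^ (∑ i, k i + n))⁻¹ := by
  rw [torusClass, haar_real_box]
  simp [Finset.sum_add_distrib]

theorem continuous_norm_eval (g : MvPolynomial (Fin n) ℤ_[p]) :
    Continuous fun x : Fin n → ℤ_[p] => ‖eval x g‖ := (MvPolynomial.continuous_eval g).norm

theorem norm_norm_le_one (z : ℤ_[p]) : ‖‖z‖‖ ≤ 1 := by simpa using PadicInt.norm_le_one z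

theorem norm_prime_pow (j : ℕ) : ‖(p : ℤ_[p]) ^ j‖ = ((p : ℝ) ^ j)⁻¹ := by
  rw [norm_pow, PadicInt.norm_p, inv_pow]

theorem integral_torusClass_of_ne_zero {g : MvPolynomial (Fin n) ℤ_[p]} {k : Fin n → ℕ} {m : ℕ}
    (hm : mVal (newton g) (natPt k) = m) {a : Fin n → (ZMod p)ˣ}
    (ha : torusEval a (red (facePoly g (firstMeetLocus (newton g) (natPt k)))) ≠ 0) :
    ∫ x in torusClass k a, ‖eval x g‖ ∂(haar p n) = ((p : ℝ) ^ (∑ i, k i + n))⁻¹ * ((p : ℝ) ^ m)⁻¹ := by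
  rw [setIntegral_congr_fun (g := fun _ => ((p : ℝ) ^ m)⁻¹) (measurableSet_torusClass k a),
    setIntegral_const, haar_torusClass, smul_eq_mul]
  intro x hx
  obtain ⟨u, hu, rfl⟩ := mem_torusClass_iff.1 hx
  beta_reduce
  rw [eval_scaled hm, norm_mul, norm_prime_pow, norm_eq_one_of_toZMod_ne_zero, mul_one]
  rw [toZMod_eval u a hu, red_rescale hm]
  exact ha

/-- In direction `i` the rescaled polynomial has a simple root modulo `p`, so `|g(x + t e_i)| =
p^{-m} p^{k_i} |t - p^{k_i} α|` for `t` in `p^{k_i+1} ℤ_p`. The mean of this over `t` is `p^{-m} /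
(p + 1)`, whatever `x` in the class. -/
theorem integral_torusClass_of_eq_zero {g : MvPolynomial (Fin n) ℤ_[p]} {k : Fin n → ℕ} {m : ℕ}
    (hm : mVal (newton g) (natPt k) = m) {a : Fin n → (ZMod p)ˣ}
    (ha : torusEval a (red (facePoly g (firstMeetLocus (newton g) (natPt k)))) = 0) {i : Fin n}
    (hi : torusEval a (pderiv i (red (facePoly g (firstMeetLocus (newton g) (natPt k))))) ≠ 0) :
    ∫ x in torusClass k a, ‖eval x g‖ ∂(haar p n) =
      ((p : ℝ) ^ (∑ i, k i + n))⁻¹ * ((p : ℝ) ^ m)⁻¹ * (1 / (p + 1)) := by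
  have hp := prime_pos_real (p := p)
  have hinv : ∀ x, ∀ t : ℤ_[p], (p : ℤ_[p]) ^ (k i + 1) ∣ t →
      (x + Pi.single i t ∈ torusClass k a ↔ x ∈ torusClass k a) := by
    intro x t ht
    refine forall_congr' fun j => ?_
    by_cases hj : j = i
    · subst hj
      rw [Pi.add_apply, Pi.single_eq_same, add_sub_right_comm]
      exact dvd_add_left ht
    · simp [hj]
  have hval : ∀ x ∈ torusClass k a, ∫ t in {t : ℤ_[p] | (p : ℤ_[p]) ^ (k i + 1) ∣ t},
      ‖eval (x + Pi.single i t) g‖ ∂(haarOne p) =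
        ((p : ℝ) ^ m)⁻¹ * (p : ℝ) ^ k i * (((p : ℝ) ^ (k i + 1))⁻¹ ^ 2 * (p / (p + 1))) := by
    intro x hx
    obtain ⟨u, hu, rfl⟩ := mem_torusClass_iff.1 hx
    obtain ⟨α, hα, hαt⟩ := exists_norm_eval_eq_norm_sub (lineRestrict u i (rescale g k m)) (by
        rw [eval_lineRestrict, ← toZMod_eq_zero_iff, Pi.single_zero, add_zero, toZMod_eval u a hu,
          red_rescale hm]
        exact ha) (by
        rw [derivative_lineRestrict, eval_lineRestrict, ← toZMod_eq_zero_iff, Pi.single_zero,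
          add_zero, toZMod_eval u a hu, red_pderiv, red_rescale hm]
        exact hi)
    have hnorm : ∀ t : ℤ_[p], (p : ℤ_[p]) ^ (k i + 1) ∣ t →
        ‖eval ((fun i => (p : ℤ_[p]) ^ k i * u i) + Pi.single i t) g‖ =
          ((p : ℝ) ^ m)⁻¹ * (p : ℝ) ^ k i * ‖t - (p : ℤ_[p]) ^ k i * α‖ := by
      rintro t ⟨v, rfl⟩
      have e1 : ((fun i => (p : ℤ_[p]) ^ k i * u i) +
          Pi.single i ((p : ℤ_[p]) ^ (k i + 1) * v) : Fin n → ℤ_[p]) =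
            fun j => (p : ℤ_[p]) ^ k j * (u + Pi.single i (p * v) : Fin n → ℤ_[p]) j := by
        ext j : 1
        by_cases hj : j = i
        · subst hj
          simp only [Pi.add_apply, Pi.single_eq_same]
          ring
        · simp [hj]
      have e2 : (p : ℤ_[p]) ^ (k i + 1) * v - (p : ℤ_[p]) ^ k i * α =
          (p : ℤ_[p]) ^ k i * (p * v - α) := by ring
      rw [e1, eval_scaled hm, norm_mul, norm_prime_pow, ← eval_lineRestrict,
        hαt _ (Dvd.intro _ rfl), e2, norm_mul, norm_prime_pow]
      field_simp
    rw [setIntegral_congr_fun (measurableSet_pow_dvd (k i + 1)) hnorm, integral_const_mul,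
      ← integral_norm_pow_dvd]
    congr 1
    have hDm := measurableSet_pow_dvd (p := p) (k i + 1)
    -- Since `p` divides `α`, translation by `p^{k_i} α` preserves `p^{k_i+1} ℤ_p`, and the root can
    -- be moved to the origin.
    rw [← integral_indicator hDm, ← integral_indicator hDm,
      ← integral_sub_right_eq_self
        (Set.indicator {t : ℤ_[p] | (p : ℤ_[p]) ^ (k i + 1) ∣ t} fun t => ‖t‖) ((p : ℤ_[p]) ^ k i * α)]
    congr 1
    ext t
    have hmem : (p : ℤ_[p]) ^ (k i + 1) ∣ (p : ℤ_[p]) ^ k i * α := by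
      rw [pow_succ]
      exact mul_dvd_mul_left _ hα
    have hiff : (p : ℤ_[p]) ^ (k i + 1) ∣ t - (p : ℤ_[p]) ^ k i * α ↔ (p : ℤ_[p]) ^ (k i + 1) ∣ t :=
      dvd_sub_left hmem
    by_cases ht : (p : ℤ_[p]) ^ (k i + 1) ∣ t
    · rw [Set.indicator_of_mem (by exact ht), Set.indicator_of_mem (by exact hiff.2 ht)]
    · rw [Set.indicator_of_notMem (by exact ht), Set.indicator_of_notMem (by exact mt hiff.1 ht)]
  have key := integral_eq_of_average (measurableSet_torusClass k a) hinv (continuous_norm_eval g)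
    (fun x => norm_norm_le_one _) hval
  rw [haar_torusClass] at key
  have hp' : (p : ℝ) ^ (k i + 1) ≠ 0 := by positivity
  rw [inv_mul_eq_iff_eq_mul₀ hp'] at key
  rw [key, pow_succ (p : ℝ) (k i)]
  field_simp

end Local

/-! ### Decomposition of the zeta integral into shells. -/

section Zeta

variable {p : ℕ} [Fact p.Prime] {n : ℕ} {I : Ideal (MvPolynomial (Fin n) ℤ_[p])}
  {g : MvPolynomial (Fin n) ℤ_[p]}

theorem norm_eq_of_mem_torusClass {k : Fin n → ℕ} {a : Fin n → (ZMod p)ˣ} {x : Fin n → ℤ_[p]}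
    (hx : x ∈ torusClass k a) (i : Fin n) : ‖x i‖ = ((p : ℝ) ^ k i)⁻¹ := by
  obtain ⟨u, hu, rfl⟩ := mem_torusClass_iff.1 hx
  beta_reduce
  rw [norm_mul, norm_prime_pow, norm_eq_one_of_toZMod_ne_zero, mul_one]
  rw [hu]
  exact (a i).ne_zero

theorem torusClass_index_eq {k l : Fin n → ℕ} {a b : Fin n → (ZMod p)ˣ} {x : Fin n → ℤ_[p]}
    (hx : x ∈ torusClass k a) (hx' : x ∈ torusClass l b) : k = l := by
  ext i
  have h := (norm_eq_of_mem_torusClass hx i).symm.trans (norm_eq_of_mem_torusClass hx' i)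
  have h1 : (1 : ℝ) < p := by exact_mod_cast one_lt_prime (p := p)
  exact (pow_right_injective₀ prime_pos_real h1.ne') (inv_injective h)

theorem torusClass_residue_eq {k : Fin n → ℕ} {a b : Fin n → (ZMod p)ˣ} {x : Fin n → ℤ_[p]}
    (hx : x ∈ torusClass k a) (hx' : x ∈ torusClass k b) : a = b := by
  obtain ⟨u, hu, hux⟩ := mem_torusClass_iff.1 hx
  obtain ⟨v, hv, hvx⟩ := mem_torusClass_iff.1 hx'
  ext i
  rw [← hu, ← hv]
  congr 1
  have h : (p : ℤ_[p]) ^ k i * u i = (p : ℤ_[p]) ^ k i * v i := congrFun (hux.symm.trans hvx) i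
  refine mul_left_cancel₀ (pow_ne_zero _ ?_) h
  exact_mod_cast (Fact.out : p.Prime).ne_zero

variable (p) in
/-- The points all of whose coordinates `x_i` have order `k_i`. -/
def shell (k : Fin n → ℕ) : Set (Fin n → ℤ_[p]) := ⋃ a, torusClass k a

theorem measurableSet_shell (k : Fin n → ℕ) : MeasurableSet (shell p k) :=
  MeasurableSet.iUnion fun a => measurableSet_torusClass k a

theorem pairwise_disjoint_shell :
    Pairwise (Function.onFun Disjoint fun k : Fin n → ℕ => shell p k) := by
  intro k l hkl
  refine Set.disjoint_left.2 fun x hx hx' => hkl ?_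
  obtain ⟨a, ha⟩ := Set.mem_iUnion.1 hx
  obtain ⟨b, hb⟩ := Set.mem_iUnion.1 hx'
  exact torusClass_index_eq ha hb

theorem ae_mem_iUnion_shell : ∀ᵐ x ∂(haar p n), x ∈ ⋃ k, shell p k := by
  filter_upwards [ae_ne_zero] with x hx
  refine Set.mem_iUnion.2 ⟨fun i => (x i).valuation, Set.mem_iUnion.2
    ⟨fun i => Units.map (PadicInt.toZMod : ℤ_[p] →+* ZMod p).toMonoidHom
      (PadicInt.unitCoeff (hx i)), mem_torusClass_iff.2
    ⟨fun i => PadicInt.unitCoeff (hx i), fun i => rfl, funext fun i => ?_⟩⟩⟩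
  conv_lhs => rw [PadicInt.unitCoeff_spec (hx i)]
  rw [mul_comm]

/-- The integral of `|g|` over a shell. -/
theorem integral_shell (hg0 : g ≠ 0) (hg : NonDegenerated g) {k : Fin n → ℕ} {m : ℕ}
    (hm : mVal (newton g) (natPt k) = m) :
    ((∫ x in shell p k, ‖eval x g‖ ∂(haar p n) : ℝ) : ℂ) =
      ((p : ℂ) ^ (∑ i, k i))⁻¹ * ((p : ℂ) ^ m)⁻¹ *
        L g (cell (newtonIdeal I) (newton g) (natPt k)) := by
  classical
  have hp := prime_pos_real (p := p)
  have hint : Integrable (fun x => ‖eval x g‖) (haar p n) :=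
    Integrable.of_bound (continuous_norm_eval g).aestronglyMeasurable 1
      (Filter.Eventually.of_forall fun x => norm_norm_le_one _)
  set P : (Fin n → (ZMod p)ˣ) → Prop := fun a =>
    torusEval a (red (facePoly g (firstMeetLocus (newton g) (natPt k)))) = 0 with hP
  have hclass : ∀ a, ∫ x in torusClass k a, ‖eval x g‖ ∂(haar p n) =
      ((p : ℝ) ^ (∑ i, k i + n))⁻¹ * ((p : ℝ) ^ m)⁻¹ * (if P a then (1 / (p + 1) : ℝ) else 1) := by
    intro a
    by_cases ha : P a
    · rw [if_pos ha]
      obtain ⟨i, hi⟩ : ∃ i, torusEval a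
          (pderiv i (red (facePoly g (firstMeetLocus (newton g) (natPt k))))) ≠ 0 := by
        by_contra! hcon
        exact hg _ ((isNewton_newton hg0).isFace_firstMeetLocus (natPt_nonneg k)) a ⟨ha, hcon⟩
      exact integral_torusClass_of_eq_zero hm ha hi
    · rw [if_neg ha, mul_one]
      exact integral_torusClass_of_ne_zero hm ha
  -- Each zero on the torus lowers the full count by `1 - 1/(p+1) = p/(p+1)`.
  have hsum : ∑ a, (if P a then (1 / (p + 1) : ℝ) else 1) = ((p : ℝ) - 1) ^ n -
      (Fintype.card {a // P a} : ℝ) * ((p : ℝ) / (p + 1)) := by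
    have h1 : ∀ a, (if P a then (1 / (p + 1) : ℝ) else 1) =
        1 - (if P a then 1 else 0) * ((p : ℝ) / (p + 1)) := by
      intro a
      split_ifs
      · field_simp
        ring
      · simp
    have h2 : (Fintype.card (Fin n → (ZMod p)ˣ) : ℝ) = ((p : ℝ) - 1) ^ n := by
      rw [Fintype.card_fun, ZMod.card_units p, Fintype.card_fin, Nat.cast_pow,
        Nat.cast_sub (one_lt_prime (p := p)).le, Nat.cast_one]
    simp only [h1, Finset.sum_sub_distrib, ← Finset.sum_mul, Finset.sum_const,
      Finset.card_univ, nsmul_eq_mul, mul_one, h2, Fintype.card_subtype]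
    rw [Finset.sum_boole]
  have hN : torusZeros g (cell (newtonIdeal I) (newton g) (natPt k)) = Fintype.card {a // P a} := by
    rw [torusZeros, conePoly, assocFace_cell (natPt_nonneg k), Nat.card_eq_fintype_card]
  rw [shell, integral_iUnion_fintype (fun a => measurableSet_torusClass k a)
    (fun a b hab => Set.disjoint_left.2 fun x hx hx' => hab (torusClass_residue_eq hx hx'))
    (fun a => hint.integrableOn)]
  simp only [hclass, ← Finset.mul_sum, hsum]
  rw [L, hN, pow_add]
  push_cast
  rw [mul_inv]
  ring

/-- The monomial with exponent `a` has norm `p^{-k·a}` on the shell, and the largest of these over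
the generators is `p^{-m}`. -/
theorem idealNorm_of_mem_shell {A : Finset (Fin n → ℕ)} (hA : IsNewton (newtonIdeal I) A)
    (hIA : I = Ideal.span (monom p '' (A : Set (Fin n → ℕ)))) {k : Fin n → ℕ} {m : ℕ}
    (hm : mVal (newtonIdeal I) (natPt k) = m) {x : Fin n → ℤ_[p]} (hx : x ∈ shell p k) :
    idealNorm I x = ((p : ℝ) ^ m)⁻¹ := by
  obtain ⟨c, hc⟩ := Set.mem_iUnion.1 hx
  obtain ⟨u, hu, rfl⟩ := mem_torusClass_iff.1 hc
  have hu1 : ∀ i, ‖u i‖ = 1 := fun i => norm_eq_one_of_toZMod_ne_zero (by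
    rw [hu]
    exact (c i).ne_zero)
  have hnorm : ∀ a : Fin n → ℕ, ‖eval (fun i => (p : ℤ_[p]) ^ k i * u i) (monom p a)‖ =
      ((p : ℝ) ^ ∑ i, k i * a i)⁻¹ := by
    intro a
    rw [monom, eval_monomial, Finsupp.prod_fintype _ _ (by simp)]
    simp [norm_prod, hu1, mul_pow, ← pow_mul, Finset.prod_pow_eq_pow_sum]
  have hle : ∀ a ∈ A, m ≤ ∑ i, k i * a i := by
    intro a ha
    have := hA.mVal_le (natPt_nonneg k) (hA.mem a ha)
    rw [hm, dotProduct_natPt] at this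
    exact_mod_cast this
  obtain ⟨a, ha, hma, -⟩ := hA.exists_mVal_eq (natPt_nonneg k)
  rw [hm, dotProduct_natPt] at hma
  have hma' : m = ∑ i, k i * a i := by exact_mod_cast hma
  obtain ⟨⟨f, hf, hfx⟩, hub⟩ := isGreatest_idealNorm I fun i => (p : ℤ_[p]) ^ k i * u i
  refine le_antisymm ?_ ?_
  · rw [← hfx]
    beta_reduce
    -- The polynomials whose value at the point is divisible by `p^m` form an ideal, so it suffices
    -- to test the generators.
    rw [norm_le_iff_pow_dvd, ← Ideal.mem_span_singleton, ← Ideal.mem_comap]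
    refine (?_ : I ≤ _) hf
    rw [hIA, Ideal.span_le]
    rintro _ ⟨b, hb, rfl⟩
    rw [SetLike.mem_coe, Ideal.mem_comap, Ideal.mem_span_singleton, ← norm_le_iff_pow_dvd, hnorm]
    have h1 : (1 : ℝ) ≤ p := by exact_mod_cast (one_lt_prime (p := p)).le
    exact inv_anti₀ (pow_pos prime_pos_real m) (pow_le_pow_right₀ h1 (hle b hb))
  · have hmem : monom p a ∈ I := by
      rw [hIA]
      exact Ideal.subset_span ⟨a, ha, rfl⟩
    have := hub ⟨_, hmem, rfl⟩
    beta_reduce at this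
    rwa [hnorm, ← hma'] at this

theorem ofReal_inv_pow_cpow (m : ℕ) (s : ℂ) :
    ((((p : ℝ) ^ m)⁻¹ : ℝ) : ℂ) ^ s = (p : ℂ) ^ (-((m : ℂ) * s)) := by
  have hp := prime_pos_real (p := p)
  have hp0 : (p : ℂ) ≠ 0 := by exact_mod_cast hp.ne'
  have h0 : ((((p : ℝ) ^ m)⁻¹ : ℝ) : ℂ) ≠ 0 := by
    rw [Complex.ofReal_ne_zero]
    positivity
  rw [Complex.cpow_def_of_ne_zero h0, Complex.cpow_def_of_ne_zero hp0,
    ← Complex.ofReal_log (by positivity), Real.log_inv, Real.log_pow, ← Complex.natCast_log]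
  congr 1
  push_cast
  ring

section

variable {A : Finset (Fin n → ℕ)} (hA : IsNewton (newtonIdeal I) A)
  (hIA : I = Ideal.span (monom p '' (A : Set (Fin n → ℕ))))
include hA hIA

theorem zetaIntegrand_of_mem_shell {k : Fin n → ℕ} {m : ℕ}
    (hm : mVal (newtonIdeal I) (natPt k) = m) (s : ℂ) {x : Fin n → ℤ_[p]} (hx : x ∈ shell p k) :
    zetaIntegrand I g s x = (p : ℂ) ^ (-((m : ℂ) * s)) * (‖eval x g‖ : ℂ) := by
  rw [zetaIntegrand, idealNorm_of_mem_shell hA hIA hm hx, ofReal_inv_pow_cpow]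

theorem integrable_zetaIntegrand {s : ℂ} (hs : 0 < s.re) :
    Integrable (zetaIntegrand I g s) (haar p n) := by
  have hrestrict : (haar p n).restrict (⋃ k, shell p k) = haar p n :=
    Measure.restrict_eq_self_of_ae_mem ae_mem_iUnion_shell
  refine Integrable.of_bound ?_ 1 ?_
  · rw [← hrestrict, aestronglyMeasurable_iUnion_iff]
    intro k
    obtain ⟨m, hm⟩ := hA.exists_nat_mVal k
    refine AEStronglyMeasurable.congr
      (f := fun x => (p : ℂ) ^ (-((m : ℂ) * s)) * (‖eval x g‖ : ℂ)) ?_ ?_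
    · exact (continuous_const.mul
        (Complex.continuous_ofReal.comp (continuous_norm_eval g))).aestronglyMeasurable
    · refine (ae_restrict_mem (measurableSet_shell k)).mono fun x hx => ?_
      exact (zetaIntegrand_of_mem_shell hA hIA hm s hx).symm
  · filter_upwards [ae_mem_iUnion_shell] with x hx
    obtain ⟨k, hk⟩ := Set.mem_iUnion.1 hx
    obtain ⟨m, hm⟩ := hA.exists_nat_mVal k
    rw [zetaIntegrand_of_mem_shell hA hIA hm s hk, norm_mul, Complex.norm_real,
      Complex.norm_natCast_cpow_of_pos (Fact.out : p.Prime).pos]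
    refine mul_le_one₀ ?_ (norm_nonneg _) (norm_norm_le_one _)
    refine Real.rpow_le_one_of_one_le_of_nonpos (by exact_mod_cast (one_lt_prime (p := p)).le) ?_
    simp only [Complex.neg_re, Complex.mul_re, Complex.natCast_re, Complex.natCast_im, zero_mul,
      sub_zero, Left.neg_nonpos_iff]
    positivity

theorem hasSum_zeta (hg0 : g ≠ 0) (hg : NonDegenerated g) {s : ℂ} (hs : 0 < s.re) :
    HasSum (fun k : Fin n → ℕ => L g (cell (newtonIdeal I) (newton g) (natPt k)) *
      (p : ℂ) ^ (-expo I g s (natPt k))) (zeta I g s) := by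
  have hrestrict : (haar p n).restrict (⋃ k, shell p k) = haar p n :=
    Measure.restrict_eq_self_of_ae_mem ae_mem_iUnion_shell
  have h := hasSum_integral_iUnion (μ := haar p n) (fun k => measurableSet_shell (p := p) k)
    pairwise_disjoint_shell (integrable_zetaIntegrand (g := g) hA hIA hs).integrableOn
  rw [hrestrict] at h
  have key : ∀ k : Fin n → ℕ, L g (cell (newtonIdeal I) (newton g) (natPt k)) *
      (p : ℂ) ^ (-expo I g s (natPt k)) = ∫ x in shell p k, zetaIntegrand I g s x ∂(haar p n) := by
    intro k
    obtain ⟨M, hM⟩ := hA.exists_nat_mVal k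
    obtain ⟨m, hm⟩ := (isNewton_newton hg0).exists_nat_mVal k
    have hp0 : (p : ℂ) ≠ 0 := by exact_mod_cast (Fact.out : p.Prime).ne_zero
    rw [setIntegral_congr_fun (measurableSet_shell k)
      (fun x hx => zetaIntegrand_of_mem_shell hA hIA hM s hx), integral_const_mul,
      integral_complex_ofReal, integral_shell (I := I) hg0 hg hm]
    have hσ : (sigma (natPt k) : ℂ) = ((∑ i, k i : ℕ) : ℂ) := by simp [sigma, natPt]
    have e : -expo I g s (natPt k) = -((M : ℂ) * s) + (-((∑ i, k i : ℕ) : ℂ) + -(m : ℂ)) := by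
      rw [expo, hM, hm, hσ]
      push_cast
      ring
    rw [e, Complex.cpow_add _ _ hp0, Complex.cpow_add _ _ hp0, Complex.cpow_neg _ (m : ℂ),
      Complex.cpow_neg _ ((∑ i, k i : ℕ) : ℂ), Complex.cpow_natCast, Complex.cpow_natCast]
    ring
  simp only [key]
  exact h

theorem zeta_eq_finsum (hg0 : g ≠ 0) (hg : NonDegenerated g) {s : ℂ} (hs : 0 < s.re)
    (hsum : ∀ δ ∈ cones I g, Summable (STerm I g δ s)) :
    zeta I g s = ∑ᶠ δ ∈ cones I g, L g δ * S I g δ s := by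
  classical
  have hfin : (cones I g).Finite := conePartition_finite hA (isNewton_newton hg0)
  rw [finsum_mem_eq_finite_toFinset_sum _ hfin]
  set f : (Fin n → ℕ) → ℂ := fun k => (p : ℂ) ^ (-expo I g s (natPt k)) with hf
  have h1 : ∀ δ ∈ hfin.toFinset, HasSum (fun k => L g δ * Set.indicator {k | natPt k ∈ δ} f k)
      (L g δ * S I g δ s) := by
    intro δ hδ
    have h := (hsum δ (hfin.mem_toFinset.1 hδ)).hasSum
    refine HasSum.mul_left _ ?_
    exact hasSum_subtype_iff_indicator.1 h
  refine (hasSum_zeta hA hIA hg0 hg hs).unique ?_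
  -- Only the cell of `k` contributes to the sum over `δ`, as `k` lies in no other member of the
  -- partition.
  convert hasSum_sum h1 using 2 with k
  have hk := cell_mem_conePartition hA (isNewton_newton hg0) (natPt_nonneg k)
  rw [Finset.sum_eq_single (cell (newtonIdeal I) (newton g) (natPt k))]
  · rw [Set.indicator_of_mem]
    exact mem_cell_self (natPt_nonneg k)
  · intro δ hδ hne
    rw [Set.indicator_of_notMem, mul_zero]
    exact fun h => hne (eq_cell_of_mem (hfin.mem_toFinset.1 hδ) h)
  · exact fun h => absurd (hfin.mem_toFinset.2 hk) h

end

end Zeta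

end MonomialZeta

end

/-! ### The main theorem. -/

open MonomialZeta in
theorem mainTheorem2 (p : ℕ) [Fact p.Prime] (n : ℕ)
    (I : Ideal (MvPolynomial (Fin n) ℤ_[p])) (hI : IsMonomialIdeal I)
    (hI_ne_bot : I ≠ ⊥) (hI_ne_top : I ≠ ⊤)
    (g : MvPolynomial (Fin n) ℤ_[p]) (hg_ne : g ≠ 0) (hg_zero : MvPolynomial.eval 0 g = 0)
    (hg : NonDegenerated g) :
    -- the formula for the zeta function
    ((cones I g).Finite ∧
      ∀ s : ℂ, 0 < s.re →
        MeasureTheory.Integrable (zetaIntegrand I g s) (haar p n) ∧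
        (∀ δ ∈ cones I g, Summable (STerm I g δ s)) ∧
        zeta I g s = ∑ᶠ δ ∈ cones I g, L g δ * S I g δ s) ∧
    -- simplicial partitions without new rays exist, and every simplicial partition into cones
    -- with primitive generators gives a closed expression of the series
    (∀ δ ∈ cones I g,
      (∃ T : Finset (Finset (Fin n → ℕ)), IsSimplicialPartition δ T ∧
        ∀ B ∈ T, ∀ k ∈ B, IsRayGenerator (cones I g) k) ∧
      (∀ T : Finset (Finset (Fin n → ℕ)), IsSimplicialPartition δ T →
        ∀ s : ℂ, 0 < s.re →
          (∀ B ∈ T, ∏ k ∈ B, ((p : ℂ) ^ expo I g s (natPt k) - 1) ≠ 0) ∧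
          S I g δ s = SClosed I g T s) ∧
      -- the series is rational in `p^{-s}`
      (∃ P Q : Polynomial ℚ, ∀ s : ℂ, 0 < s.re →
        Polynomial.aeval ((p : ℂ) ^ (-s)) Q ≠ 0 ∧
        S I g δ s = Polynomial.aeval ((p : ℂ) ^ (-s)) P / Polynomial.aeval ((p : ℂ) ^ (-s)) Q)) ∧
    -- the zeta function has a meromorphic continuation, all of whose poles are candidate poles
    (∃ Z : ℂ → ℂ, Meromorphic Z ∧ ∀ s : ℂ, 0 < s.re → Z s = zeta I g s) ∧
    (∀ Z : ℂ → ℂ, Meromorphic Z → (∀ s : ℂ, 0 < s.re → Z s = zeta I g s) →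
      ∀ s : ℂ, meromorphicOrderAt Z s < 0 → s ∈ candidatePoles I g) ∧
    -- the real parts of the candidate poles, which are rational numbers
    (Complex.re '' candidatePoles I g =
      {r | ∃ k : Fin n → ℕ, IsRayGenerator (cones I g) k ∧ mVal (newtonIdeal I) (natPt k) ≠ 0 ∧
        r = -((mVal (newton g) (natPt k) + sigma (natPt k)) /
          mVal (newtonIdeal I) (natPt k))}) ∧
    (∀ s ∈ candidatePoles I g, ∃ q : ℚ, s.re = (q : ℝ)) := by
  classical
  obtain ⟨A, hA, hIA⟩ := exists_isNewton_newtonIdeal hI hI_ne_bot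
  have hG := isNewton_newton hg_ne
  have hfin : (cones I g).Finite := conePartition_finite hA hG
  have hsimp : ∀ δ ∈ cones I g, ∃ T : Finset (Finset (Fin n → ℕ)), IsSimplicialPartition δ T ∧
      ∀ B ∈ T, ∀ k ∈ B, IsRayGenerator (cones I g) k :=
    fun δ hδ => exists_isSimplicialPartition hA hG hδ
  choose! T hT hTray using hsimp
  have hclosed : ∀ δ ∈ cones I g, ∀ U : Finset (Finset (Fin n → ℕ)), IsSimplicialPartition δ U →
      ∀ s : ℂ, 0 < s.re → S I g δ s = SClosed I g U s :=
    fun δ hδ U hU s hs => (hasSum_STerm hA hG hδ hU hs).tsum_eq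
  have hsum : ∀ s : ℂ, 0 < s.re → ∀ δ ∈ cones I g, Summable (STerm I g δ s) :=
    fun s hs δ hδ => (hasSum_STerm hA hG hδ (hT δ hδ) hs).summable
  have hzeta : ∀ s : ℂ, 0 < s.re → zeta I g s = ∑ᶠ δ ∈ cones I g, L g δ * S I g δ s :=
    fun s hs => zeta_eq_finsum hA hIA hg_ne hg hs (hsum s hs)
  -- The continuation uses partitions without new rays, so that its denominators involve only ray
  -- generators of the partition.
  set Z₀ : ℂ → ℂ := fun s => ∑ δ ∈ hfin.toFinset, L g δ * SClosed I g (T δ) s with hZ₀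
  have hmero : Meromorphic Z₀ := fun s => MeromorphicAt.fun_sum fun δ _ =>
    analyticAt_const.meromorphicAt.fun_mul (meromorphic_SClosed (T δ) s)
  have hZ₀zeta : ∀ s : ℂ, 0 < s.re → Z₀ s = zeta I g s := by
    intro s hs
    rw [hzeta s hs, finsum_mem_eq_finite_toFinset_sum _ hfin]
    refine Finset.sum_congr rfl fun δ hδ => ?_
    have hδ' := hfin.mem_toFinset.1 hδ
    rw [hclosed δ hδ' _ (hT δ hδ') s hs]
  refine ⟨⟨hfin, fun s hs => ⟨integrable_zetaIntegrand hA hIA hs, hsum s hs, hzeta s hs⟩⟩,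
    fun δ hδ => ⟨⟨T δ, hT δ hδ, hTray δ hδ⟩, fun U hU s hs => ⟨fun B hB => ?_, hclosed δ hδ U hU s hs⟩,
      ?_⟩, ⟨Z₀, hmero, hZ₀zeta⟩, fun Z hZ hZzeta s hs => ?_, ?_, ?_⟩
  · exact Finset.prod_ne_zero_iff.2 fun k hk =>
      cpow_sub_one_ne_zero (expo_re_pos hA hG hs (hU.primitive B hB k hk))
  · obtain ⟨P, Q, H⟩ := isRational_SClosed hA hG (hT δ hδ).primitive
    refine ⟨P, Q, fun s hs => ⟨(H s hs).1, ?_⟩⟩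
    rw [hclosed δ hδ _ (hT δ hδ) s hs]
    exact (H s hs).2
  · by_contra hcand
    have han : AnalyticAt ℂ Z₀ s := by
      refine Finset.analyticAt_fun_sum _ fun δ hδ => analyticAt_const.mul (analyticAt_SClosed ?_)
      exact fun B hB b hb h0 =>
        hcand ⟨b, hTray δ (hfin.mem_toFinset.1 hδ) B hB b hb, h0⟩
    -- An arbitrary continuation agrees with `Z₀` on a punctured neighbourhood of `s`, hence has the
    -- same order there.
    rw [meromorphicOrderAt_congr (eventuallyEq_of_eqOn_re_pos hZ hmero
      (fun z hz => (hZzeta z hz).trans (hZ₀zeta z hz).symm) s)] at hs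
    exact absurd han.meromorphicOrderAt_nonneg (not_le.2 hs)
  · ext r
    constructor
    · rintro ⟨s, ⟨k, hk, h0⟩, rfl⟩
      obtain ⟨h1, h2⟩ := re_of_mem_candidatePoles hG hk.1 h0
      exact ⟨k, hk, h1, h2⟩
    · rintro ⟨k, hk, h0, rfl⟩
      exact ⟨_, mem_candidatePoles_of_eq hk h0, Complex.ofReal_re _⟩
  · rintro s ⟨k, hk, h0⟩
    obtain ⟨-, h2⟩ := re_of_mem_candidatePoles hG hk.1 h0
    obtain ⟨m, c, hm, hc, -⟩ := exists_nat_expo hA hG k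
    refine ⟨-((c : ℚ) / m), ?_⟩
    rw [h2, hm, hc]
    push_cast
    rfl
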